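/- **Algebras and languages.** A *modal bi-Heyting algebra* is a bi-Heyting algebra $\mathbf A$ (with implication $\to$ and subtraction $-$, $u-v\le w\iff u\le v\vee w$) with unary operations $\Box,\Diamond$ preserving finite meets and finite joins, respectively. The language $\mathcal L_1$ consists of the terms built from $\bot,\top$, propositional variables and fixed point variables by $\wedge,\vee,\to,-,\Diamond,\Box$ and the binders $\mu X.t$, $\nu X.t$ with $t$ positive in $X$; $\mathcal L_2$ is the same with binders $\mu_2,\nu_2$. In $\mathbf A$, $\mu X.t(X)$ is the meet of $\{a\mid t(a)\le a\}$ and $\nu X.t(X)$ the join of $\{a\mid a\le t(a)\}$, if these exist; $\mu_2X.t$ is the join of the transfinite iterates $t^0=\bot$, $t^{\alpha+1}=t(t^\alpha)$, $t^\lambda=\bigvee_{\alpha<\lambda}t^\alpha$ and $\nu_2X.t$ the meet of the dual iterates starting at $\top$, if all of these exist. $\mathbf A$ is a *mu-algebra of the second kind* if every $\mathcal L_2$-term is defined for all values of its variables. An $\mathcal L_1$-inequality is $\phi\le\psi$ with $\phi,\psi\in\mathcal L_1$ having no free fixed point variables; $\mathbf A\models\phi\le\psi$ means that it holds under all assignments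 of elements of $\mathbf A$ to the propositional variables. **Canonical extension.** $\mathbf A^\delta$ is the (up to isomorphism over $\mathbf A$ unique) complete lattice containing $\mathbf A$ as a bounded sublattice such that every element is a join of meets and a meet of joins of elements of $A$, and such that for $S,T\subseteq A$, $\bigwedge S\le\bigvee T$ implies $\bigwedge S'\le\bigvee T'$ for some finite $S'\subseteq S$, $T'\subseteq T$. It carries its own $\to$ and $-$ (the residuals of $\wedge$ and $\vee$) and the modalities $\Box^\pi,\Diamond^\sigma$, where, with $k$ ranging over meets and $u$ over joins of subsets of $A$, $f^\sigma(c)=\bigvee\{\bigwedge\{f(a)\mid k\le a\le u\}\mid k\le c\le u\}$ and $f^\pi(c)=\bigwedge\{\bigvee\{f(a)\mid k\le a\le u\}\mid k\le c\le u\}$. In $\mathbf A^\delta$ the binders $\mu,\nu$ are interpreted as above, over all of $A^\delta$; $\mathbf A^\delta\models\phi\le\psi$ means that $\phi\le\psi$ holds under all assignments into $A^\delta$. A *perfect* modal bi-Heyting algebra is one on a completely distributive complete lattice whose completely join-irreducibles are join-dense and whose completely meet-irreducibles are meet-dense, with $\Box$ completely meet- and $\Diamond$ completely join-preserving. **The algorithm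 $\mu^*$-ALBA.** It works in the language extended by nominals $\mathbf i,\mathbf j$ (ranging over completely join-irreducibles), co-nominals $\mathbf m,\mathbf n$ (completely meet-irreducibles), the left adjoint $\blacklozenge$ of $\Box$ and the right adjoint $\blacksquare$ of $\Diamond$, with binders written $\mu^*,\nu^*$. Signs of occurrences are those in signed generation trees: $\to$ changes the sign in its first, $-$ in its second argument. A run on $\phi\le\psi$ consists of the following. 1. *Preprocessing*: with respect to $+$lhs and $-$rhs, distribute positive $\Diamond,\wedge$ over positive $\vee$ and negative $\Box,\vee$ over negative $\wedge$; split $\alpha\vee\beta\le\gamma$ into $\alpha\le\gamma$, $\beta\le\gamma$ and $\alpha\le\beta\wedge\gamma$ into $\alpha\le\beta$, $\alpha\le\gamma$; replace $\alpha(p)\le\beta(p)$ by $\alpha(\bot)\le\beta(\bot)$ if $\alpha$ is negative and $\beta$ positive in $p$, and by $\alpha(\top)\le\beta(\top)$ if $\alpha$ is positive and $\beta$ negative in $p$. 2. *Starring and first approximation*: replace $\mu,\nu$ by $\mu^*,\nu^*$ and each resulting $\alpha\le\beta$ by the quasi-inequality $\mathbf i\le\alpha\ \&\ \beta\le\mathbf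 m\Rightarrow\mathbf i\le\mathbf m$. 3. Finitely many applications, to inequalities in antecedents, of the following rules (with $\wedge,\vee$ up to commutativity and with newly introduced nominals and co-nominals fresh): * residuation: $\chi-\psi\le\phi\,/\,\chi\le\psi\vee\phi$; $\phi\le\chi\to\psi\,/\,\phi\wedge\chi\le\psi$; $\chi\wedge\psi\le\phi\,/\,\chi\le\psi\to\phi$; $\phi\le\chi\vee\psi\,/\,\phi-\chi\le\psi$; * adjunction: $\phi\vee\chi\le\psi\,/\,\phi\le\psi,\ \chi\le\psi$; $\psi\le\phi\wedge\chi\,/\,\psi\le\phi,\ \psi\le\chi$; $\Diamond\phi\le\psi\,/\,\phi\le\blacksquare\psi$; $\phi\le\Box\psi\,/\,\blacklozenge\phi\le\psi$; * approximation: $\Box\psi\le\mathbf m\,/\,\Box\mathbf n\le\mathbf m,\ \psi\le\mathbf n$; $\mathbf j\le\Diamond\psi\,/\,\mathbf j\le\Diamond\mathbf i,\ \mathbf i\le\psi$; $\chi\to\phi\le\mathbf m\,/\,\mathbf j\to\mathbf n\le\mathbf m,\ \mathbf j\le\chi,\ \phi\le\mathbf n$; $\mathbf i\le\chi-\phi\,/\,\mathbf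 i\le\mathbf j-\mathbf n,\ \mathbf j\le\chi,\ \phi\le\mathbf n$; * $(\mu^\tau\text{-A-R})$: for an order type $\tau\in\{1,\partial\}^n$, replace the quasi-inequality by $n$ quasi-inequalities, the $k$-th having $\mathbf i\le\mu^*X.\psi(\overline{\mathbf j}^\tau_k/\overline x,X)$ and $\mathbf j^{\tau_k}\le^{\tau_k}\phi_k$ in place of $\mathbf i\le\mu^*X.\psi(\overline\phi/\overline x,X)$. Here $\mathbf j^{\tau_k}$ is a nominal if $\tau_k=1$ and a co-nominal if $\tau_k=\partial$, $\le^\partial$ is $\ge$, and $\overline{\mathbf j}^\tau_k$ has $\mathbf j^{\tau_k}$ at place $k$ and at the places $l\ne k$ the constant $\bot$ if $\tau_l=1$, $\top$ if $\tau_l=\partial$. It is required that $\psi(\overline x,X)$ contains no propositional variables and no free fixed point variables but $\overline x,X$, is positive (negative) in $x_l$ if $\tau_l=1$ ($\tau_l=\partial$), and that on every perfect modal bi-Heyting algebra $\mathbf C$ (with its binders read as ordinary least and greatest fixed points) its term function is completely join-preserving on $\mathbf C^\tau\times\mathbf C$; * $(\nu^\tau\text{-A-R})$: the order dual of the previous rule,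 for $\nu^*X.\phi(\overline\psi/\overline x,X)\le\mathbf m$, with complete meet-preservation; * Ackermann rules: if the inequalities of an antecedent that contain $p$ are among $\alpha_i\le p$ and $\beta_j(p)\le\gamma_j(p)$, with $\alpha_i$ $p$-free and syntactically closed, $\beta_j$ positive in $p$ and syntactically closed, $\gamma_j$ negative in $p$ and syntactically open, replace these inequalities by $\beta_j(\bigvee_i\alpha_i)\le\gamma_j(\bigvee_i\alpha_i)$; and dually, $p\le\alpha_i$ and $\gamma_j(p)\le\beta_j(p)$, with $\alpha_i$ $p$-free and syntactically open, $\gamma_j$ negative in $p$ and syntactically closed, $\beta_j$ positive in $p$ and syntactically open, are replaced by $\gamma_j(\bigwedge_i\alpha_i)\le\beta_j(\bigwedge_i\alpha_i)$. Here a term is syntactically open (closed) if all its occurrences of nominals, $\blacklozenge$ and $\mu^*$ are negative (positive) and all its occurrences of co-nominals, $\blacksquare$ and $\nu^*$ are positive (negative). An application of $(\mu^\tau\text{-A-R})$ *handles* the positive occurrences of $\mu^*$ and the negative occurrences of $\nu^*$ in $\mu^*X.\psi(\overline x,X)$, in particular the displayed binder; an application of $(\nu^\tau\text{-A-R})$ handles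 the positive occurrences of $\nu^*$ and the negative occurrences of $\mu^*$ in $\nu^*X.\phi(\overline x,X)$. The run *succeeds* if no propositional variables are left in the resulting quasi-inequalities, and it is *proper* if all occurrences of binders (that are left at the end) have been handled in this way. **Theorem (Canonicity).** Let $\mathbf A$ be a mu-algebra of the second kind and let $\phi\le\psi$ be an $\mathcal L_1$-inequality on which a proper run of $\mu^*$-ALBA succeeds. If $\mathbf A\models\phi\le\psi$, then $\mathbf A^\delta\models\phi\le\psi$. -/

import Mathlib

universe u v

namespace MuCanon

/-! ### Terms

Fixed point variables are de Bruijn indices: `Term β n` is the set of terms whose free fixed point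
(or placeholder) variables are among `n` given ones, so `Term β 0` is the set of sentences; the
body of a binder has one further variable, of index `0`. Propositional variables, nominals and
co-nominals are indexed by `ℕ`. Every binder carries a label from `β`. Terms of the languages with
binders `μ, ν` (resp. `μ₂, ν₂`) have labels in `Unit`; terms with binders `μ*, ν*` have labels in
`Bool`, the label recording whether that occurrence has been handled by a fixed point
approximation rule. -/

inductive Term (β : Type) : ℕ → Type
  | bot {n : ℕ} : Term β n
  | top {n : ℕ} : Term β n
  | var {n : ℕ} (p : ℕ) : Term β n
  | fvar {n : ℕ} (i : Fin n) : Term β n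
  | nom {n : ℕ} (j : ℕ) : Term β n
  | cnom {n : ℕ} (m : ℕ) : Term β n
  | and {n : ℕ} (s t : Term β n) : Term β n
  | or {n : ℕ} (s t : Term β n) : Term β n
  | imp {n : ℕ} (s t : Term β n) : Term β n
  | sub {n : ℕ} (s t : Term β n) : Term β n
  | dia {n : ℕ} (t : Term β n) : Term β n
  | box {n : ℕ} (t : Term β n) : Term β n
  | bdia {n : ℕ} (t : Term β n) : Term β n
  | bbox {n : ℕ} (t : Term β n) : Term β n
  | mu {n : ℕ} (b : β) (t : Term β (n + 1)) : Term β n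
  | nu {n : ℕ} (b : β) (t : Term β (n + 1)) : Term β n

/-- Extension of a tuple by a new entry of index `0`. -/
def extend {X : Type*} {n : ℕ} (a : X) (f : Fin n → X) : Fin (n + 1) → X :=
  fun i => Fin.cases a f i

namespace Term

variable {β : Type}

/-- Renaming of free fixed point variables. -/
def rename : {n m : ℕ} → (Fin n → Fin m) → Term β n → Term β m
  | _, _, _, bot => bot
  | _, _, _, top => top
  | _, _, _, var p => var p
  | _, _, r, fvar i => fvar (r i)
  | _, _, _, nom j => nom j
  | _, _, _, cnom m => cnom m
  | _, _, r, and s t => and (rename r s) (rename r t)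
  | _, _, r, or s t => or (rename r s) (rename r t)
  | _, _, r, imp s t => imp (rename r s) (rename r t)
  | _, _, r, sub s t => sub (rename r s) (rename r t)
  | _, _, r, dia t => dia (rename r t)
  | _, _, r, box t => box (rename r t)
  | _, _, r, bdia t => bdia (rename r t)
  | _, _, r, bbox t => bbox (rename r t)
  | _, _, r, mu b t => mu b (rename (extend 0 (fun i => (r i).succ)) t)
  | _, _, r, nu b t => nu b (rename (extend 0 (fun i => (r i).succ)) t)

/-- Passing a substitution under a binder. -/
def lift {n m : ℕ} (σ : Fin n → Term β m) : Fin (n + 1) → Term β (m + 1) :=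
  extend (fvar 0) (fun i => rename Fin.succ (σ i))

/-- Capture-avoiding substitution for the free fixed point / placeholder variables. -/
def subst : {n m : ℕ} → (Fin n → Term β m) → Term β n → Term β m
  | _, _, _, bot => bot
  | _, _, _, top => top
  | _, _, _, var p => var p
  | _, _, σ, fvar i => σ i
  | _, _, _, nom j => nom j
  | _, _, _, cnom m => cnom m
  | _, _, σ, and s t => and (subst σ s) (subst σ t)
  | _, _, σ, or s t => or (subst σ s) (subst σ t)
  | _, _, σ, imp s t => imp (subst σ s) (subst σ t)
  | _, _, σ, sub s t => sub (subst σ s) (subst σ t)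
  | _, _, σ, dia t => dia (subst σ t)
  | _, _, σ, box t => box (subst σ t)
  | _, _, σ, bdia t => bdia (subst σ t)
  | _, _, σ, bbox t => bbox (subst σ t)
  | _, _, σ, mu b t => mu b (subst (lift σ) t)
  | _, _, σ, nu b t => nu b (subst (lift σ) t)

/-- `substVar p α t` is `t(α/p)`: substitution of the sentence `α` for the propositional
variable `p`. -/
def substVar (p : ℕ) (α : Term β 0) : {n : ℕ} → Term β n → Term β n
  | _, bot => bot
  | _, top => top
  | _, var q => if q = p then rename Fin.elim0 α else var q
  | _, fvar i => fvar i
  | _, nom j => nom j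
  | _, cnom m => cnom m
  | _, and s t => and (substVar p α s) (substVar p α t)
  | _, or s t => or (substVar p α s) (substVar p α t)
  | _, imp s t => imp (substVar p α s) (substVar p α t)
  | _, sub s t => sub (substVar p α s) (substVar p α t)
  | _, dia t => dia (substVar p α t)
  | _, box t => box (substVar p α t)
  | _, bdia t => bdia (substVar p α t)
  | _, bbox t => bbox (substVar p α t)
  | _, mu b t => mu b (substVar p α t)
  | _, nu b t => nu b (substVar p α t)

/-- Terms without nominals, co-nominals and the adjoint modalities. -/
def Basic : {n : ℕ} → Term β n → Prop
  | _, bot => True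
  | _, top => True
  | _, var _ => True
  | _, fvar _ => True
  | _, nom _ => False
  | _, cnom _ => False
  | _, and s t => Basic s ∧ Basic t
  | _, or s t => Basic s ∧ Basic t
  | _, imp s t => Basic s ∧ Basic t
  | _, sub s t => Basic s ∧ Basic t
  | _, dia t => Basic t
  | _, box t => Basic t
  | _, bdia _ => False
  | _, bbox _ => False
  | _, mu _ t => Basic t
  | _, nu _ t => Basic t

/-- `VarSign p s t`: in the positive generation tree of `t` every `p`-node has sign `s`
(`true` is `+`). So `VarSign p true` is "positive in `p`", `VarSign p false` "negative in `p`". -/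
def VarSign (p : ℕ) : {n : ℕ} → Bool → Term β n → Prop
  | _, _, bot => True
  | _, _, top => True
  | _, s, var q => q = p → s = true
  | _, _, fvar _ => True
  | _, _, nom _ => True
  | _, _, cnom _ => True
  | _, s, and a b => VarSign p s a ∧ VarSign p s b
  | _, s, or a b => VarSign p s a ∧ VarSign p s b
  | _, s, imp a b => VarSign p (!s) a ∧ VarSign p s b
  | _, s, sub a b => VarSign p s a ∧ VarSign p (!s) b
  | _, s, dia t => VarSign p s t
  | _, s, box t => VarSign p s t
  | _, s, bdia t => VarSign p s t
  | _, s, bbox t => VarSign p s t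
  | _, s, mu _ t => VarSign p s t
  | _, s, nu _ t => VarSign p s t

/-- The same for the free fixed point / placeholder variable of index `i`. -/
def FVarSign : {n : ℕ} → Fin n → Bool → Term β n → Prop
  | _, _, _, bot => True
  | _, _, _, top => True
  | _, _, _, var _ => True
  | _, i, s, fvar k => k = i → s = true
  | _, _, _, nom _ => True
  | _, _, _, cnom _ => True
  | _, i, s, and a b => FVarSign i s a ∧ FVarSign i s b
  | _, i, s, or a b => FVarSign i s a ∧ FVarSign i s b
  | _, i, s, imp a b => FVarSign i (!s) a ∧ FVarSign i s b
  | _, i, s, sub a b => FVarSign i s a ∧ FVarSign i (!s) b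
  | _, i, s, dia t => FVarSign i s t
  | _, i, s, box t => FVarSign i s t
  | _, i, s, bdia t => FVarSign i s t
  | _, i, s, bbox t => FVarSign i s t
  | _, i, s, mu _ t => FVarSign i.succ s t
  | _, i, s, nu _ t => FVarSign i.succ s t

/-- Well-formedness: the body of every binder is positive in the bound variable. -/
def WF : {n : ℕ} → Term β n → Prop
  | _, bot => True
  | _, top => True
  | _, var _ => True
  | _, fvar _ => True
  | _, nom _ => True
  | _, cnom _ => True
  | _, and s t => WF s ∧ WF t
  | _, or s t => WF s ∧ WF t
  | _, imp s t => WF s ∧ WF t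
  | _, sub s t => WF s ∧ WF t
  | _, dia t => WF t
  | _, box t => WF t
  | _, bdia t => WF t
  | _, bbox t => WF t
  | _, mu _ t => FVarSign 0 true t ∧ WF t
  | _, nu _ t => FVarSign 0 true t ∧ WF t

/-- `VarFree p t`: the propositional variable `p` does not occur in `t`. -/
def VarFree (p : ℕ) : {n : ℕ} → Term β n → Prop
  | _, bot => True
  | _, top => True
  | _, var q => q ≠ p
  | _, fvar _ => True
  | _, nom _ => True
  | _, cnom _ => True
  | _, and s t => VarFree p s ∧ VarFree p t
  | _, or s t => VarFree p s ∧ VarFree p t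
  | _, imp s t => VarFree p s ∧ VarFree p t
  | _, sub s t => VarFree p s ∧ VarFree p t
  | _, dia t => VarFree p t
  | _, box t => VarFree p t
  | _, bdia t => VarFree p t
  | _, bbox t => VarFree p t
  | _, mu _ t => VarFree p t
  | _, nu _ t => VarFree p t

/-- No propositional variable occurs in `t`. -/
def Pure {n : ℕ} (t : Term β n) : Prop := ∀ p, VarFree p t

/-- The nominal `j` does not occur in `t`. -/
def NomFree (j : ℕ) : {n : ℕ} → Term β n → Prop
  | _, bot => True
  | _, top => True
  | _, var _ => True
  | _, fvar _ => True
  | _, nom k => k ≠ j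
  | _, cnom _ => True
  | _, and s t => NomFree j s ∧ NomFree j t
  | _, or s t => NomFree j s ∧ NomFree j t
  | _, imp s t => NomFree j s ∧ NomFree j t
  | _, sub s t => NomFree j s ∧ NomFree j t
  | _, dia t => NomFree j t
  | _, box t => NomFree j t
  | _, bdia t => NomFree j t
  | _, bbox t => NomFree j t
  | _, mu _ t => NomFree j t
  | _, nu _ t => NomFree j t

/-- The co-nominal `m` does not occur in `t`. -/
def CnomFree (m : ℕ) : {n : ℕ} → Term β n → Prop
  | _, bot => True
  | _, top => True
  | _, var _ => True
  | _, fvar _ => True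
  | _, nom _ => True
  | _, cnom k => k ≠ m
  | _, and s t => CnomFree m s ∧ CnomFree m t
  | _, or s t => CnomFree m s ∧ CnomFree m t
  | _, imp s t => CnomFree m s ∧ CnomFree m t
  | _, sub s t => CnomFree m s ∧ CnomFree m t
  | _, dia t => CnomFree m t
  | _, box t => CnomFree m t
  | _, bdia t => CnomFree m t
  | _, bbox t => CnomFree m t
  | _, mu _ t => CnomFree m t
  | _, nu _ t => CnomFree m t

/-- `Syn true`: syntactically open terms; `Syn false`: syntactically closed terms. -/
def Syn : {n : ℕ} → Bool → Term β n → Prop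
  | _, _, bot => True
  | _, _, top => True
  | _, _, var _ => True
  | _, _, fvar _ => True
  | _, s, nom _ => s = false
  | _, s, cnom _ => s = true
  | _, s, and a b => Syn s a ∧ Syn s b
  | _, s, or a b => Syn s a ∧ Syn s b
  | _, s, imp a b => Syn (!s) a ∧ Syn s b
  | _, s, sub a b => Syn s a ∧ Syn (!s) b
  | _, s, dia t => Syn s t
  | _, s, box t => Syn s t
  | _, s, bdia t => s = false ∧ Syn s t
  | _, s, bbox t => s = true ∧ Syn s t
  | _, s, mu _ t => s = false ∧ Syn s t
  | _, s, nu _ t => s = true ∧ Syn s t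

abbrev SynOpen {n : ℕ} (t : Term β n) : Prop := Syn true t

abbrev SynClosed {n : ℕ} (t : Term β n) : Prop := Syn false t

/-- The translation `t ↦ t*`, replacing `μ, ν` by (not yet handled) `μ*, ν*`. -/
def star : {n : ℕ} → Term Unit n → Term Bool n
  | _, bot => bot
  | _, top => top
  | _, var p => var p
  | _, fvar i => fvar i
  | _, nom j => nom j
  | _, cnom m => cnom m
  | _, and s t => and (star s) (star t)
  | _, or s t => or (star s) (star t)
  | _, imp s t => imp (star s) (star t)
  | _, sub s t => sub (star s) (star t)
  | _, dia t => dia (star t)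
  | _, box t => box (star t)
  | _, bdia t => bdia (star t)
  | _, bbox t => bbox (star t)
  | _, mu _ t => mu false (star t)
  | _, nu _ t => nu false (star t)

/-- `handle s t` labels as handled the skeleton binders, i.e. the nodes `+μ*` and `-ν*`, of the
signed generation tree of `t` whose root has sign `s`. -/
def handle : {n : ℕ} → Bool → Term Bool n → Term Bool n
  | _, _, bot => bot
  | _, _, top => top
  | _, _, var p => var p
  | _, _, fvar i => fvar i
  | _, _, nom j => nom j
  | _, _, cnom m => cnom m
  | _, s, and a b => and (handle s a) (handle s b)
  | _, s, or a b => or (handle s a) (handle s b)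
  | _, s, imp a b => imp (handle (!s) a) (handle s b)
  | _, s, sub a b => sub (handle s a) (handle (!s) b)
  | _, s, dia t => dia (handle s t)
  | _, s, box t => box (handle s t)
  | _, s, bdia t => bdia (handle s t)
  | _, s, bbox t => bbox (handle s t)
  | _, s, mu b t => mu (b || s) (handle s t)
  | _, s, nu b t => nu (b || !s) (handle s t)

/-- Every binder occurring in the term is labelled as handled. -/
def AllHandled : {n : ℕ} → Term Bool n → Prop
  | _, bot => True
  | _, top => True
  | _, var _ => True
  | _, fvar _ => True
  | _, nom _ => True
  | _, cnom _ => True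
  | _, and s t => AllHandled s ∧ AllHandled t
  | _, or s t => AllHandled s ∧ AllHandled t
  | _, imp s t => AllHandled s ∧ AllHandled t
  | _, sub s t => AllHandled s ∧ AllHandled t
  | _, dia t => AllHandled t
  | _, box t => AllHandled t
  | _, bdia t => AllHandled t
  | _, bbox t => AllHandled t
  | _, mu b t => b = true ∧ AllHandled t
  | _, nu b t => b = true ∧ AllHandled t

end Term

/-- Terms of the modal mu-language: no nominals, co-nominals or adjoint modalities, and binders
only over bodies positive in the bound variable. -/
def IsMuTerm {n : ℕ} (t : Term Unit n) : Prop := t.Basic ∧ t.WF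

/-! ### Modal bi-Heyting algebras and mu-algebras -/

/-- Modal bi-Heyting algebras; `a ⇨ b` is implication and `a \ b` is subtraction. -/
class ModalBiheytingAlgebra (A : Type u) extends BiheytingAlgebra A where
  box : A → A
  dia : A → A
  box_top : box ⊤ = ⊤
  box_inf : ∀ a b, box (a ⊓ b) = box a ⊓ box b
  dia_bot : dia ⊥ = ⊥
  dia_sup : ∀ a b, dia (a ⊔ b) = dia a ⊔ dia b

section Algebra

variable {A : Type u} [ModalBiheytingAlgebra A]

/-- `Val L G v t env b`: the term `t` is defined under the assignment `v` of the propositional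
variables and `env` of the free fixed point variables, and `b` is its value. Here `L f b`
(`G f b`) says that the least (greatest) fixed point of `f` is defined and equal to `b`. -/
def Val (L G : (A → A) → A → Prop) (v : ℕ → A) :
    {n : ℕ} → Term Unit n → (Fin n → A) → A → Prop
  | _, .bot, _, b => b = ⊥
  | _, .top, _, b => b = ⊤
  | _, .var p, _, b => b = v p
  | _, .fvar i, env, b => b = env i
  | _, .nom _, _, _ => False
  | _, .cnom _, _, _ => False
  | _, .and s t, env, b => ∃ x y, Val L G v s env x ∧ Val L G v t env y ∧ b = x ⊓ y
  | _, .or s t, env, b => ∃ x y, Val L G v s env x ∧ Val L G v t env y ∧ b = x ⊔ y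
  | _, .imp s t, env, b => ∃ x y, Val L G v s env x ∧ Val L G v t env y ∧ b = x ⇨ y
  | _, .sub s t, env, b => ∃ x y, Val L G v s env x ∧ Val L G v t env y ∧ b = x \ y
  | _, .dia t, env, b => ∃ x, Val L G v t env x ∧ b = ModalBiheytingAlgebra.dia x
  | _, .box t, env, b => ∃ x, Val L G v t env x ∧ b = ModalBiheytingAlgebra.box x
  | _, .bdia _, _, _ => False
  | _, .bbox _, _, _ => False
  | _, .mu _ t, env, b => ∃ f : A → A, (∀ a, Val L G v t (extend a env) (f a)) ∧ L f b
  | _, .nu _ t, env, b => ∃ f : A → A, (∀ a, Val L G v t (extend a env) (f a)) ∧ G f b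

/-- `b` is the meet of the pre-fixed points of `f`. -/
def IsMu (f : A → A) (b : A) : Prop := IsGLB {a | f a ≤ a} b

/-- `b` is the join of the post-fixed points of `f`. -/
def IsNu (f : A → A) (b : A) : Prop := IsLUB {a | a ≤ f a} b

/-- All transfinite iterates of `f` starting at `⊥` exist, and `b` is their join. -/
def IsMu₂ (f : A → A) (b : A) : Prop :=
  ∃ g : Ordinal.{u} → A, g 0 = ⊥ ∧ (∀ α, g (Order.succ α) = f (g α)) ∧
    (∀ l, Order.IsSuccLimit l → IsLUB (g '' Set.Iio l) (g l)) ∧ IsLUB (Set.range g) b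

/-- All transfinite iterates of `f` starting at `⊤` exist, and `b` is their meet. -/
def IsNu₂ (f : A → A) (b : A) : Prop :=
  ∃ g : Ordinal.{u} → A, g 0 = ⊤ ∧ (∀ α, g (Order.succ α) = f (g α)) ∧
    (∀ l, Order.IsSuccLimit l → IsGLB (g '' Set.Iio l) (g l)) ∧ IsGLB (Set.range g) b

variable (A) in
/-- Mu-algebras of the second kind: every term is defined everywhere when its binders are
interpreted as `μ₂, ν₂`. -/
def SecondKind : Prop :=
  ∀ (n : ℕ) (t : Term Unit n), IsMuTerm t → ∀ (v : ℕ → A) (env : Fin n → A),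
    ∃ b, Val IsMu₂ IsNu₂ v t env b

variable (A) in
/-- `A ⊨ φ ≤ ψ`, with the binders interpreted as `μ, ν`. -/
def Models (φ ψ : Term Unit 0) : Prop :=
  ∀ (v : ℕ → A) (a b : A),
    Val IsMu IsNu v φ Fin.elim0 a → Val IsMu IsNu v ψ Fin.elim0 b → a ≤ b

end Algebra

/-! ### Interpretation in complete lattices with modalities -/

section Complete

variable {C : Type v} [CompleteLattice C]

def IsCompletelyJoinIrreducible (j : C) : Prop := ∀ X : Set C, j = sSup X → j ∈ X

def IsCompletelyMeetIrreducible (m : C) : Prop := ∀ Y : Set C, m = sInf Y → m ∈ Y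

variable (C) in
structure Assignment where
  var : ℕ → C
  nom : ℕ → C
  cnom : ℕ → C

/-- Nominals are sent to completely join-irreducible and co-nominals to completely
meet-irreducible elements. -/
def Assignment.Respects (V : Assignment C) : Prop :=
  (∀ j, IsCompletelyJoinIrreducible (V.nom j)) ∧ ∀ m, IsCompletelyMeetIrreducible (V.cnom m)

/-- Interpretation of terms. Implication, subtraction, the left adjoint of `box` and the right
adjoint of `dia` are given by the usual formulas for residuals and adjoints in complete lattices;
least and greatest fixed points are the meet of all pre-fixed and the join of all post-fixed
points in `C`. -/
def eval (box dia : C → C) (V : Assignment C) {β : Type} : {n : ℕ} → Term β n → (Fin n → C) → C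
  | _, .bot, _ => ⊥
  | _, .top, _ => ⊤
  | _, .var p, _ => V.var p
  | _, .fvar i, env => env i
  | _, .nom j, _ => V.nom j
  | _, .cnom m, _ => V.cnom m
  | _, .and s t, env => eval box dia V s env ⊓ eval box dia V t env
  | _, .or s t, env => eval box dia V s env ⊔ eval box dia V t env
  | _, .imp s t, env => sSup {c | c ⊓ eval box dia V s env ≤ eval box dia V t env}
  | _, .sub s t, env => sInf {c | eval box dia V s env ≤ eval box dia V t env ⊔ c}
  | _, .dia t, env => dia (eval box dia V t env)
  | _, .box t, env => box (eval box dia V t env)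
  | _, .bdia t, env => sInf {c | eval box dia V t env ≤ box c}
  | _, .bbox t, env => sSup {c | dia c ≤ eval box dia V t env}
  | _, .mu _ t, env => sInf {c | eval box dia V t (extend c env) ≤ c}
  | _, .nu _ t, env => sSup {c | c ≤ eval box dia V t (extend c env)}

/-- Perfect modal bi-Heyting algebras: completely distributive complete lattices in which the
completely join-irreducibles are join-dense and the completely meet-irreducibles meet-dense, with
a completely meet-preserving `box` and a completely join-preserving `dia`. -/
structure IsPerfect (box dia : C → C) : Prop where
  distrib : ∀ (ι : Type v) (κ : ι → Type v) (f : ∀ i, κ i → C),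
    ⨅ i, ⨆ k, f i k = ⨆ g : ∀ i, κ i, ⨅ i, f i (g i)
  join_dense : ∀ c : C, c = sSup {j | IsCompletelyJoinIrreducible j ∧ j ≤ c}
  meet_dense : ∀ c : C, c = sInf {m | IsCompletelyMeetIrreducible m ∧ c ≤ m}
  box_sInf : ∀ S : Set C, box (sInf S) = sInf (box '' S)
  dia_sSup : ∀ S : Set C, dia (sSup S) = sSup (dia '' S)

/-- The join in `C^τ × C` of a set of tuples `(X, x₁, …, xₙ)`; the variable `X` has index `0` and
`τ k = true` stands for `1`, `τ k = false` for `∂`. -/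
def joinOrd {n : ℕ} (τ : Fin n → Bool) (S : Set (Fin (n + 1) → C)) : Fin (n + 1) → C :=
  extend (sSup ((fun x => x 0) '' S))
    (fun k => if τ k then sSup ((fun x => x k.succ) '' S) else sInf ((fun x => x k.succ) '' S))

/-- The meet in `C^τ × C`. -/
def meetOrd {n : ℕ} (τ : Fin n → Bool) (S : Set (Fin (n + 1) → C)) : Fin (n + 1) → C :=
  extend (sInf ((fun x => x 0) '' S))
    (fun k => if τ k then sInf ((fun x => x k.succ) '' S) else sSup ((fun x => x k.succ) '' S))

end Complete

/-- On every perfect modal bi-Heyting algebra the term function of `ψ(x₁, …, xₙ, X)` is completely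
join-preserving on `C^τ × C`. -/
def JoinPreserving {n : ℕ} (ψ : Term Bool (n + 1)) (τ : Fin n → Bool) : Prop :=
  ∀ (C : Type v) [CompleteLattice C] (box dia : C → C), IsPerfect box dia →
    ∀ V : Assignment C, V.Respects → ∀ S : Set (Fin (n + 1) → C),
      eval box dia V ψ (joinOrd τ S) = sSup (eval box dia V ψ '' S)

/-- The order dual of `JoinPreserving`. -/
def MeetPreserving {n : ℕ} (φ : Term Bool (n + 1)) (τ : Fin n → Bool) : Prop :=
  ∀ (C : Type v) [CompleteLattice C] (box dia : C → C), IsPerfect box dia →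
    ∀ V : Assignment C, V.Respects → ∀ S : Set (Fin (n + 1) → C),
      eval box dia V φ (meetOrd τ S) = sInf (eval box dia V φ '' S)

/-! ### The canonical extension -/

section CanonicalExtension

variable {A : Type u} [ModalBiheytingAlgebra A] {C : Type v} [CompleteLattice C]

/-- The embedding `e` exhibits the complete lattice `C` as the canonical extension of `A`. -/
structure IsCanonicalExtension (e : BoundedLatticeHom A C) : Prop where
  injective : Function.Injective e
  join_of_meets : ∀ c : C, ∃ F : Set (Set A), c = sSup ((fun S => sInf (e '' S)) '' F)
  meet_of_joins : ∀ c : C, ∃ F : Set (Set A), c = sInf ((fun S => sSup (e '' S)) '' F)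
  compact : ∀ S T : Set A, sInf (e '' S) ≤ sSup (e '' T) →
    ∃ S' T' : Finset A, ↑S' ⊆ S ∧ ↑T' ⊆ T ∧ S'.inf id ≤ T'.sup id

def ClosedElts (e : BoundedLatticeHom A C) : Set C := {c | ∃ S : Set A, c = sInf (e '' S)}

def OpenElts (e : BoundedLatticeHom A C) : Set C := {c | ∃ S : Set A, c = sSup (e '' S)}

/-- The extension `f^σ`. -/
def sigmaExt (e : BoundedLatticeHom A C) (f : A → A) (c : C) : C :=
  sSup {x | ∃ k ∈ ClosedElts e, ∃ w ∈ OpenElts e, k ≤ c ∧ c ≤ w ∧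
    x = sInf ((fun a => e (f a)) '' {a | k ≤ e a ∧ e a ≤ w})}

/-- The extension `f^π`. -/
def piExt (e : BoundedLatticeHom A C) (f : A → A) (c : C) : C :=
  sInf {x | ∃ k ∈ ClosedElts e, ∃ w ∈ OpenElts e, k ≤ c ∧ c ≤ w ∧
    x = sSup ((fun a => e (f a)) '' {a | k ≤ e a ∧ e a ≤ w})}

/-- `A^δ ⊨ φ ≤ ψ`, the modalities of `A^δ` being `box^π` and `dia^σ`. (Nominals and co-nominals do
not occur in terms of the modal mu-language, so their values do not matter.) -/
def CanonicalModels (e : BoundedLatticeHom A C) (φ ψ : Term Unit 0) : Prop :=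
  ∀ V : Assignment C,
    eval (piExt e ModalBiheytingAlgebra.box) (sigmaExt e ModalBiheytingAlgebra.dia) V φ Fin.elim0 ≤
      eval (piExt e ModalBiheytingAlgebra.box) (sigmaExt e ModalBiheytingAlgebra.dia) V ψ Fin.elim0

end CanonicalExtension

/-! ### The algorithm -/

/-- Inequalities between sentences. -/
structure Ineq (β : Type) where
  lhs : Term β 0
  rhs : Term β 0

/-- One application of a distribution law inside a term, at a node of the signed generation tree
whose root has the given sign: positive diamonds and meets are distributed over positive joins,
negative boxes and joins over negative meets. -/
inductive Distr : Bool → {n : ℕ} → Term Unit n → Term Unit n → Prop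
  | dia_or {n : ℕ} (a b : Term Unit n) :
      Distr true (.dia (.or a b)) (.or (.dia a) (.dia b))
  | or_and {n : ℕ} (a b c : Term Unit n) :
      Distr true (.and (.or a b) c) (.or (.and a c) (.and b c))
  | and_or {n : ℕ} (a b c : Term Unit n) :
      Distr true (.and c (.or a b)) (.or (.and c a) (.and c b))
  | box_and {n : ℕ} (a b : Term Unit n) :
      Distr false (.box (.and a b)) (.and (.box a) (.box b))
  | and_orN {n : ℕ} (a b c : Term Unit n) :
      Distr false (.or (.and a b) c) (.and (.or a c) (.or b c))
  | or_andN {n : ℕ} (a b c : Term Unit n) :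
      Distr false (.or c (.and a b)) (.and (.or c a) (.or c b))
  | andL {n : ℕ} {s : Bool} {a a' : Term Unit n} (b : Term Unit n) :
      Distr s a a' → Distr s (.and a b) (.and a' b)
  | andR {n : ℕ} {s : Bool} {b b' : Term Unit n} (a : Term Unit n) :
      Distr s b b' → Distr s (.and a b) (.and a b')
  | orL {n : ℕ} {s : Bool} {a a' : Term Unit n} (b : Term Unit n) :
      Distr s a a' → Distr s (.or a b) (.or a' b)
  | orR {n : ℕ} {s : Bool} {b b' : Term Unit n} (a : Term Unit n) :
      Distr s b b' → Distr s (.or a b) (.or a b')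
  | impL {n : ℕ} {s : Bool} {a a' : Term Unit n} (b : Term Unit n) :
      Distr (!s) a a' → Distr s (.imp a b) (.imp a' b)
  | impR {n : ℕ} {s : Bool} {b b' : Term Unit n} (a : Term Unit n) :
      Distr s b b' → Distr s (.imp a b) (.imp a b')
  | subL {n : ℕ} {s : Bool} {a a' : Term Unit n} (b : Term Unit n) :
      Distr s a a' → Distr s (.sub a b) (.sub a' b)
  | subR {n : ℕ} {s : Bool} {b b' : Term Unit n} (a : Term Unit n) :
      Distr (!s) b b' → Distr s (.sub a b) (.sub a b')
  | dia {n : ℕ} {s : Bool} {a a' : Term Unit n} : Distr s a a' → Distr s (.dia a) (.dia a')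
  | box {n : ℕ} {s : Bool} {a a' : Term Unit n} : Distr s a a' → Distr s (.box a) (.box a')
  | mu {n : ℕ} {s : Bool} {b : Unit} {a a' : Term Unit (n + 1)} :
      Distr s a a' → Distr s (.mu b a) (.mu b a')
  | nu {n : ℕ} {s : Bool} {b : Unit} {a a' : Term Unit (n + 1)} :
      Distr s a a' → Distr s (.nu b a) (.nu b a')

/-- Preprocessing rules: an inequality is replaced by a list of inequalities. -/
inductive PreRule : Ineq Unit → List (Ineq Unit) → Prop
  | distrL {φ φ' : Term Unit 0} (ψ : Term Unit 0) : Distr true φ φ' → PreRule ⟨φ, ψ⟩ [⟨φ', ψ⟩]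
  | distrR {ψ ψ' : Term Unit 0} (φ : Term Unit 0) : Distr false ψ ψ' → PreRule ⟨φ, ψ⟩ [⟨φ, ψ'⟩]
  | orLA (α β γ : Term Unit 0) : PreRule ⟨.or α β, γ⟩ [⟨α, γ⟩, ⟨β, γ⟩]
  | andRA (α β γ : Term Unit 0) : PreRule ⟨α, .and β γ⟩ [⟨α, β⟩, ⟨α, γ⟩]
  | elimBot (p : ℕ) (α β : Term Unit 0) : α.VarSign p false → β.VarSign p true →
      PreRule ⟨α, β⟩ [⟨Term.substVar p .bot α, Term.substVar p .bot β⟩]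
  | elimTop (p : ℕ) (γ χ : Term Unit 0) : γ.VarSign p true → χ.VarSign p false →
      PreRule ⟨γ, χ⟩ [⟨Term.substVar p .top γ, Term.substVar p .top χ⟩]

/-- One preprocessing step on the current list of inequalities. -/
inductive PreStep : List (Ineq Unit) → List (Ineq Unit) → Prop
  | mk (l₁ l₂ : List (Ineq Unit)) {I : Ineq Unit} {Is : List (Ineq Unit)} :
      PreRule I Is → PreStep (l₁ ++ I :: l₂) (l₁ ++ Is ++ l₂)

/-- The quasi-inequality whose antecedent is the conjunction of `ants` and whose consequent is
`i ≤ m`, for the nominal `i` and co-nominal `m` with the given indices. -/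
structure QIneq where
  ants : List (Ineq Bool)
  i : ℕ
  m : ℕ

/-- Starring of the binders followed by first approximation. -/
def firstApprox (i m : ℕ) (I : Ineq Unit) : QIneq :=
  ⟨[⟨.nom i, I.lhs.star⟩, ⟨I.rhs.star, .cnom m⟩], i, m⟩

def QIneq.FreshNom (Q : QIneq) (j : ℕ) : Prop :=
  j ≠ Q.i ∧ ∀ I ∈ Q.ants, I.lhs.NomFree j ∧ I.rhs.NomFree j

def QIneq.FreshCnom (Q : QIneq) (n : ℕ) : Prop :=
  n ≠ Q.m ∧ ∀ I ∈ Q.ants, I.lhs.CnomFree n ∧ I.rhs.CnomFree n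

/-- The tuple with a nominal (co-nominal, if `τ k = ∂`) of index `c` at place `k` and `⊥^τ` at the
other places. -/
def nomTuple {n : ℕ} (τ : Fin n → Bool) (k : Fin n) (c : ℕ) : Fin n → Term Bool 0 :=
  fun l => if l = k then (if τ k then .nom c else .cnom c) else (if τ l then .bot else .top)

/-- The tuple with a co-nominal (nominal, if `τ k = ∂`) of index `c` at place `k` and `⊤^τ` at the
other places. -/
def cnomTuple {n : ℕ} (τ : Fin n → Bool) (k : Fin n) (c : ℕ) : Fin n → Term Bool 0 :=
  fun l => if l = k then (if τ k then .cnom c else .nom c) else (if τ l then .top else .bot)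

/-- The rules acting on a single inequality in an antecedent. Such an inequality is replaced by a
disjunction (outer list) of conjunctions (inner lists) of inequalities. `FN` and `FC` are the
sets of fresh nominals and co-nominals. Residuation and meet / join are used up to commutativity.
-/
inductive Rule (FN FC : ℕ → Prop) : Ineq Bool → List (List (Ineq Bool)) → Prop
  -- residuation
  | subLR (χ ψ φ : Term Bool 0) : Rule FN FC ⟨.sub χ ψ, φ⟩ [[⟨χ, .or ψ φ⟩]]
  | impRR (φ χ ψ : Term Bool 0) : Rule FN FC ⟨φ, .imp χ ψ⟩ [[⟨.and φ χ, ψ⟩]]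
  | andLR (χ ψ φ : Term Bool 0) : Rule FN FC ⟨.and χ ψ, φ⟩ [[⟨χ, .imp ψ φ⟩]]
  | andLR_comm (χ ψ φ : Term Bool 0) : Rule FN FC ⟨.and χ ψ, φ⟩ [[⟨ψ, .imp χ φ⟩]]
  | orRR (φ χ ψ : Term Bool 0) : Rule FN FC ⟨φ, .or χ ψ⟩ [[⟨.sub φ χ, ψ⟩]]
  | orRR_comm (φ χ ψ : Term Bool 0) : Rule FN FC ⟨φ, .or χ ψ⟩ [[⟨.sub φ ψ, χ⟩]]
  -- adjunction
  | orLA (φ χ ψ : Term Bool 0) : Rule FN FC ⟨.or φ χ, ψ⟩ [[⟨φ, ψ⟩, ⟨χ, ψ⟩]]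
  | andRA (ψ φ χ : Term Bool 0) : Rule FN FC ⟨ψ, .and φ χ⟩ [[⟨ψ, φ⟩, ⟨ψ, χ⟩]]
  | diaLA (φ ψ : Term Bool 0) : Rule FN FC ⟨.dia φ, ψ⟩ [[⟨φ, .bbox ψ⟩]]
  | boxRA (φ ψ : Term Bool 0) : Rule FN FC ⟨φ, .box ψ⟩ [[⟨.bdia φ, ψ⟩]]
  -- ordinary approximation
  | boxAppr (ψ : Term Bool 0) (m n : ℕ) : FC n →
      Rule FN FC ⟨.box ψ, .cnom m⟩ [[⟨.box (.cnom n), .cnom m⟩, ⟨ψ, .cnom n⟩]]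
  | diaAppr (ψ : Term Bool 0) (j i : ℕ) : FN i →
      Rule FN FC ⟨.nom j, .dia ψ⟩ [[⟨.nom j, .dia (.nom i)⟩, ⟨.nom i, ψ⟩]]
  | impAppr (χ φ : Term Bool 0) (m j n : ℕ) : FN j → FC n →
      Rule FN FC ⟨.imp χ φ, .cnom m⟩
        [[⟨.imp (.nom j) (.cnom n), .cnom m⟩, ⟨.nom j, χ⟩, ⟨φ, .cnom n⟩]]
  | subAppr (χ φ : Term Bool 0) (i j n : ℕ) : FN j → FC n →
      Rule FN FC ⟨.nom i, .sub χ φ⟩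
        [[⟨.nom i, .sub (.nom j) (.cnom n)⟩, ⟨.nom j, χ⟩, ⟨φ, .cnom n⟩]]
  -- approximation for `μ*`
  | muAppr {n : ℕ} (τ : Fin n → Bool) (b : Bool) (ψ : Term Bool (n + 1)) (φ : Fin n → Term Bool 0)
      (i : ℕ) (c : Fin n → ℕ) :
      ψ.Pure → (∀ k, ψ.FVarSign k.succ (τ k)) → JoinPreserving.{v} ψ τ →
      (∀ k, if τ k then FN (c k) else FC (c k)) →
      Rule FN FC ⟨.nom i, (Term.mu b ψ).subst φ⟩
        (List.ofFn fun k =>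
          [⟨.nom i, ((Term.mu b ψ).handle true).subst (nomTuple τ k (c k))⟩,
            if τ k then ⟨.nom (c k), φ k⟩ else ⟨φ k, .cnom (c k)⟩])
  -- approximation for `ν*`
  | nuAppr {n : ℕ} (τ : Fin n → Bool) (b : Bool) (φ : Term Bool (n + 1)) (ψ : Fin n → Term Bool 0)
      (m : ℕ) (c : Fin n → ℕ) :
      φ.Pure → (∀ k, φ.FVarSign k.succ (τ k)) → MeetPreserving.{v} φ τ →
      (∀ k, if τ k then FC (c k) else FN (c k)) →
      Rule FN FC ⟨(Term.nu b φ).subst ψ, .cnom m⟩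
        (List.ofFn fun k =>
          [⟨((Term.nu b φ).handle false).subst (cnomTuple τ k (c k)), .cnom m⟩,
            if τ k then ⟨ψ k, .cnom (c k)⟩ else ⟨.nom (c k), ψ k⟩])

/-- Finite joins and meets of terms; the empty ones are `⊥` and `⊤`. -/
def bigOr : List (Term Bool 0) → Term Bool 0
  | [] => .bot
  | [a] => a
  | a :: b :: l => .or a (bigOr (b :: l))

def bigAnd : List (Term Bool 0) → Term Bool 0
  | [] => .top
  | [a] => a
  | a :: b :: l => .and a (bigAnd (b :: l))

def Ineq.substVar (p : ℕ) (α : Term Bool 0) (I : Ineq Bool) : Ineq Bool :=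
  ⟨Term.substVar p α I.lhs, Term.substVar p α I.rhs⟩

/-- Application of a rule to a quasi-inequality, which is replaced by a list of quasi-inequalities.
In the Ackermann rules `αs` bound the variable `p`, `Bs` are the other inequalities
containing `p`, and `rest` are inequalities without `p`, which the rule does not touch. -/
inductive QRule : QIneq → List QIneq → Prop
  | single (l₁ l₂ : List (Ineq Bool)) (I : Ineq Bool) (i m : ℕ) (D : List (List (Ineq Bool))) :
      Rule.{v} (QIneq.FreshNom ⟨l₁ ++ I :: l₂, i, m⟩) (QIneq.FreshCnom ⟨l₁ ++ I :: l₂, i, m⟩) I D →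
      QRule ⟨l₁ ++ I :: l₂, i, m⟩ (D.map fun Is => ⟨l₁ ++ Is ++ l₂, i, m⟩)
  | rightAckermann (p : ℕ) (αs : List (Term Bool 0)) (Bs rest ants : List (Ineq Bool)) (i m : ℕ) :
      ants.Perm (αs.map (fun α => ⟨α, .var p⟩) ++ Bs ++ rest) →
      (∀ α ∈ αs, α.VarFree p ∧ α.SynClosed) →
      (∀ I ∈ Bs, I.lhs.VarSign p true ∧ I.lhs.SynClosed ∧ I.rhs.VarSign p false ∧ I.rhs.SynOpen) →
      (∀ I ∈ rest, I.lhs.VarFree p ∧ I.rhs.VarFree p) →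
      QRule ⟨ants, i, m⟩ [⟨Bs.map (Ineq.substVar p (bigOr αs)) ++ rest, i, m⟩]
  | leftAckermann (p : ℕ) (αs : List (Term Bool 0)) (Bs rest ants : List (Ineq Bool)) (i m : ℕ) :
      ants.Perm (αs.map (fun α => ⟨.var p, α⟩) ++ Bs ++ rest) →
      (∀ α ∈ αs, α.VarFree p ∧ α.SynOpen) →
      (∀ I ∈ Bs, I.lhs.VarSign p false ∧ I.lhs.SynClosed ∧ I.rhs.VarSign p true ∧ I.rhs.SynOpen) →
      (∀ I ∈ rest, I.lhs.VarFree p ∧ I.rhs.VarFree p) →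
      QRule ⟨ants, i, m⟩ [⟨Bs.map (Ineq.substVar p (bigAnd αs)) ++ rest, i, m⟩]

/-- One step of the algorithm on the current list of quasi-inequalities. -/
inductive Step : List QIneq → List QIneq → Prop
  | mk (l₁ l₂ : List QIneq) {Q : QIneq} {Qs : List QIneq} :
      QRule.{v} Q Qs → Step (l₁ ++ Q :: l₂) (l₁ ++ Qs ++ l₂)

/-- `Run φ ψ Qs`: some run on `φ ≤ ψ` (preprocessing, starring and first approximation, then any
finite number of rule applications) produces the quasi-inequalities `Qs`. -/
def Run (φ ψ : Term Unit 0) (Qs : List QIneq) : Prop :=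
  ∃ (Is : List (Ineq Unit)) (i m : ℕ),
    Relation.ReflTransGen PreStep [⟨φ, ψ⟩] Is ∧
      Relation.ReflTransGen Step.{v} (Is.map (firstApprox i m)) Qs

/-- All propositional variables have been eliminated. -/
def Purified (Qs : List QIneq) : Prop :=
  ∀ Q ∈ Qs, ∀ I ∈ Q.ants, I.lhs.Pure ∧ I.rhs.Pure

/-- All occurrences of binders have been handled by fixed point approximation rules. -/
def BindersHandled (Qs : List QIneq) : Prop :=
  ∀ Q ∈ Qs, ∀ I ∈ Q.ants, I.lhs.AllHandled ∧ I.rhs.AllHandled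

/-- A proper run of the algorithm succeeds on `φ ≤ ψ`. -/
def ProperRunSucceeds (φ ψ : Term Unit 0) : Prop :=
  ∃ Qs : List QIneq, Run.{v} φ ψ Qs ∧ Purified Qs ∧ BindersHandled Qs

end MuCanon

/-!
Starred terms are evaluated in the canonical extension `C` of `A` with fixed points computed inside
a subset `K` of `C`. For `K = A`, with variables ranging over `A`, validity of an inequality of
`A`-defined terms is validity in `A`; for `K = C` it is validity in `C`. A run carries validity for
`K = A` down to pure quasi-inequalities: as fixed points are computed in `A`, syntactically closed
and open terms are continuous enough for the compactness argument of the topological Ackermann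
lemma. Once all binders are handled, passing from `K = C` to `K = A` shrinks the left-hand sides and
enlarges the right-hand sides of the antecedents, so validity of pure quasi-inequalities extends
from `A` to `C`. It is carried back up the run by the ordinary Ackermann lemma, the complete
primality of nominals and co-nominals, and complete join- and meet-preservation in the fixed point
rules.
-/

namespace MuCanon

/-! ### Residuals, adjoints and relative fixed points in complete lattices -/

section CompleteLattice

variable {C : Type v} [CompleteLattice C]

/-- The implication of a complete lattice, defined by the formula that computes the right residual
of `⊓` whenever there is one; it is the one used in `eval`. -/
def relImp (x y : C) : C := sSup {c | c ⊓ x ≤ y}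

/-- The subtraction of a complete lattice, dual to `relImp`. -/
def relSub (x y : C) : C := sInf {c | x ≤ y ⊔ c}

/-- The candidate for a left adjoint of `F`, as used in `eval` to interpret the black diamond. -/
def leftAdj (F : C → C) (x : C) : C := sInf {c | x ≤ F c}

/-- The candidate for a right adjoint of `F`, as used in `eval` to interpret the black box. -/
def rightAdj (F : C → C) (x : C) : C := sSup {c | F c ≤ x}

/-- The least fixed point of `F` relative to `K`: the meet of the prefixed points of `F` in `K`. -/
def lfpIn (K : Set C) (F : C → C) : C := sInf {c | c ∈ K ∧ F c ≤ c}

/-- The greatest fixed point of `F` relative to `K`: the join of the postfixed points of `F` in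
`K`. -/
def gfpIn (K : Set C) (F : C → C) : C := sSup {c | c ∈ K ∧ c ≤ F c}

lemma relSub_eq_relImp_dual (x y : C) :
    relSub x y = OrderDual.ofDual (relImp (OrderDual.toDual y) (OrderDual.toDual x)) := by
  change sInf {c | x ≤ y ⊔ c} = sInf {c | x ≤ c ⊔ y}
  simp only [sup_comm]

lemma relImp_eq_relSub_dual (x y : C) :
    relImp x y = OrderDual.ofDual (relSub (OrderDual.toDual y) (OrderDual.toDual x)) :=
  (relSub_eq_relImp_dual (C := Cᵒᵈ) y x).symm

lemma relImp_mono {x x' y y' : C} (hx : x' ≤ x) (hy : y ≤ y') : relImp x y ≤ relImp x' y' :=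
  sSup_le_sSup fun _ hc => (inf_le_inf_left _ hx).trans (le_trans hc hy)

lemma relSub_mono {x x' y y' : C} (hx : x ≤ x') (hy : y' ≤ y) : relSub x y ≤ relSub x' y' :=
  sInf_le_sInf fun _ hc => hx.trans (le_trans hc (sup_le_sup_right hy _))

lemma leftAdj_mono (F : C → C) : Monotone (leftAdj F) := fun _ _ h =>
  sInf_le_sInf fun _ hc => h.trans hc

lemma rightAdj_mono (F : C → C) : Monotone (rightAdj F) := fun _ _ h =>
  sSup_le_sSup fun _ hc => le_trans hc h

lemma lfpIn_mono {K : Set C} {F G : C → C} (h : ∀ c ∈ K, F c ≤ G c) : lfpIn K F ≤ lfpIn K G :=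
  sInf_le_sInf fun c hc => ⟨hc.1, (h c hc.1).trans hc.2⟩

lemma gfpIn_mono {K : Set C} {F G : C → C} (h : ∀ c ∈ K, F c ≤ G c) : gfpIn K F ≤ gfpIn K G :=
  sSup_le_sSup fun c hc => ⟨hc.1, hc.2.trans (h c hc.1)⟩

lemma lfpIn_anti {K K' : Set C} (h : K ⊆ K') (F : C → C) : lfpIn K' F ≤ lfpIn K F :=
  sInf_le_sInf fun _ hc => ⟨h hc.1, hc.2⟩

lemma gfpIn_mono_left {K K' : Set C} (h : K ⊆ K') (F : C → C) : gfpIn K F ≤ gfpIn K' F :=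
  sSup_le_sSup fun _ hc => ⟨h hc.1, hc.2⟩

lemma gc_leftAdj {F : C → C} (hF : ∀ S, F (sInf S) = sInf (F '' S)) :
    GaloisConnection (leftAdj F) F := by
  have hmono : Monotone F := OrderHomClass.mono (⟨F, hF⟩ : sInfHom C C)
  refine fun x y => ⟨fun h => le_trans ?_ (hmono h), fun h => sInf_le h⟩
  rw [leftAdj, hF]
  exact le_sInf (Set.forall_mem_image.2 fun _ hc => hc)

lemma gc_rightAdj {F : C → C} (hF : ∀ S, F (sSup S) = sSup (F '' S)) :
    GaloisConnection F (rightAdj F) :=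
  (gc_leftAdj (C := Cᵒᵈ) (F := F) hF).dual

/-! ### Completely prime elements -/

/-- Completely join-prime elements. -/
def IsJoinPrime (j : C) : Prop := ∀ X : Set C, j ≤ sSup X → ∃ x ∈ X, j ≤ x

/-- Completely meet-prime elements. -/
def IsMeetPrime (m : C) : Prop := ∀ X : Set C, sInf X ≤ m → ∃ x ∈ X, x ≤ m

variable (C) in
/-- Join-density of the completely join-prime elements. -/
def JoinPrimeDense : Prop := ∀ c d : C, (∀ j, IsJoinPrime j → j ≤ c → j ≤ d) → c ≤ d

variable (C) in
/-- Meet-density of the completely meet-prime elements. -/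
def MeetPrimeDense : Prop := ∀ c d : C, (∀ m, IsMeetPrime m → d ≤ m → c ≤ m) → c ≤ d

lemma MeetPrimeDense.dual (hC : MeetPrimeDense C) : JoinPrimeDense Cᵒᵈ := fun c d h => hC d c h

lemma IsJoinPrime.irreducible {j : C} (hj : IsJoinPrime j) : IsCompletelyJoinIrreducible j := by
  intro X hX
  obtain ⟨x, hx, hjx⟩ := hj X hX.le
  rwa [le_antisymm hjx (hX ▸ le_sSup hx)]

lemma IsMeetPrime.irreducible {m : C} (hm : IsMeetPrime m) : IsCompletelyMeetIrreducible m :=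
  IsJoinPrime.irreducible (C := Cᵒᵈ) hm

namespace JoinPrimeDense

variable (hC : JoinPrimeDense C)
include hC

lemma isJoinPrime {j : C} (hj : IsCompletelyJoinIrreducible j) : IsJoinPrime j :=
  (hj {i | IsJoinPrime i ∧ i ≤ j} (le_antisymm
    (hC _ _ fun _ hi hij => le_sSup ⟨hi, hij⟩) (sSup_le fun _ hi => hi.2))).1

lemma eq_sSup_irreducible (c : C) : c = sSup {j | IsCompletelyJoinIrreducible j ∧ j ≤ c} :=
  le_antisymm (hC _ _ fun _ hj hjc => le_sSup ⟨hj.irreducible, hjc⟩) (sSup_le fun _ hj => hj.2)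

lemma iInf_iSup_eq {ι : Type*} {κ : ι → Type*} (f : ∀ i, κ i → C) :
    ⨅ i, ⨆ k, f i k = ⨆ g : ∀ i, κ i, ⨅ i, f i (g i) := by
  refine le_antisymm (hC _ _ fun j hj hle => ?_)
    (iSup_le fun g => le_iInf fun i => (iInf_le _ i).trans (le_iSup (f i) (g i)))
  have exists_index (i) : ∃ k, j ≤ f i k := by
    simpa using hj (Set.range (f i)) (hle.trans (iInf_le _ i))
  choose g hg using exists_index
  exact le_iSup_of_le g (le_iInf hg)

lemma inf_sup_left (x y z : C) : x ⊓ (y ⊔ z) = x ⊓ y ⊔ x ⊓ z := by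
  refine le_antisymm (hC _ _ fun j hj hle => ?_) le_inf_sup
  obtain ⟨w, rfl | rfl, hjw⟩ := hj {y, z} (by simpa only [sSup_pair] using hle.trans inf_le_right)
  · exact le_sup_of_le_left (le_inf (hle.trans inf_le_left) hjw)
  · exact le_sup_of_le_right (le_inf (hle.trans inf_le_left) hjw)

lemma le_relImp_iff {x y z : C} : z ≤ relImp x y ↔ z ⊓ x ≤ y := by
  refine ⟨fun h => hC _ _ fun j hj hle => ?_, fun h => le_sSup h⟩
  obtain ⟨c, hc, hjc⟩ := hj _ ((hle.trans inf_le_left).trans h)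
  exact (le_inf hjc (hle.trans inf_le_right)).trans hc

end JoinPrimeDense

namespace MeetPrimeDense

variable (hC : MeetPrimeDense C)
include hC

lemma isMeetPrime {m : C} (hm : IsCompletelyMeetIrreducible m) : IsMeetPrime m :=
  hC.dual.isJoinPrime (j := OrderDual.toDual m) hm

lemma eq_sInf_irreducible (c : C) : c = sInf {m | IsCompletelyMeetIrreducible m ∧ c ≤ m} :=
  hC.dual.eq_sSup_irreducible c

lemma sup_inf_left (x y z : C) : x ⊔ y ⊓ z = (x ⊔ y) ⊓ (x ⊔ z) := hC.dual.inf_sup_left x y z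

lemma relSub_le_iff {x y z : C} : relSub x y ≤ z ↔ x ≤ y ⊔ z := by
  rw [relSub_eq_relImp_dual, sup_comm]
  exact hC.dual.le_relImp_iff

end MeetPrimeDense

end CompleteLattice

/-! ### Dense and compact completions -/

section DenseCompact

variable {A : Type u} {C : Type v} [CompleteLattice C]

section Lattice

variable [Lattice A] [BoundedOrder A]

/-- Closed elements of a completion `e`: meets of elements of the lattice. Unlike `ClosedElts`, this
notion does not refer to modalities, so that it dualizes along `e.dual`. -/
def IsClosedElt (e : BoundedLatticeHom A C) (c : C) : Prop := ∃ S : Set A, c = sInf (e '' S)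

/-- Open elements of a completion `e`: joins of elements of the lattice. -/
def IsOpenElt (e : BoundedLatticeHom A C) (c : C) : Prop := ∃ S : Set A, c = sSup (e '' S)

/-- Dense and compact completions of a bounded lattice, with density stated as: the order is
determined by closed elements below, and by open elements above. -/
structure IsDenseCompact (e : BoundedLatticeHom A C) : Prop where
  le_of_forall_closed : ∀ c d, (∀ k, IsClosedElt e k → k ≤ c → k ≤ d) → c ≤ d
  le_of_forall_open : ∀ c d, (∀ o, IsOpenElt e o → d ≤ o → c ≤ o) → c ≤ d
  compact : ∀ S T : Set A, sInf (e '' S) ≤ sSup (e '' T) →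
    ∃ S' T' : Finset A, ↑S' ⊆ S ∧ ↑T' ⊆ T ∧ S'.inf id ≤ T'.sup id

variable {e : BoundedLatticeHom A C}

lemma isClosedElt_map (e : BoundedLatticeHom A C) (a : A) : IsClosedElt e (e a) := ⟨{a}, by simp⟩

lemma isOpenElt_map (e : BoundedLatticeHom A C) (a : A) : IsOpenElt e (e a) := ⟨{a}, by simp⟩

lemma IsClosedElt.eq_sInf {k : C} (hk : IsClosedElt e k) : k = sInf (e '' {a | k ≤ e a}) := by
  refine le_antisymm (le_sInf (Set.forall_mem_image.2 fun _ ha => ha)) ?_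
  obtain ⟨S, rfl⟩ := hk
  exact sInf_le_sInf (Set.image_mono fun a ha => sInf_le (Set.mem_image_of_mem e ha))

lemma IsOpenElt.eq_sSup {o : C} (ho : IsOpenElt e o) : o = sSup (e '' {a | e a ≤ o}) :=
  IsClosedElt.eq_sInf (e := e.dual) ho

lemma infClosed_setOf_le_map (e : BoundedLatticeHom A C) (x : C) : InfClosed {a | x ≤ e a} :=
  fun a ha b hb => by
    change x ≤ e (a ⊓ b)
    rw [map_inf]
    exact le_inf ha hb

namespace IsDenseCompact

variable (he : IsDenseCompact e)
include he

lemma dual : IsDenseCompact e.dual where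
  le_of_forall_closed c d := he.le_of_forall_open d c
  le_of_forall_open c d := he.le_of_forall_closed d c
  compact S T h := by
    obtain ⟨S', T', hS, hT, hle⟩ := he.compact T S h
    exact ⟨T', S', hT, hS, hle⟩

lemma map_le_map_iff {a b : A} : e a ≤ e b ↔ a ≤ b := by
  refine ⟨fun h => ?_, fun h => OrderHomClass.mono e h⟩
  obtain ⟨S, T, hS, hT, hle⟩ := he.compact {a} {b} (by simpa using h)
  calc a ≤ S.inf id := Finset.le_inf fun x hx => (Set.mem_singleton_iff.1 (hS hx)).ge
    _ ≤ T.sup id := hle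
    _ ≤ b := Finset.sup_le fun x hx => (Set.mem_singleton_iff.1 (hT hx)).le

lemma exists_finset_inf_le {S : Set A} {o : C} (ho : IsOpenElt e o) (h : sInf (e '' S) ≤ o) :
    ∃ S' : Finset A, ↑S' ⊆ S ∧ e (S'.inf id) ≤ o := by
  obtain ⟨T, rfl⟩ := ho
  obtain ⟨S', T', hS, hT, hle⟩ := he.compact S T h
  refine ⟨S', hS, (he.map_le_map_iff.2 hle).trans ?_⟩
  rw [map_finset_sup]
  exact Finset.sup_le fun a ha => le_sSup (Set.mem_image_of_mem e (hT ha))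

lemma exists_mem_map_le {G : Set A} {o : C} (ho : IsOpenElt e o) (htop : ⊤ ∈ G)
    (hinf : InfClosed G) (h : sInf (e '' G) ≤ o) : ∃ a ∈ G, e a ≤ o := by
  obtain ⟨S, hS, hle⟩ := he.exists_finset_inf_le ho h
  exact ⟨S.inf id, Finset.inf_mem G htop (fun _ ha _ hb => hinf ha hb) S id fun _ ha => hS ha, hle⟩

lemma exists_mem_le_map {G : Set A} {k : C} (hk : IsClosedElt e k) (hbot : ⊥ ∈ G)
    (hsup : SupClosed G) (h : k ≤ sSup (e '' G)) : ∃ a ∈ G, k ≤ e a :=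
  he.dual.exists_mem_map_le (G := G) (o := k) hk hbot hsup h

lemma exists_between {k o : C} (hk : IsClosedElt e k) (ho : IsOpenElt e o) (h : k ≤ o) :
    ∃ a, k ≤ e a ∧ e a ≤ o :=
  he.exists_mem_map_le (G := {a | k ≤ e a}) ho (show k ≤ e ⊤ by simp)
    (infClosed_setOf_le_map e k) (hk.eq_sInf.ge.trans h)

lemma exists_map_inf_le {x y o : C} (hx : IsClosedElt e x) (hy : IsClosedElt e y)
    (ho : IsOpenElt e o) (h : x ⊓ y ≤ o) : ∃ a b, x ≤ e a ∧ y ≤ e b ∧ e (a ⊓ b) ≤ o := by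
  let G : Set A := {c | ∃ a b, x ≤ e a ∧ y ≤ e b ∧ a ⊓ b = c}
  have hG : InfClosed G := by
    rintro _ ⟨a, b, ha, hb, rfl⟩ _ ⟨a', b', ha', hb', rfl⟩
    exact ⟨a ⊓ a', b ⊓ b', infClosed_setOf_le_map e x ha ha', infClosed_setOf_le_map e y hb hb',
      inf_inf_inf_comm ..⟩
  have hx' : sInf (e '' G) ≤ x := by
    refine le_of_le_of_eq (sInf_le_sInf (Set.image_mono fun a ha => ?_)) hx.eq_sInf.symm
    exact ⟨a, ⊤, ha, by simp, inf_top_eq a⟩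
  have hy' : sInf (e '' G) ≤ y := by
    refine le_of_le_of_eq (sInf_le_sInf (Set.image_mono fun b hb => ?_)) hy.eq_sInf.symm
    exact ⟨⊤, b, by simp, hb, top_inf_eq b⟩
  obtain ⟨_, ⟨a, b, ha, hb, rfl⟩, hab⟩ := he.exists_mem_map_le ho
    (G := G) ⟨⊤, ⊤, by simp, by simp, top_inf_eq ⊤⟩ hG ((le_inf hx' hy').trans h)
  exact ⟨a, b, ha, hb, hab⟩

lemma exists_le_map_sup {x y k : C} (hx : IsOpenElt e x) (hy : IsOpenElt e y)
    (hk : IsClosedElt e k) (h : k ≤ x ⊔ y) : ∃ a b, e a ≤ x ∧ e b ≤ y ∧ k ≤ e (a ⊔ b) :=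
  he.dual.exists_map_inf_le (x := x) (y := y) (o := k) hx hy hk h

lemma isClosedElt_of_irreducible {j : C} (hj : IsCompletelyJoinIrreducible j) :
    IsClosedElt e j := by
  refine (hj {k | IsClosedElt e k ∧ k ≤ j} (le_antisymm ?_ (sSup_le fun _ hk => hk.2))).1
  exact he.le_of_forall_closed _ _ fun k hk hkj => le_sSup ⟨hk, hkj⟩

lemma isOpenElt_of_irreducible {m : C} (hm : IsCompletelyMeetIrreducible m) : IsOpenElt e m :=
  he.dual.isClosedElt_of_irreducible (j := OrderDual.toDual m) hm

lemma isJoinPrime_sInf_compl {J : Order.Ideal A} (hJ : J.IsPrime) :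
    IsJoinPrime (sInf (e '' (J : Set A)ᶜ)) := by
  have hinf : InfClosed (J : Set A)ᶜ := fun a ha b hb hab => (hJ.mem_or_mem hab).elim ha hb
  have htop : ⊤ ∈ (J : Set A)ᶜ := hJ.toIsProper.top_notMem
  intro X hX
  by_contra! hno
  have le_sSup_ideal (x) (hx : x ∈ X) : x ≤ sSup (e '' J) := by
    obtain ⟨w, hw, hxw, hnw⟩ : ∃ w, IsOpenElt e w ∧ x ≤ w ∧ ¬ sInf (e '' (J : Set A)ᶜ) ≤ w := by
      by_contra! hcon
      exact hno x hx (he.le_of_forall_open _ _ hcon)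
    refine hxw.trans (hw.eq_sSup.trans_le (sSup_le_sSup (Set.image_mono fun a ha => ?_)))
    by_contra haJ
    exact hnw ((sInf_le (Set.mem_image_of_mem e haJ)).trans ha)
  obtain ⟨a, haJ, ha⟩ := he.exists_mem_le_map ⟨_, rfl⟩ J.bot_mem
    (fun _ ha _ hb => Order.Ideal.sup_mem ha hb) (hX.trans (sSup_le le_sSup_ideal))
  obtain ⟨b, hb, hba⟩ := he.exists_mem_map_le (isOpenElt_map e a) htop hinf ha
  exact hb (J.lower (he.map_le_map_iff.1 hba) haJ)

end IsDenseCompact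

end Lattice

section DistribLattice

variable [DistribLattice A] [BoundedOrder A] {e : BoundedLatticeHom A C}

namespace IsDenseCompact

variable (he : IsDenseCompact e)
include he

lemma exists_isPrime_separating {k o : C} (h : ¬ k ≤ o) :
    ∃ J : Order.Ideal A, J.IsPrime ∧ {a | e a ≤ o} ⊆ J ∧ {a | k ≤ e a} ⊆ (J : Set A)ᶜ := by
  let F : Order.PFilter A := Order.IsPFilter.toPFilter (F := {a | k ≤ e a})
    (.of_def ⟨⊤, by simp⟩
      (fun a ha b hb => ⟨a ⊓ b, infClosed_setOf_le_map e k ha hb, inf_le_left, inf_le_right⟩)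
      (fun hab ha => le_trans ha (he.map_le_map_iff.2 hab)))
  let I : Order.Ideal A := Order.IsIdeal.toIdeal (I := {a | e a ≤ o})
    ⟨fun _ _ hab ha => (he.map_le_map_iff.2 hab).trans ha, ⟨⊥, by simp⟩,
      fun a ha b hb => ⟨a ⊔ b, infClosed_setOf_le_map e.dual o ha hb, le_sup_left, le_sup_right⟩⟩
  have hFI : Disjoint (F : Set A) (I : Set A) :=
    Set.disjoint_left.2 fun a (hka : k ≤ e a) (hao : e a ≤ o) => h (hka.trans hao)
  obtain ⟨J, hJ, hIJ, hFJ⟩ := DistribLattice.prime_ideal_of_disjoint_filter_ideal hFI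
  exact ⟨J, hJ, hIJ, hFJ.subset_compl_right⟩

lemma exists_isJoinPrime {k o : C} (hk : IsClosedElt e k) (ho : IsOpenElt e o) (h : ¬ k ≤ o) :
    ∃ j, IsJoinPrime j ∧ j ≤ k ∧ ¬ j ≤ o := by
  obtain ⟨J, hJ, hoJ, hkJ⟩ := he.exists_isPrime_separating h
  refine ⟨_, he.isJoinPrime_sInf_compl hJ,
    (sInf_le_sInf (Set.image_mono hkJ)).trans hk.eq_sInf.ge, fun hle => ?_⟩
  obtain ⟨a, haJ, hao⟩ := he.exists_mem_map_le (G := (J : Set A)ᶜ) ho hJ.toIsProper.top_notMem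
    (fun a ha b hb hab => (hJ.mem_or_mem hab).elim ha hb) hle
  exact haJ (hoJ hao)

theorem joinPrimeDense : JoinPrimeDense C := by
  refine fun c d h => he.le_of_forall_closed _ _ fun k hk hkc =>
    he.le_of_forall_open _ _ fun o ho hdo => ?_
  by_contra hko
  obtain ⟨j, hj, hjk, hjo⟩ := he.exists_isJoinPrime hk ho hko
  exact hjo ((h j hj (hjk.trans hkc)).trans hdo)

theorem meetPrimeDense : MeetPrimeDense C := fun c d h => he.dual.joinPrimeDense d c h

end IsDenseCompact

end DistribLattice

lemma IsDenseCompact.map_himp [HeytingAlgebra A] {e : BoundedLatticeHom A C}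
    (he : IsDenseCompact e) (a b : A) : e (a ⇨ b) = relImp (e a) (e b) := by
  apply le_antisymm
  · rw [he.joinPrimeDense.le_relImp_iff, ← map_inf, he.map_le_map_iff]
    exact himp_inf_le
  · refine he.le_of_forall_closed _ _ fun k hk hle => ?_
    obtain ⟨c, d, hkc, had, hcd⟩ := he.exists_map_inf_le hk (isClosedElt_map e a)
      (isOpenElt_map e b) (he.joinPrimeDense.le_relImp_iff.1 hle)
    refine hkc.trans (he.map_le_map_iff.2 (le_himp_iff.2 ?_))
    exact (inf_le_inf_left c (he.map_le_map_iff.1 had)).trans (he.map_le_map_iff.1 hcd)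

lemma IsDenseCompact.map_sdiff [CoheytingAlgebra A] {e : BoundedLatticeHom A C}
    (he : IsDenseCompact e) (a b : A) : e (a \ b) = relSub (e a) (e b) :=
  (he.dual.map_himp (OrderDual.toDual b) (OrderDual.toDual a)).trans
    (relSub_eq_relImp_dual (e a) (e b)).symm

lemma IsDenseCompact.exists_map_himp_le [HeytingAlgebra A] {e : BoundedLatticeHom A C}
    (he : IsDenseCompact e) {x y o : C} (hx : IsOpenElt e x) (hy : IsClosedElt e y)
    (ho : IsOpenElt e o) (h : relImp x y ≤ o) : ∃ a b, e a ≤ x ∧ y ≤ e b ∧ e (a ⇨ b) ≤ o := by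
  let G : Set A := {c | ∃ a b, e a ≤ x ∧ y ≤ e b ∧ a ⇨ b ≤ c}
  have hG : InfClosed G := by
    rintro c ⟨a, b, ha, hb, hc⟩ c' ⟨a', b', ha', hb', hc'⟩
    exact ⟨a ⊔ a', b ⊓ b', infClosed_setOf_le_map e.dual x ha ha',
      infClosed_setOf_le_map e y hb hb',
      le_inf ((himp_le_himp le_sup_left inf_le_left).trans hc)
        ((himp_le_himp le_sup_right inf_le_right).trans hc')⟩
  have le_relImp_map {a b : A} (ha : e a ≤ x) (hb : y ≤ e b) :
      sInf (e '' G) ≤ relImp (e a) (e b) :=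
    (sInf_le (Set.mem_image_of_mem e (show a ⇨ b ∈ G from ⟨a, b, ha, hb, le_rfl⟩))).trans
      (he.map_himp a b).le
  have hle : sInf (e '' G) ≤ relImp x y := by
    have hC := he.joinPrimeDense
    rw [hC.le_relImp_iff, inf_comm, ← hC.le_relImp_iff]
    refine hx.eq_sSup.trans_le (sSup_le (Set.forall_mem_image.2 fun a ha => ?_))
    rw [hC.le_relImp_iff]
    refine (le_sInf (Set.forall_mem_image.2 fun b hb => ?_)).trans hy.eq_sInf.ge
    rw [inf_comm, ← hC.le_relImp_iff]
    exact le_relImp_map ha hb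
  obtain ⟨c, ⟨a, b, ha, hb, hab⟩, hc⟩ := he.exists_mem_map_le ho
    (G := G) ⟨⊥, ⊤, by simp, by simp, le_top⟩ hG (hle.trans h)
  exact ⟨a, b, ha, hb, (he.map_le_map_iff.2 hab).trans hc⟩

end DenseCompact

/-! ### Extensions of box and diamond -/

section ModalExtension

variable {A : Type u} {C : Type v} [CompleteLattice C] [Lattice A] [BoundedOrder A]

/-- `F` is the extension of the box operator `f` along the completion `e`. The condition says that
on closed elements `F` has the left adjoint induced by the preimages of principal filters; for dense
compact completions it characterizes `f^π`. -/
def IsBoxExt (e : BoundedLatticeHom A C) (f : InfTopHom A A) (F : C → C) : Prop :=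
  ∀ k, IsClosedElt e k → ∀ c, k ≤ F c ↔ sInf (e '' {a | k ≤ e (f a)}) ≤ c

/-- `F` is the extension of the diamond operator `f` along the completion `e`, dually to
`IsBoxExt`. -/
def IsDiaExt (e : BoundedLatticeHom A C) (f : SupBotHom A A) (F : C → C) : Prop :=
  ∀ o, IsOpenElt e o → ∀ c, F c ≤ o ↔ c ≤ sSup (e '' {a | e (f a) ≤ o})

variable {e : BoundedLatticeHom A C}

lemma IsDiaExt.dual {f : SupBotHom A A} {F : C → C} (hF : IsDiaExt e f F) :
    IsBoxExt (C := Cᵒᵈ) e.dual f.dual F := hF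

namespace IsDenseCompact

variable (he : IsDenseCompact e)
include he

lemma isBoxExt_of_le_iff (f : InfTopHom A A) {F : C → C}
    (hF : ∀ x c, x ≤ F c ↔ ∀ k o, IsClosedElt e k → IsOpenElt e o → k ≤ c → c ≤ o →
      x ≤ sSup ((fun a => e (f a)) '' {a | k ≤ e a ∧ e a ≤ o})) : IsBoxExt e f F := by
  refine fun k hk c => ⟨fun h => he.le_of_forall_open _ _ fun o ho hco => ?_,
    fun h => (hF k c).2 fun k' o hk' ho hkc hco => ?_⟩
  · let G : Set A := {b | ∃ a, e a ≤ o ∧ b ≤ f a}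
    have hG : SupClosed G := by
      rintro b ⟨a, ha, hb⟩ b' ⟨a', ha', hb'⟩
      exact ⟨a ⊔ a', infClosed_setOf_le_map e.dual o ha ha',
        sup_le (hb.trans (OrderHomClass.mono f le_sup_left))
          (hb'.trans (OrderHomClass.mono f le_sup_right))⟩
    have hkG : k ≤ sSup (e '' G) := by
      refine ((hF k c).1 h ⊥ o ⟨{⊥}, by simp⟩ ho bot_le hco).trans (sSup_le ?_)
      rintro _ ⟨a, ha, rfl⟩
      exact le_sSup (Set.mem_image_of_mem e (show f a ∈ G from ⟨a, ha.2, le_rfl⟩))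
    obtain ⟨b, ⟨a, hao, hba⟩, hkb⟩ := he.exists_mem_le_map (G := G) hk ⟨⊥, by simp, bot_le⟩ hG hkG
    have hka : k ≤ e (f a) := hkb.trans (he.map_le_map_iff.2 hba)
    exact (sInf_le (Set.mem_image_of_mem e hka)).trans hao
  · obtain ⟨a, hka, hao⟩ := he.exists_mem_map_le (G := {a | k ≤ e (f a)}) ho
      (show k ≤ e (f ⊤) by simp) ((infClosed_setOf_le_map e k).preimage f) (h.trans hco)
    obtain ⟨a', hka', hao'⟩ := he.exists_between hk' ho (hkc.trans hco)
    have hmono : f a ≤ f (a ⊔ a') := OrderHomClass.mono f le_sup_left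
    exact (hka.trans (he.map_le_map_iff.2 hmono)).trans
      (le_sSup ⟨a ⊔ a', ⟨hka'.trans (he.map_le_map_iff.2 le_sup_right),
        infClosed_setOf_le_map e.dual o hao hao'⟩, rfl⟩)

end IsDenseCompact

namespace IsBoxExt

variable {f : InfTopHom A A} {F : C → C} (hF : IsBoxExt e f F) (he : IsDenseCompact e)
include hF he

lemma map_sInf (S : Set C) : F (sInf S) = sInf (F '' S) := by
  apply le_antisymm
  · refine he.le_of_forall_closed _ _ fun k hk hle =>
      le_sInf (Set.forall_mem_image.2 fun c hc => ?_)
    exact (hF k hk c).2 (((hF k hk _).1 hle).trans (sInf_le hc))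
  · refine he.le_of_forall_closed _ _ fun k hk hle => (hF k hk _).2 (le_sInf fun c hc => ?_)
    exact (hF k hk c).1 (hle.trans (sInf_le (Set.mem_image_of_mem F hc)))

lemma gc : GaloisConnection (leftAdj F) F := gc_leftAdj (hF.map_sInf he)

lemma exists_of_closed_le_open {k o : C} (hk : IsClosedElt e k) (ho : IsOpenElt e o)
    (h : k ≤ F o) : ∃ a, k ≤ e (f a) ∧ e a ≤ o :=
  he.exists_mem_map_le (G := {a | k ≤ e (f a)}) ho (show k ≤ e (f ⊤) by simp)
    ((infClosed_setOf_le_map e k).preimage f) ((hF k hk o).1 h)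

lemma map_apply (a : A) : F (e a) = e (f a) := by
  apply le_antisymm
  · refine he.le_of_forall_closed _ _ fun k hk hle => ?_
    obtain ⟨b, hkb, hba⟩ := hF.exists_of_closed_le_open he hk (isOpenElt_map e a) hle
    exact hkb.trans (he.map_le_map_iff.2 (OrderHomClass.mono f (he.map_le_map_iff.1 hba)))
  · exact (hF _ (isClosedElt_map e _) _).2 (sInf_le ⟨a, le_rfl, rfl⟩)

lemma exists_of_map_closed_le_open {k o : C} (hk : IsClosedElt e k) (ho : IsOpenElt e o)
    (h : F k ≤ o) : ∃ a, k ≤ e a ∧ e (f a) ≤ o := by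
  have hle : sInf (e '' (f '' {a | k ≤ e a})) ≤ o := by
    rwa [Set.image_image, Set.image_congr fun a _ => (hF.map_apply he a).symm,
      ← Set.image_image, ← hF.map_sInf he, ← hk.eq_sInf]
  obtain ⟨_, ⟨a, ha, rfl⟩, hao⟩ := he.exists_mem_map_le (G := f '' {a | k ≤ e a}) ho
    ⟨⊤, show k ≤ e ⊤ by simp, map_top f⟩ ((infClosed_setOf_le_map e k).image f) hle
  exact ⟨a, ha, hao⟩

end IsBoxExt

end ModalExtension

/-! ### Limits of directed families -/

section Limit

variable {A : Type u} {C : Type v} [CompleteLattice C] {D : Type*} [Preorder D]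

section Lattice

variable [Lattice A] [BoundedOrder A]

/-- The antitone family `f` converges to the closed element `x`: every element of the algebra above
`x` is above some `f d`, and every open element above `x` has such an element below it. -/
structure ClosedLim (e : BoundedLatticeHom A C) (x : C) (f : D → C) : Prop where
  le : ∀ d, x ≤ f d
  anti : Antitone f
  approx : ∀ o, IsOpenElt e o → x ≤ o → ∃ d a, f d ≤ e a ∧ e a ≤ o

/-- The monotone family `f` converges to the open element `x`, dually to `ClosedLim`. -/
structure OpenLim (e : BoundedLatticeHom A C) (x : C) (f : D → C) : Prop where
  le : ∀ d, f d ≤ x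
  mono : Monotone f
  approx : ∀ k, IsClosedElt e k → k ≤ x → ∃ d a, e a ≤ f d ∧ k ≤ e a

variable {e : BoundedLatticeHom A C} {x y : C} {f g : D → C}

lemma OpenLim.dual (h : OpenLim e x f) : ClosedLim (C := Cᵒᵈ) e.dual x f :=
  ⟨h.le, h.mono, h.approx⟩

lemma ClosedLim.dual (h : ClosedLim e x f) : OpenLim (C := Cᵒᵈ) e.dual x f :=
  ⟨h.le, h.anti, h.approx⟩

lemma ClosedLim.of_dual (h : ClosedLim (C := Cᵒᵈ) e.dual x f) : OpenLim e x f :=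
  ⟨h.le, h.anti, h.approx⟩

lemma OpenLim.of_dual (h : OpenLim (C := Cᵒᵈ) e.dual x f) : ClosedLim e x f :=
  ⟨h.le, h.mono, h.approx⟩

lemma ClosedLim.const [Nonempty D] (he : IsDenseCompact e) (hx : IsClosedElt e x) :
    ClosedLim e x (fun _ : D => x) :=
  ⟨fun _ => le_rfl, antitone_const, fun _ ho h =>
    ⟨Classical.arbitrary D, he.exists_between hx ho h⟩⟩

lemma OpenLim.const [Nonempty D] (he : IsDenseCompact e) (hx : IsOpenElt e x) :
    OpenLim e x (fun _ : D => x) :=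
  (ClosedLim.const (C := Cᵒᵈ) he.dual hx).of_dual

lemma ClosedLim.isClosedElt (he : IsDenseCompact e) (h : ClosedLim e x f) : IsClosedElt e x := by
  refine ⟨{a | x ≤ e a}, le_antisymm (le_sInf (Set.forall_mem_image.2 fun _ ha => ha)) ?_⟩
  refine he.le_of_forall_open _ _ fun o ho hxo => ?_
  obtain ⟨d, a, hda, hao⟩ := h.approx o ho hxo
  exact (sInf_le (Set.mem_image_of_mem e ((h.le d).trans hda))).trans hao

lemma OpenLim.isOpenElt (he : IsDenseCompact e) (h : OpenLim e x f) : IsOpenElt e x :=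
  h.dual.isClosedElt he.dual

lemma ClosedLim.exists_le_map (hf : ClosedLim e x f) {a : A} (h : x ≤ e a) : ∃ d, f d ≤ e a := by
  obtain ⟨d, b, hd, hb⟩ := hf.approx _ (isOpenElt_map e a) h
  exact ⟨d, hd.trans hb⟩

lemma OpenLim.exists_map_le (hf : OpenLim e x f) {a : A} (h : e a ≤ x) : ∃ d, e a ≤ f d :=
  hf.dual.exists_le_map h

section Modal

variable (he : IsDenseCompact e)
include he

lemma ClosedLim.box {b : InfTopHom A A} {B : C → C} (hB : IsBoxExt e b B)
    (hf : ClosedLim e x f) : ClosedLim e (B x) (fun d => B (f d)) := by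
  have hmono := (hB.gc he).monotone_u
  refine ⟨fun d => hmono (hf.le d), hmono.comp_antitone hf.anti, fun o ho h => ?_⟩
  obtain ⟨a, hxa, hao⟩ := hB.exists_of_map_closed_le_open he (hf.isClosedElt he) ho h
  obtain ⟨d, hd⟩ := hf.exists_le_map hxa
  exact ⟨d, b a, (hmono hd).trans (hB.map_apply he a).le, hao⟩

lemma OpenLim.box {b : InfTopHom A A} {B : C → C} (hB : IsBoxExt e b B)
    (hf : OpenLim e x f) : OpenLim e (B x) (fun d => B (f d)) := by
  have hmono := (hB.gc he).monotone_u
  refine ⟨fun d => hmono (hf.le d), hmono.comp hf.mono, fun k hk h => ?_⟩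
  obtain ⟨a, hka, hax⟩ := hB.exists_of_closed_le_open he hk (hf.isOpenElt he) h
  obtain ⟨d, hd⟩ := hf.exists_map_le hax
  exact ⟨d, b a, (hB.map_apply he a).ge.trans (hmono hd), hka⟩

lemma ClosedLim.leftAdj {b : InfTopHom A A} {B : C → C} (hB : IsBoxExt e b B)
    (hf : ClosedLim e x f) : ClosedLim e (leftAdj B x) (fun d => leftAdj B (f d)) := by
  have hmono := leftAdj_mono B
  refine ⟨fun d => hmono (hf.le d), hmono.comp_antitone hf.anti, fun o ho h => ?_⟩
  obtain ⟨a, hxa, hao⟩ := hB.exists_of_closed_le_open he (hf.isClosedElt he) ho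
    (((hB.gc he) _ _).1 h)
  obtain ⟨d, hd⟩ := hf.exists_le_map hxa
  exact ⟨d, a, sInf_le (hd.trans (hB.map_apply he a).ge), hao⟩

lemma OpenLim.dia {b : SupBotHom A A} {B : C → C} (hB : IsDiaExt e b B)
    (hf : OpenLim e x f) : OpenLim e (B x) (fun d => B (f d)) :=
  (hf.dual.box he.dual hB.dual).of_dual

lemma ClosedLim.dia {b : SupBotHom A A} {B : C → C} (hB : IsDiaExt e b B)
    (hf : ClosedLim e x f) : ClosedLim e (B x) (fun d => B (f d)) :=
  (hf.dual.box he.dual hB.dual).of_dual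

lemma OpenLim.rightAdj {b : SupBotHom A A} {B : C → C} (hB : IsDiaExt e b B)
    (hf : OpenLim e x f) : OpenLim e (rightAdj B x) (fun d => rightAdj B (f d)) :=
  (hf.dual.leftAdj he.dual hB.dual).of_dual

end Modal

variable [IsDirectedOrder D]

lemma ClosedLim.sup (hf : ClosedLim e x f) (hg : ClosedLim e y g) :
    ClosedLim e (x ⊔ y) (fun d => f d ⊔ g d) := by
  refine ⟨fun d => sup_le_sup (hf.le d) (hg.le d), hf.anti.sup hg.anti, fun o ho h => ?_⟩
  obtain ⟨d₁, a₁, hfa, hao₁⟩ := hf.approx o ho (le_sup_left.trans h)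
  obtain ⟨d₂, a₂, hga, hao₂⟩ := hg.approx o ho (le_sup_right.trans h)
  obtain ⟨d, hd₁, hd₂⟩ := exists_ge_ge d₁ d₂
  refine ⟨d, a₁ ⊔ a₂, ?_, infClosed_setOf_le_map e.dual o hao₁ hao₂⟩
  rw [map_sup]
  exact sup_le_sup ((hf.anti hd₁).trans hfa) ((hg.anti hd₂).trans hga)

lemma OpenLim.inf (hf : OpenLim e x f) (hg : OpenLim e y g) :
    OpenLim e (x ⊓ y) (fun d => f d ⊓ g d) :=
  (hf.dual.sup hg.dual).of_dual

lemma ClosedLim.inf (he : IsDenseCompact e) (hf : ClosedLim e x f) (hg : ClosedLim e y g) :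
    ClosedLim e (x ⊓ y) (fun d => f d ⊓ g d) := by
  refine ⟨fun d => inf_le_inf (hf.le d) (hg.le d), hf.anti.inf hg.anti, fun o ho h => ?_⟩
  obtain ⟨a, b, ha, hb, hab⟩ :=
    he.exists_map_inf_le (hf.isClosedElt he) (hg.isClosedElt he) ho h
  obtain ⟨d₁, hfa⟩ := hf.exists_le_map ha
  obtain ⟨d₂, hgb⟩ := hg.exists_le_map hb
  obtain ⟨d, hd₁, hd₂⟩ := exists_ge_ge d₁ d₂
  refine ⟨d, a ⊓ b, ?_, hab⟩
  rw [map_inf]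
  exact inf_le_inf ((hf.anti hd₁).trans hfa) ((hg.anti hd₂).trans hgb)

lemma OpenLim.sup (he : IsDenseCompact e) (hf : OpenLim e x f) (hg : OpenLim e y g) :
    OpenLim e (x ⊔ y) (fun d => f d ⊔ g d) :=
  (hf.dual.inf he.dual hg.dual).of_dual

variable [Nonempty D] {F : C → C} {G : D → C → C}

lemma ClosedLim.lfpIn (he : IsDenseCompact e)
    (h : ∀ a, ClosedLim e (F (e a)) (fun d => G d (e a))) :
    ClosedLim e (lfpIn (Set.range e) F) (fun d => lfpIn (Set.range e) (G d)) := by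
  refine ⟨fun d => lfpIn_mono ?_, fun d d' hd => lfpIn_mono ?_, fun o ho hle => ?_⟩
  · exact Set.forall_mem_range.2 fun a => (h a).le d
  · exact Set.forall_mem_range.2 fun a => (h a).anti hd
  · have hset : {c | c ∈ Set.range e ∧ F c ≤ c} = e '' {a | F (e a) ≤ e a} := by
      ext c
      exact ⟨fun ⟨⟨a, ha⟩, hc⟩ => ⟨a, by subst ha; exact hc, ha⟩,
        fun ⟨a, ha, hc⟩ => ⟨⟨a, hc⟩, hc ▸ ha⟩⟩
    rw [MuCanon.lfpIn, hset] at hle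
    obtain ⟨S, hS, hSo⟩ := he.exists_finset_inf_le ho hle
    choose φ hφ using fun a : S => (h a).exists_le_map (hS a.2)
    classical
    obtain ⟨d, hd⟩ := Finset.exists_le (Finset.univ.image φ)
    refine ⟨d, S.inf id, ?_, hSo⟩
    rw [map_finset_inf]
    refine Finset.le_inf fun a ha => sInf_le ⟨⟨a, rfl⟩, ?_⟩
    exact ((h a).anti (hd _ (Finset.mem_image_of_mem φ (Finset.mem_univ ⟨a, ha⟩)))).trans
      (hφ ⟨a, ha⟩)

lemma OpenLim.gfpIn (he : IsDenseCompact e)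
    (h : ∀ a, OpenLim e (F (e a)) (fun d => G d (e a))) :
    OpenLim e (gfpIn (Set.range e) F) (fun d => gfpIn (Set.range e) (G d)) :=
  (ClosedLim.lfpIn (C := Cᵒᵈ) (F := F) (G := G) he.dual fun a => (h a).dual).of_dual

end Lattice

section BiheytingAlgebra

variable [BiheytingAlgebra A] [IsDirectedOrder D] {e : BoundedLatticeHom A C} {x y : C}
  {f g : D → C} (he : IsDenseCompact e)
include he

lemma ClosedLim.imp (hf : OpenLim e x f) (hg : ClosedLim e y g) :
    ClosedLim e (relImp x y) (fun d => relImp (f d) (g d)) := by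
  refine ⟨fun d => relImp_mono (hf.le d) (hg.le d),
    fun d d' h => relImp_mono (hf.mono h) (hg.anti h), fun o ho h => ?_⟩
  obtain ⟨a, b, ha, hb, hab⟩ :=
    he.exists_map_himp_le (hf.isOpenElt he) (hg.isClosedElt he) ho h
  obtain ⟨d₁, haf⟩ := hf.exists_map_le ha
  obtain ⟨d₂, hgb⟩ := hg.exists_le_map hb
  obtain ⟨d, hd₁, hd₂⟩ := exists_ge_ge d₁ d₂
  refine ⟨d, a ⇨ b, ?_, hab⟩
  rw [he.map_himp]
  exact relImp_mono (haf.trans (hf.mono hd₁)) ((hg.anti hd₂).trans hgb)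

lemma ClosedLim.sub (hf : ClosedLim e x f) (hg : OpenLim e y g) :
    ClosedLim e (relSub x y) (fun d => relSub (f d) (g d)) := by
  refine ⟨fun d => relSub_mono (hf.le d) (hg.le d),
    fun d d' h => relSub_mono (hf.anti h) (hg.mono h), fun o ho h => ?_⟩
  obtain ⟨a, b, ha, hb, hab⟩ := he.exists_le_map_sup (hg.isOpenElt he) ho (hf.isClosedElt he)
    (he.meetPrimeDense.relSub_le_iff.1 h)
  obtain ⟨d₁, hfab⟩ := hf.exists_le_map hab
  obtain ⟨d₂, hag⟩ := hg.exists_map_le ha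
  obtain ⟨d, hd₁, hd₂⟩ := exists_ge_ge d₁ d₂
  refine ⟨d, b, sInf_le (((hf.anti hd₁).trans hfab).trans ?_), hb⟩
  rw [map_sup]
  exact sup_le_sup_right (hag.trans (hg.mono hd₂)) _

lemma OpenLim.imp (hf : ClosedLim e x f) (hg : OpenLim e y g) :
    OpenLim e (relImp x y) (fun d => relImp (f d) (g d)) := by
  simp only [relImp_eq_relSub_dual]
  exact (ClosedLim.sub he.dual hg.dual hf.dual).of_dual

lemma OpenLim.sub (hf : OpenLim e x f) (hg : ClosedLim e y g) :
    OpenLim e (relSub x y) (fun d => relSub (f d) (g d)) := by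
  simp only [relSub_eq_relImp_dual]
  exact (ClosedLim.imp he.dual hg.dual hf.dual).of_dual

end BiheytingAlgebra

end Limit

/-! ### Interpretation with restricted fixed points -/

section EvalIn

variable {C : Type v} [CompleteLattice C] {β : Type}

/-- The interpretation of terms in which least and greatest fixed points are computed from the
prefixed and postfixed points in `K` only. For `K = Set.univ` it is `eval`; for `K` the image of an
algebra in its canonical extension it is the admissible interpretation. -/
def evalIn (K : Set C) (box dia : C → C) (V : Assignment C) : {n : ℕ} → Term β n → (Fin n → C) → C
  | _, .bot, _ => ⊥
  | _, .top, _ => ⊤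
  | _, .var p, _ => V.var p
  | _, .fvar i, env => env i
  | _, .nom j, _ => V.nom j
  | _, .cnom m, _ => V.cnom m
  | _, .and s t, env => evalIn K box dia V s env ⊓ evalIn K box dia V t env
  | _, .or s t, env => evalIn K box dia V s env ⊔ evalIn K box dia V t env
  | _, .imp s t, env => relImp (evalIn K box dia V s env) (evalIn K box dia V t env)
  | _, .sub s t, env => relSub (evalIn K box dia V s env) (evalIn K box dia V t env)
  | _, .dia t, env => dia (evalIn K box dia V t env)
  | _, .box t, env => box (evalIn K box dia V t env)
  | _, .bdia t, env => leftAdj box (evalIn K box dia V t env)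
  | _, .bbox t, env => rightAdj dia (evalIn K box dia V t env)
  | _, .mu _ t, env => lfpIn K fun c => evalIn K box dia V t (extend c env)
  | _, .nu _ t, env => gfpIn K fun c => evalIn K box dia V t (extend c env)

variable {K : Set C} {box dia : C → C}

lemma evalIn_univ (V : Assignment C) {n : ℕ} (t : Term β n) (env : Fin n → C) :
    evalIn Set.univ box dia V t env = eval box dia V t env := by
  induction t <;> simp_all [evalIn, eval, relImp, relSub, leftAdj, rightAdj, lfpIn, gfpIn]

/-- The second assignment is above the first one on the variables with a positive occurrence in
`t` and below it on those with a negative one. -/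
structure AssignmentLE {n : ℕ} (t : Term β n) (V V' : Assignment C) (env env' : Fin n → C) :
    Prop where
  var_le : ∀ p, ¬ t.VarSign p false → V.var p ≤ V'.var p
  var_ge : ∀ p, ¬ t.VarSign p true → V'.var p ≤ V.var p
  env_le : ∀ i, ¬ t.FVarSign i false → env i ≤ env' i
  env_ge : ∀ i, ¬ t.FVarSign i true → env' i ≤ env i
  nom_eq : ∀ j, ¬ t.NomFree j → V.nom j = V'.nom j
  cnom_eq : ∀ m, ¬ t.CnomFree m → V.cnom m = V'.cnom m

lemma AssignmentLE.binder {n : ℕ} {t : Term β n} {s : Term β (n + 1)} {V V' : Assignment C}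
    {env env' : Fin n → C} (h : AssignmentLE t V V' env env') (c : C)
    (h1 : ∀ p b, t.VarSign p b → s.VarSign p b) (h2 : ∀ i b, t.FVarSign i b → s.FVarSign i.succ b)
    (h3 : ∀ j, t.NomFree j → s.NomFree j) (h4 : ∀ m, t.CnomFree m → s.CnomFree m) :
    AssignmentLE s V V' (extend c env) (extend c env') where
  var_le p hp := h.var_le p (mt (h1 _ _) hp)
  var_ge p hp := h.var_ge p (mt (h1 _ _) hp)
  env_le i := by
    refine Fin.cases (fun _ => le_rfl) (fun i hi => ?_) i
    exact h.env_le i (mt (h2 _ _) hi)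
  env_ge i := by
    refine Fin.cases (fun _ => le_rfl) (fun i hi => ?_) i
    exact h.env_ge i (mt (h2 _ _) hi)
  nom_eq j hj := h.nom_eq j (mt (h3 _) hj)
  cnom_eq j hj := h.cnom_eq j (mt (h4 _) hj)

lemma AssignmentLE.weaken {n : ℕ} {t s : Term β n} {V V' : Assignment C}
    {env env' : Fin n → C} (h : AssignmentLE t V V' env env')
    (h1 : ∀ p b, t.VarSign p b → s.VarSign p b) (h2 : ∀ i b, t.FVarSign i b → s.FVarSign i b)
    (h3 : ∀ j, t.NomFree j → s.NomFree j) (h4 : ∀ m, t.CnomFree m → s.CnomFree m) :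
    AssignmentLE s V V' env env' where
  var_le p hp := h.var_le p (mt (h1 _ _) hp)
  var_ge p hp := h.var_ge p (mt (h1 _ _) hp)
  env_le i hi := h.env_le i (mt (h2 _ _) hi)
  env_ge i hi := h.env_ge i (mt (h2 _ _) hi)
  nom_eq j hj := h.nom_eq j (mt (h3 _) hj)
  cnom_eq j hj := h.cnom_eq j (mt (h4 _) hj)

lemma AssignmentLE.flip {n : ℕ} {t s : Term β n} {V V' : Assignment C}
    {env env' : Fin n → C} (h : AssignmentLE t V V' env env')
    (h1 : ∀ p b, t.VarSign p b → s.VarSign p !b) (h2 : ∀ i b, t.FVarSign i b → s.FVarSign i !b)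
    (h3 : ∀ j, t.NomFree j → s.NomFree j) (h4 : ∀ m, t.CnomFree m → s.CnomFree m) :
    AssignmentLE s V' V env' env where
  var_le p hp := h.var_ge p (mt (h1 _ true) hp)
  var_ge p hp := h.var_le p (mt (h1 _ false) hp)
  env_le i hi := h.env_ge i (mt (h2 _ true) hi)
  env_ge i hi := h.env_le i (mt (h2 _ false) hi)
  nom_eq j hj := (h.nom_eq j (mt (h3 _) hj)).symm
  cnom_eq j hj := (h.cnom_eq j (mt (h4 _) hj)).symm

lemma evalIn_mono (hbox : Monotone box) (hdia : Monotone dia) {n : ℕ} {t : Term β n}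
    {V V' : Assignment C} {env env' : Fin n → C} (h : AssignmentLE t V V' env env') :
    evalIn K box dia V t env ≤ evalIn K box dia V' t env' := by
  induction t generalizing V V' with
  | bot => exact le_rfl
  | top => exact le_rfl
  | var p => exact h.var_le p (by simp [Term.VarSign])
  | fvar i => exact h.env_le i (by simp [Term.FVarSign])
  | nom j => exact (h.nom_eq j (by simp [Term.NomFree])).le
  | cnom m => exact (h.cnom_eq m (by simp [Term.CnomFree])).le
  | and s t ihs iht =>
    exact inf_le_inf
      (ihs (h.weaken (fun _ _ h => h.1) (fun _ _ h => h.1) (fun _ h => h.1) (fun _ h => h.1)))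
      (iht (h.weaken (fun _ _ h => h.2) (fun _ _ h => h.2) (fun _ h => h.2) (fun _ h => h.2)))
  | or s t ihs iht =>
    exact sup_le_sup
      (ihs (h.weaken (fun _ _ h => h.1) (fun _ _ h => h.1) (fun _ h => h.1) (fun _ h => h.1)))
      (iht (h.weaken (fun _ _ h => h.2) (fun _ _ h => h.2) (fun _ h => h.2) (fun _ h => h.2)))
  | imp s t ihs iht =>
    exact relImp_mono
      (ihs (h.flip (fun _ _ h => h.1) (fun _ _ h => h.1) (fun _ h => h.1) (fun _ h => h.1)))
      (iht (h.weaken (fun _ _ h => h.2) (fun _ _ h => h.2) (fun _ h => h.2) (fun _ h => h.2)))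
  | sub s t ihs iht =>
    exact relSub_mono
      (ihs (h.weaken (fun _ _ h => h.1) (fun _ _ h => h.1) (fun _ h => h.1) (fun _ h => h.1)))
      (iht (h.flip (fun _ _ h => h.2) (fun _ _ h => h.2) (fun _ h => h.2) (fun _ h => h.2)))
  | dia t ih =>
    exact hdia (ih (h.weaken (fun _ _ h => h) (fun _ _ h => h) (fun _ h => h) (fun _ h => h)))
  | box t ih =>
    exact hbox (ih (h.weaken (fun _ _ h => h) (fun _ _ h => h) (fun _ h => h) (fun _ h => h)))
  | bdia t ih =>
    exact leftAdj_mono box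
      (ih (h.weaken (fun _ _ h => h) (fun _ _ h => h) (fun _ h => h) (fun _ h => h)))
  | bbox t ih =>
    exact rightAdj_mono dia
      (ih (h.weaken (fun _ _ h => h) (fun _ _ h => h) (fun _ h => h) (fun _ h => h)))
  | mu b t ih =>
    exact lfpIn_mono fun c _ =>
      ih (h.binder c (fun _ _ h => h) (fun _ _ h => h) (fun _ h => h) (fun _ h => h))
  | nu b t ih =>
    exact gfpIn_mono fun c _ =>
      ih (h.binder c (fun _ _ h => h) (fun _ _ h => h) (fun _ h => h) (fun _ h => h))

lemma Term.VarFree.varSign {p : ℕ} {n : ℕ} {t : Term β n} (h : t.VarFree p) (s : Bool) :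
    t.VarSign p s := by
  induction t generalizing s <;> simp_all [-Bool.forall_bool, Term.VarFree, Term.VarSign]

lemma evalIn_congr (hbox : Monotone box) (hdia : Monotone dia) {n : ℕ} {t : Term β n}
    {V V' : Assignment C} {env env' : Fin n → C} (hvar : ∀ p, ¬ t.VarFree p → V.var p = V'.var p)
    (henv : ∀ i, ¬ (t.FVarSign i true ∧ t.FVarSign i false) → env i = env' i)
    (hnom : ∀ j, ¬ t.NomFree j → V.nom j = V'.nom j)
    (hcnom : ∀ m, ¬ t.CnomFree m → V.cnom m = V'.cnom m) :
    evalIn K box dia V t env = evalIn K box dia V' t env' :=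
  le_antisymm
    (evalIn_mono hbox hdia
      ⟨fun p hp => (hvar p fun h => hp (h.varSign _)).le, fun p hp => (hvar p fun h => hp
        (h.varSign _)).ge, fun i hi => (henv i fun h => hi h.2).le,
        fun i hi => (henv i fun h => hi h.1).ge, hnom, hcnom⟩)
    (evalIn_mono hbox hdia
      ⟨fun p hp => (hvar p fun h => hp (h.varSign _)).ge, fun p hp => (hvar p fun h => hp
        (h.varSign _)).le, fun i hi => (henv i fun h => hi h.2).ge,
        fun i hi => (henv i fun h => hi h.1).le, fun j hj => (hnom j hj).symm,
        fun m hm => (hcnom m hm).symm⟩)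

/-! ### Substitution -/

lemma extend_comp_lift {X : Type*} {n m : ℕ} (r : Fin n → Fin m) (c : X) (env : Fin m → X) :
    (fun i => extend c env (extend (0 : Fin (m + 1)) (fun i => (r i).succ) i)) =
      extend c (fun i => env (r i)) := by
  funext i
  exact Fin.cases rfl (fun _ => rfl) i

lemma evalIn_rename (V : Assignment C) {n m : ℕ} (r : Fin n → Fin m) (t : Term β n)
    (env : Fin m → C) :
    evalIn K box dia V (t.rename r) env = evalIn K box dia V t (fun i => env (r i)) := by
  induction t generalizing m with
  | mu b t ih => simp only [Term.rename, evalIn, ih, extend_comp_lift]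
  | nu b t ih => simp only [Term.rename, evalIn, ih, extend_comp_lift]
  | _ => simp_all [Term.rename, evalIn]

lemma evalIn_lift (V : Assignment C) {n m : ℕ} (σ : Fin n → Term β m) (c : C)
    (env : Fin m → C) :
    (fun i => evalIn K box dia V (Term.lift σ i) (extend c env)) =
      extend c (fun i => evalIn K box dia V (σ i) env) := by
  funext i
  refine Fin.cases rfl (fun i => ?_) i
  exact evalIn_rename V Fin.succ (σ i) (extend c env)

lemma evalIn_subst (V : Assignment C) {n m : ℕ} (σ : Fin n → Term β m) (t : Term β n)
    (env : Fin m → C) :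
    evalIn K box dia V (t.subst σ) env =
      evalIn K box dia V t (fun i => evalIn K box dia V (σ i) env) := by
  induction t generalizing m with
  | mu b t ih => simp only [Term.subst, evalIn, ih, evalIn_lift]
  | nu b t ih => simp only [Term.subst, evalIn, ih, evalIn_lift]
  | _ => simp_all [Term.subst, evalIn]

/-- The assignment `V` with the value of the propositional variable `p` changed to `x`. -/
def Assignment.setVar (V : Assignment C) (p : ℕ) (x : C) : Assignment C :=
  { V with var := Function.update V.var p x }

lemma evalIn_substVar (V : Assignment C) {n : ℕ} (p : ℕ) (α : Term β 0) (t : Term β n)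
    (env : Fin n → C) :
    evalIn K box dia V (Term.substVar p α t) env =
      evalIn K box dia (V.setVar p (evalIn K box dia V α Fin.elim0)) t env := by
  induction t with
  | var q =>
    by_cases h : q = p
    · subst h
      simp only [Term.substVar, if_true, evalIn_rename, evalIn, Assignment.setVar,
        Function.update_self]
      congr 1
      funext i
      exact i.elim0
    · simp [Term.substVar, h, evalIn, Assignment.setVar]
  | _ => simp_all [Term.substVar, evalIn, Assignment.setVar]

lemma evalIn_star (V : Assignment C) {n : ℕ} (t : Term Unit n) (env : Fin n → C) :
    evalIn K box dia V t.star env = evalIn K box dia V t env := by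
  induction t <;> simp_all [Term.star, evalIn]

lemma evalIn_handle (V : Assignment C) {n : ℕ} (s : Bool) (t : Term Bool n) (env : Fin n → C) :
    evalIn K box dia V (t.handle s) env = evalIn K box dia V t env := by
  induction t generalizing s <;> simp_all [-Bool.forall_bool, Term.handle, evalIn]
end EvalIn

/-! ### Signs of handled binders -/

/-- In the signed generation tree of `t` with root sign `s` every handled binder is `+μ*` or `-ν*`.
A binder is handled if its label is `true`. -/
def WellHandled : {n : ℕ} → Bool → Term Bool n → Prop
  | _, s, .and a b => WellHandled s a ∧ WellHandled s b
  | _, s, .or a b => WellHandled s a ∧ WellHandled s b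
  | _, s, .imp a b => WellHandled (!s) a ∧ WellHandled s b
  | _, s, .sub a b => WellHandled s a ∧ WellHandled (!s) b
  | _, s, .dia t => WellHandled s t
  | _, s, .box t => WellHandled s t
  | _, s, .bdia t => WellHandled s t
  | _, s, .bbox t => WellHandled s t
  | _, s, .mu b t => (b = true → s = true) ∧ WellHandled s t
  | _, s, .nu b t => (b = true → s = false) ∧ WellHandled s t
  | _, _, _ => True

lemma wellHandled_star {n : ℕ} (s : Bool) (t : Term Unit n) : WellHandled s t.star := by
  induction t generalizing s <;> grind [Term.star, WellHandled]

lemma wellHandled_rename {n m : ℕ} (r : Fin n → Fin m) (s : Bool) (t : Term Bool n) :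
    WellHandled s (t.rename r) ↔ WellHandled s t := by
  induction t generalizing m s <;> grind [Term.rename, WellHandled]

namespace WellHandled

lemma handle {n : ℕ} {s : Bool} {t : Term Bool n} (h : WellHandled s t) :
    WellHandled s (t.handle s) := by
  induction t generalizing s <;> grind [Term.handle, WellHandled]

lemma lift {n m : ℕ} {σ : Fin n → Term Bool m} (hσ : ∀ i s, WellHandled s (σ i)) (i s) :
    WellHandled s (Term.lift σ i) :=
  Fin.cases trivial (fun i => (wellHandled_rename _ _ _).2 (hσ i s)) i

lemma subst {n m : ℕ} {σ : Fin n → Term Bool m} (hσ : ∀ i s, WellHandled s (σ i)) {s : Bool}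
    {t : Term Bool n} (h : WellHandled s t) : WellHandled s (t.subst σ) := by
  induction t generalizing m s <;> grind [Term.subst, WellHandled, WellHandled.lift]

lemma of_subst {n m : ℕ} {σ : Fin n → Term Bool m} {s : Bool} {t : Term Bool n}
    (h : WellHandled s (t.subst σ)) : WellHandled s t := by
  induction t generalizing m s <;> grind [Term.subst, WellHandled]

/-- The hypothesis `hk` says that `k` has an occurrence of sign `!b` in `t`. -/
lemma of_subst_occ {n m : ℕ} {σ : Fin n → Term Bool m} {s b : Bool} {t : Term Bool n} {k : Fin n}
    (hk : ¬ t.FVarSign k b) (h : WellHandled s (t.subst σ)) : WellHandled (s ^^ b) (σ k) := by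
  have lift_succ {n m : ℕ} (σ : Fin n → Term Bool m) (k : Fin n) :
      Term.lift σ k.succ = (σ k).rename Fin.succ := rfl
  induction t generalizing m s b with
  | fvar i =>
    simp only [Term.FVarSign, Classical.not_imp, Bool.not_eq_true] at hk
    obtain ⟨rfl, rfl⟩ := hk
    simpa [Term.subst] using h
  | imp x y ihx ihy =>
    rcases not_and_or.1 hk with hk | hk
    · simpa using ihx hk h.1
    · exact ihy hk h.2
  | sub x y ihx ihy =>
    rcases not_and_or.1 hk with hk | hk
    · exact ihx hk h.1
    · simpa using ihy hk h.2
  | _ => grind [Term.subst, WellHandled, Term.FVarSign, wellHandled_rename]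

lemma substVar {n : ℕ} {p : ℕ} {α : Term Bool 0} {s b : Bool} {t : Term Bool n}
    (h : WellHandled s t) (ht : t.VarSign p b) (hα : WellHandled (s == b) α) :
    WellHandled s (Term.substVar p α t) := by
  induction t generalizing s b with
  | var q =>
    by_cases hq : q = p
    · obtain rfl : b = true := ht hq
      simpa [Term.substVar, hq, wellHandled_rename] using hα
    · simp [Term.substVar, hq, WellHandled]
  | imp x y ihx ihy => exact ⟨ihx h.1 ht.1 (by cases s <;> cases b <;> exact hα), ihy h.2 ht.2 hα⟩
  | sub x y ihx ihy => exact ⟨ihx h.1 ht.1 hα, ihy h.2 ht.2 (by cases s <;> cases b <;> exact hα)⟩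
  | _ => grind [Term.substVar, WellHandled, Term.VarSign]

end WellHandled

lemma nomFree_rename {β : Type} {n m : ℕ} (r : Fin n → Fin m) (j : ℕ) (t : Term β n) :
    (t.rename r).NomFree j ↔ t.NomFree j := by
  induction t generalizing m <;> simp_all [Term.rename, Term.NomFree]

lemma cnomFree_rename {β : Type} {n m : ℕ} (r : Fin n → Fin m) (j : ℕ) (t : Term β n) :
    (t.rename r).CnomFree j ↔ t.CnomFree j := by
  induction t generalizing m <;> simp_all [Term.rename, Term.CnomFree]

namespace Term

variable {β : Type} {n m : ℕ} {σ : Fin n → Term β m} {j : ℕ} {b : Bool} {t : Term β n} {k : Fin n}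

lemma NomFree.of_subst (h : (t.subst σ).NomFree j) : t.NomFree j := by
  induction t generalizing m <;> grind [Term.subst, Term.NomFree]

lemma CnomFree.of_subst (h : (t.subst σ).CnomFree j) : t.CnomFree j := by
  induction t generalizing m <;> grind [Term.subst, Term.CnomFree]

lemma NomFree.of_subst_occ (hk : ¬ t.FVarSign k b) (h : (t.subst σ).NomFree j) :
    (σ k).NomFree j := by
  have lift_succ {n m : ℕ} (σ : Fin n → Term β m) (k : Fin n) :
      Term.lift σ k.succ = (σ k).rename Fin.succ := rfl
  induction t generalizing m b <;>
    grind [Term.subst, Term.NomFree, Term.FVarSign, nomFree_rename]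

lemma CnomFree.of_subst_occ (hk : ¬ t.FVarSign k b) (h : (t.subst σ).CnomFree j) :
    (σ k).CnomFree j := by
  have lift_succ {n m : ℕ} (σ : Fin n → Term β m) (k : Fin n) :
      Term.lift σ k.succ = (σ k).rename Fin.succ := rfl
  induction t generalizing m b <;>
    grind [Term.subst, Term.CnomFree, Term.FVarSign, cnomFree_rename]

end Term

/-- Read at the right sign, a handled binder ranges over fewer pre- or postfixed points in the
restricted interpretation, which makes the value of a positive term larger. -/
lemma eval_le_evalIn {C : Type v} [CompleteLattice C] {K : Set C} {box dia : C → C}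
    (hbox : Monotone box) (hdia : Monotone dia) (V : Assignment C) {n : ℕ} {t : Term Bool n}
    (hh : t.AllHandled) (env : Fin n → C) :
    (WellHandled true t → evalIn Set.univ box dia V t env ≤ evalIn K box dia V t env) ∧
      (WellHandled false t → evalIn K box dia V t env ≤ evalIn Set.univ box dia V t env) := by
  induction t with
  | and x y ihx ihy =>
    exact ⟨fun h => inf_le_inf ((ihx hh.1 env).1 h.1) ((ihy hh.2 env).1 h.2),
      fun h => inf_le_inf ((ihx hh.1 env).2 h.1) ((ihy hh.2 env).2 h.2)⟩
  | or x y ihx ihy =>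
    exact ⟨fun h => sup_le_sup ((ihx hh.1 env).1 h.1) ((ihy hh.2 env).1 h.2),
      fun h => sup_le_sup ((ihx hh.1 env).2 h.1) ((ihy hh.2 env).2 h.2)⟩
  | imp x y ihx ihy =>
    exact ⟨fun h => relImp_mono ((ihx hh.1 env).2 h.1) ((ihy hh.2 env).1 h.2),
      fun h => relImp_mono ((ihx hh.1 env).1 h.1) ((ihy hh.2 env).2 h.2)⟩
  | sub x y ihx ihy =>
    exact ⟨fun h => relSub_mono ((ihx hh.1 env).1 h.1) ((ihy hh.2 env).2 h.2),
      fun h => relSub_mono ((ihx hh.1 env).2 h.1) ((ihy hh.2 env).1 h.2)⟩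
  | dia t ih => exact ⟨fun h => hdia ((ih hh env).1 h), fun h => hdia ((ih hh env).2 h)⟩
  | box t ih => exact ⟨fun h => hbox ((ih hh env).1 h), fun h => hbox ((ih hh env).2 h)⟩
  | bdia t ih =>
    exact ⟨fun h => leftAdj_mono box ((ih hh env).1 h), fun h => leftAdj_mono box ((ih hh env).2 h)⟩
  | bbox t ih =>
    exact ⟨fun h => rightAdj_mono dia ((ih hh env).1 h),
      fun h => rightAdj_mono dia ((ih hh env).2 h)⟩
  | mu b t ih =>
    refine ⟨fun h => ?_, fun h => absurd (h.1 hh.1) (by simp)⟩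
    exact (lfpIn_anti (Set.subset_univ K) _).trans (lfpIn_mono fun c _ => (ih hh.2 _).1 h.2)
  | nu b t ih =>
    refine ⟨fun h => absurd (h.1 hh.1) (by simp), fun h => ?_⟩
    exact (gfpIn_mono fun c _ => (ih hh.2 _).2 h.2).trans (gfpIn_mono_left (Set.subset_univ K) _)
  | _ => exact ⟨fun _ => le_rfl, fun _ => le_rfl⟩

/-! ### Perfect algebras -/

namespace IsPerfect

variable {C : Type v} [CompleteLattice C] {box dia : C → C} (h : IsPerfect box dia)
include h

lemma dual : IsPerfect (C := Cᵒᵈ) dia box where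
  distrib _ _ f := by
    let _ := CompletelyDistribLattice.ofMinimalAxioms (α := C) ⟨fun f => h.distrib _ _ f⟩
    exact iSup_iInf_eq (α := C)
  join_dense := h.meet_dense
  meet_dense := h.join_dense
  box_sInf := h.dia_sSup
  dia_sSup := h.box_sInf

lemma joinPrimeDense : JoinPrimeDense C := by
  let _ := CompletelyDistribLattice.ofMinimalAxioms (α := C) ⟨fun f => h.distrib _ _ f⟩
  intro c d hcd
  rw [h.join_dense c]
  refine sSup_le fun j hj => hcd j (fun X hX => ?_) hj.2
  obtain ⟨x, hx, hjx⟩ := hj.1 ((j ⊓ ·) '' X) (by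
    rw [sSup_image, ← inf_sSup_eq, inf_eq_left.2 hX])
  exact ⟨x, hx, inf_eq_left.1 hjx⟩

lemma meetPrimeDense : MeetPrimeDense C := fun c d hcd => h.dual.joinPrimeDense d c hcd

lemma box_gc : GaloisConnection (leftAdj box) box := gc_leftAdj h.box_sInf

lemma dia_gc : GaloisConnection dia (rightAdj dia) := gc_rightAdj h.dia_sSup

lemma exists_le_dia {j x : C} (hj : IsCompletelyJoinIrreducible j) (hx : j ≤ dia x) :
    ∃ i, IsCompletelyJoinIrreducible i ∧ i ≤ x ∧ j ≤ dia i := by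
  rw [h.join_dense x, h.dia_sSup] at hx
  obtain ⟨_, ⟨i, hi, rfl⟩, hji⟩ := h.joinPrimeDense.isJoinPrime hj _ hx
  exact ⟨i, hi.1, hi.2, hji⟩

lemma exists_box_le {m x : C} (hm : IsCompletelyMeetIrreducible m) (hx : box x ≤ m) :
    ∃ n, IsCompletelyMeetIrreducible n ∧ x ≤ n ∧ box n ≤ m :=
  h.dual.exists_le_dia hm hx

lemma exists_relImp_le {m x y : C} (hm : IsCompletelyMeetIrreducible m) (hxy : relImp x y ≤ m) :
    ∃ j n, IsCompletelyJoinIrreducible j ∧ IsCompletelyMeetIrreducible n ∧ j ≤ x ∧ y ≤ n ∧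
      relImp j n ≤ m := by
  have sInf_le_relImp : sInf {z | ∃ j n, IsCompletelyJoinIrreducible j ∧
      IsCompletelyMeetIrreducible n ∧ j ≤ x ∧ y ≤ n ∧ z = relImp j n} ≤ relImp x y := by
    refine h.joinPrimeDense.le_relImp_iff.2 (h.joinPrimeDense _ _ fun j hj hle =>
      h.meetPrimeDense _ _ fun n hn hyn => ?_)
    have hjn : j ≤ relImp j n := hle.trans (inf_le_left.trans
      (sInf_le ⟨j, n, hj.irreducible, hn.irreducible, hle.trans inf_le_right, hyn, rfl⟩))
    simpa only [inf_idem] using h.joinPrimeDense.le_relImp_iff.1 hjn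
  obtain ⟨_, ⟨j, n, hj, hn, hjx, hyn, rfl⟩, hle⟩ :=
    h.meetPrimeDense.isMeetPrime hm _ (sInf_le_relImp.trans hxy)
  exact ⟨j, n, hj, hn, hjx, hyn, hle⟩

lemma exists_le_relSub {i x y : C} (hi : IsCompletelyJoinIrreducible i) (hxy : i ≤ relSub x y) :
    ∃ j n, IsCompletelyJoinIrreducible j ∧ IsCompletelyMeetIrreducible n ∧ j ≤ x ∧ y ≤ n ∧
      i ≤ relSub j n := by
  simp only [relSub_eq_relImp_dual] at hxy ⊢
  obtain ⟨n, j, hn, hj, hyn, hjx, hle⟩ := h.dual.exists_relImp_le hi hxy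
  exact ⟨j, n, hj, hn, hjx, hyn, hle⟩

end IsPerfect

lemma IsDenseCompact.isPerfect {A C : Type*} [DistribLattice A] [BoundedOrder A]
    [CompleteLattice C] {e : BoundedLatticeHom A C} (he : IsDenseCompact e) {bx : InfTopHom A A}
    {di : SupBotHom A A} {box dia : C → C} (hbox : IsBoxExt e bx box)
    (hdia : IsDiaExt e di dia) : IsPerfect box dia where
  distrib _ _ := he.joinPrimeDense.iInf_iSup_eq
  join_dense := he.joinPrimeDense.eq_sSup_irreducible
  meet_dense := he.meetPrimeDense.eq_sInf_irreducible
  box_sInf := hbox.map_sInf he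
  dia_sSup := hdia.dual.map_sInf he.dual

/-! ### Approximation of fixed points of completely join-preserving maps -/

section Approximation

variable {C : Type v} [CompleteLattice C]

/-- The relation `x ≤^b y` on `C`, where `true` stands for `1` and `false` for `∂`. -/
def SignLE (b : Bool) (x y : C) : Prop := if b then x ≤ y else y ≤ x

/-- The completely join-irreducible elements of `C^b`, where `true` stands for `1` and `false` for
`∂`. -/
def IsIrreducible (b : Bool) (x : C) : Prop :=
  if b then IsCompletelyJoinIrreducible x else IsCompletelyMeetIrreducible x

/-- The tuple with `j` at place `k` and the least element of `C^(τ l)` at the places `l ≠ k`. -/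
def singleTuple {n : ℕ} (τ : Fin n → Bool) (k : Fin n) (j : C) : Fin n → C :=
  fun l => if l = k then j else if τ l then ⊥ else ⊤

lemma signLE_dual {b : Bool} {x y : C} : SignLE (C := Cᵒᵈ) b x y ↔ SignLE (!b) x y := by
  cases b <;> exact Iff.rfl

lemma isIrreducible_dual {b : Bool} {x : C} :
    IsIrreducible (C := Cᵒᵈ) b x ↔ IsIrreducible (!b) x := by
  cases b <;> exact Iff.rfl

variable {n : ℕ} {τ : Fin n → Bool} {k : Fin n} {j : C}

lemma singleTuple_dual :
    singleTuple (C := Cᵒᵈ) τ k j = singleTuple (C := C) (fun l => !τ l) k j := by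
  funext l
  change (if l = k then j else if τ l then _ else _) = if l = k then j else if !τ l then _ else _
  cases τ l <;> rfl

lemma singleTuple_self : singleTuple τ k j k = j := if_pos rfl

lemma signLE_singleTuple {x : Fin n → C} (hj : SignLE (τ k) j (x k)) (l : Fin n) :
    SignLE (τ l) (singleTuple τ k j l) (x l) := by
  rcases eq_or_ne l k with rfl | hl
  · rwa [singleTuple_self]
  · cases hτ : τ l <;> simp [SignLE, singleTuple, hl, hτ]

lemma joinOrd_pair {a b : C} (hab : a ≤ b) (x : Fin n → C) :
    joinOrd τ {extend a x, extend b x} = extend b x := by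
  funext i
  refine Fin.cases ?_ (fun k => ?_) i
  · simpa only [joinOrd, extend, Fin.cases_zero, Set.image_pair, sSup_pair] using
      sup_eq_right.2 hab
  · simp [joinOrd, extend, Set.image_pair]

lemma joinOrd_singleTuple (hC : JoinPrimeDense C) (hC' : MeetPrimeDense C) {occ : Fin n → Prop}
    (f : Fin n → C → C) (x : Fin n → C) (hk : occ k) :
    joinOrd τ {s | ∃ l j, occ l ∧ IsIrreducible (τ l) j ∧ SignLE (τ l) j (x l) ∧
      s = extend (f l j) (singleTuple τ l j)} k.succ = x k := by
  set S : Set (Fin (n + 1) → C) := {s | ∃ l j, occ l ∧ IsIrreducible (τ l) j ∧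
    SignLE (τ l) j (x l) ∧ s = extend (f l j) (singleTuple τ l j)}
  have mem_image {j : C} (hj : IsIrreducible (τ k) j) (hjx : SignLE (τ k) j (x k)) :
      j ∈ (fun s => s k.succ) '' S :=
    ⟨_, ⟨k, j, hk, hj, hjx, rfl⟩, singleTuple_self⟩
  have signLE_of_mem {s} (hs : s ∈ S) : SignLE (τ k) (s k.succ) (x k) := by
    obtain ⟨l, j, -, -, hj, rfl⟩ := hs
    exact signLE_singleTuple hj k
  change (if τ k then sSup ((fun s => s k.succ) '' S) else sInf ((fun s => s k.succ) '' S)) = x k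
  cases hτ : τ k <;> simp only [hτ, SignLE, IsIrreducible, if_true, Bool.false_eq_true, if_false]
    at mem_image signLE_of_mem ⊢
  · refine le_antisymm ?_ (le_sInf (Set.forall_mem_image.2 fun s => signLE_of_mem))
    conv_rhs => rw [hC'.eq_sInf_irreducible (x k)]
    exact le_sInf fun j hj => sInf_le (mem_image hj.1 hj.2)
  · refine le_antisymm (sSup_le (Set.forall_mem_image.2 fun s => signLE_of_mem)) ?_
    conv_lhs => rw [hC.eq_sSup_irreducible (x k)]
    exact sSup_le fun j hj => le_sSup (mem_image hj.1 hj.2)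

variable {G : (Fin (n + 1) → C) → C} (hG : ∀ S, G (joinOrd τ S) = sSup (G '' S))
include hG

lemma map_extend_mono (x : Fin n → C) : Monotone fun c => G (extend c x) := by
  intro a b hab
  have h := hG {extend a x, extend b x}
  rw [joinOrd_pair hab, Set.image_pair, sSup_pair] at h
  exact sup_eq_right.1 h.symm

lemma map_lfp_le (x : Fin n → C) :
    G (extend (lfpIn Set.univ fun c => G (extend c x)) x) ≤
      lfpIn Set.univ fun c => G (extend c x) :=
  le_sInf fun _ hc => (map_extend_mono hG x (sInf_le hc)).trans hc.2

/-- The join of the least fixed points at the tuples `singleTuple τ k j`, with `j` an irreducible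
below `x k`, is a prefixed point at `x`. -/
theorem exists_singleTuple_of_le_lfp (hC : JoinPrimeDense C) (hC' : MeetPrimeDense C)
    {occ : Fin n → Prop}
    (hocc : ∀ c x x', (∀ k, occ k → x k = x' k) → G (extend c x) = G (extend c x'))
    {i : C} (hi : IsJoinPrime i) {x : Fin n → C}
    (hix : i ≤ lfpIn Set.univ fun c => G (extend c x)) :
    ∃ k j, occ k ∧ IsIrreducible (τ k) j ∧ SignLE (τ k) j (x k) ∧
      i ≤ lfpIn Set.univ fun c => G (extend c (singleTuple τ k j)) := by
  let F (x : Fin n → C) : C := lfpIn Set.univ fun c => G (extend c x)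
  let S : Set (Fin (n + 1) → C) := {s | ∃ k j, occ k ∧ IsIrreducible (τ k) j ∧
    SignLE (τ k) j (x k) ∧ s = extend (F (singleTuple τ k j)) (singleTuple τ k j)}
  have prefixed : G (extend (sSup ((fun s => s 0) '' S)) x) ≤ sSup ((fun s => s 0) '' S) := calc
    _ = G (joinOrd τ S) := hocc _ x _ fun k hk =>
      (joinOrd_singleTuple hC hC' (fun k j => F (singleTuple τ k j)) x hk).symm
    _ = sSup (G '' S) := hG S
    _ ≤ _ := sSup_le (Set.forall_mem_image.2 fun s hs =>
      le_trans (by obtain ⟨k, j, -, -, -, rfl⟩ := hs; exact map_lfp_le hG _)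
        (le_sSup (Set.mem_image_of_mem (fun s => s 0) hs)))
  obtain ⟨_, ⟨_, ⟨k, j, hk, hj, hjx, rfl⟩, rfl⟩, hij⟩ :=
    hi _ (hix.trans (sInf_le ⟨Set.mem_univ _, prefixed⟩))
  exact ⟨k, j, hk, hj, hjx, hij⟩

end Approximation

/-! ### Approximation rules for fixed point terms -/

section FixedPointTerms

variable {C : Type v} [CompleteLattice C] {box dia : C → C} (h : IsPerfect box dia)
  {n : ℕ} {τ : Fin n → Bool}
include h

lemma evalIn_le_of_signLE {K : Set C} {β : Type} {t : Term β n} (ht : ∀ k, t.FVarSign k (τ k))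
    {V : Assignment C} {x y : Fin n → C} (hxy : ∀ k, SignLE (τ k) (x k) (y k)) :
    evalIn K box dia V t x ≤ evalIn K box dia V t y := by
  have le_of_not_sign {k b} (hk : ¬ t.FVarSign k b) : SignLE (!b) (x k) (y k) := by
    have hτ : τ k = !b := Bool.eq_not.2 fun hτ => hk (hτ ▸ ht k)
    exact hτ ▸ hxy k
  exact evalIn_mono h.box_gc.monotone_u h.dia_gc.monotone_l
    ⟨fun _ _ => le_rfl, fun _ _ => le_rfl, fun _ hk => le_of_not_sign hk,
      fun _ hk => le_of_not_sign hk, fun _ _ => rfl, fun _ _ => rfl⟩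

lemma evalIn_extend_congr {K : Set C} {β : Type} {t : Term β (n + 1)}
    (ht : ∀ k : Fin n, t.FVarSign k.succ (τ k)) (V : Assignment C) (c : C) {x y : Fin n → C}
    (hxy : ∀ k : Fin n, ¬ t.FVarSign k.succ (!τ k) → x k = y k) :
    evalIn K box dia V t (extend c x) = evalIn K box dia V t (extend c y) := by
  refine evalIn_congr h.box_gc.monotone_u h.dia_gc.monotone_l (fun _ _ => rfl) ?_ (fun _ _ => rfl)
    (fun _ _ => rfl)
  refine Fin.cases (fun _ => rfl) fun k hk => hxy k fun hk' => hk ?_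
  have hk'' := ht k
  cases hτ : τ k <;> simp_all

lemma exists_le_mu_singleTuple {ψ : Term Bool (n + 1)} (hsign : ∀ k, ψ.FVarSign k.succ (τ k))
    (hψ : JoinPreserving.{v} ψ τ) {V : Assignment C} (hV : V.Respects) {i : C}
    (hi : IsCompletelyJoinIrreducible i) {b : Bool} {x : Fin n → C}
    (hix : i ≤ evalIn Set.univ box dia V (.mu b ψ) x) :
    ∃ k j, ¬ (Term.mu b ψ).FVarSign k (!τ k) ∧ IsIrreducible (τ k) j ∧ SignLE (τ k) j (x k) ∧
      i ≤ evalIn Set.univ box dia V (.mu b ψ) (singleTuple τ k j) := by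
  refine exists_singleTuple_of_le_lfp (G := evalIn Set.univ box dia V ψ) (fun S => ?_)
    h.joinPrimeDense h.meetPrimeDense (fun c x y => evalIn_extend_congr h hsign V c)
    (h.joinPrimeDense.isJoinPrime hi) hix
  rw [funext (evalIn_univ V ψ)]
  exact hψ C box dia h V hV S

lemma exists_nu_singleTuple_le {φ : Term Bool (n + 1)} (hsign : ∀ k, φ.FVarSign k.succ (τ k))
    (hφ : MeetPreserving.{v} φ τ) {V : Assignment C} (hV : V.Respects) {m : C}
    (hm : IsCompletelyMeetIrreducible m) {b : Bool} {x : Fin n → C}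
    (hxm : evalIn Set.univ box dia V (.nu b φ) x ≤ m) :
    ∃ k j, ¬ (Term.nu b φ).FVarSign k (!τ k) ∧ IsIrreducible (!τ k) j ∧
      SignLE (!τ k) j (x k) ∧
      evalIn Set.univ box dia V (.nu b φ) (singleTuple (fun l => !τ l) k j) ≤ m := by
  have map_meetOrd (S) : evalIn Set.univ box dia V φ (meetOrd τ S) =
      sInf (evalIn Set.univ box dia V φ '' S) := by
    rw [funext (evalIn_univ V φ)]
    exact hφ C box dia h V hV S
  obtain ⟨k, j, hk, hj, hjx, hle⟩ := exists_singleTuple_of_le_lfp (C := Cᵒᵈ) (τ := τ)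
    (G := evalIn Set.univ box dia V φ) map_meetOrd
    h.dual.joinPrimeDense h.dual.meetPrimeDense (fun c x y => evalIn_extend_congr h hsign V c)
    (h.dual.joinPrimeDense.isJoinPrime hm) hxm
  exact ⟨k, j, hk, isIrreducible_dual.1 hj, signLE_dual.1 hjx, singleTuple_dual (C := C) ▸ hle⟩

end FixedPointTerms

/-! ### Points -/

section Points

variable {C : Type v} {β : Type} {F : Bool → ℕ → Prop}

/-- The value of the nominal (if `b = true`) or co-nominal (if `b = false`) with index `c`. -/
def Assignment.pt (V : Assignment C) (b : Bool) (c : ℕ) : C := if b then V.nom c else V.cnom c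

/-- The assignment `V` with the value of one nominal (if `b = true`) or co-nominal (if `b = false`)
changed to `x`. -/
def Assignment.setPt (V : Assignment C) (b : Bool) (c : ℕ) (x : C) : Assignment C :=
  if b then { V with nom := Function.update V.nom c x }
  else { V with cnom := Function.update V.cnom c x }

/-- The nominal (if `b = true`) or co-nominal (if `b = false`) with index `c` does not occur. -/
def Term.PtFree {n : ℕ} (b : Bool) (c : ℕ) (t : Term β n) : Prop :=
  if b then t.NomFree c else t.CnomFree c

/-- The nominal (if `b = true`) or co-nominal (if `b = false`) with index `c` occurs in neither
side. -/
def Ineq.PtFree (b : Bool) (c : ℕ) (I : Ineq β) : Prop := I.lhs.PtFree b c ∧ I.rhs.PtFree b c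

/-- The assignments differ at most at the nominals and co-nominals in `F`. -/
structure AgreeOff (F : Bool → ℕ → Prop) (V V' : Assignment C) : Prop where
  var_eq : V'.var = V.var
  pt_eq : ∀ b c, ¬ F b c → V'.pt b c = V.pt b c

lemma Assignment.pt_setPt_self (V : Assignment C) (b : Bool) (c : ℕ) (x : C) :
    (V.setPt b c x).pt b c = x := by
  cases b <;> exact Function.update_self ..

lemma Assignment.pt_setPt_of_ne (V : Assignment C) {b b' : Bool} {c c' : ℕ} (x : C)
    (h : b' = b → c' ≠ c) : (V.setPt b c x).pt b' c' = V.pt b' c' := by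
  cases b <;> cases b' <;> first | rfl | exact Function.update_of_ne (h rfl) ..

lemma AgreeOff.refl (F : Bool → ℕ → Prop) (V : Assignment C) : AgreeOff F V V :=
  ⟨rfl, fun _ _ _ => rfl⟩

lemma AgreeOff.setPt {V V' : Assignment C} (h : AgreeOff F V V') {b : Bool} {c : ℕ} (hc : F b c)
    (x : C) : AgreeOff F V (V'.setPt b c x) where
  var_eq := by cases b <;> exact h.var_eq
  pt_eq b' c' hc' := by
    rw [V'.pt_setPt_of_ne x (by rintro rfl rfl; exact hc' hc), h.pt_eq b' c' hc']

lemma Term.PtFree.of_subst {n m : ℕ} {σ : Fin n → Term β m} {t : Term β n} {b : Bool} {c : ℕ}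
    (h : (t.subst σ).PtFree b c) : t.PtFree b c := by
  cases b
  exacts [CnomFree.of_subst h, NomFree.of_subst h]

lemma Term.PtFree.of_subst_occ {n m : ℕ} {σ : Fin n → Term β m} {t : Term β n} {b b' : Bool}
    {c : ℕ} {k : Fin n} (hk : ¬ t.FVarSign k b') (h : (t.subst σ).PtFree b c) :
    (σ k).PtFree b c := by
  cases b
  exacts [CnomFree.of_subst_occ hk h, NomFree.of_subst_occ hk h]

variable [CompleteLattice C]

lemma Assignment.Respects.isIrreducible_pt {V : Assignment C} (hV : V.Respects) (b : Bool)
    (c : ℕ) : IsIrreducible b (V.pt b c) := by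
  cases b
  exacts [hV.2 c, hV.1 c]

lemma Assignment.Respects.setPt {V : Assignment C} (hV : V.Respects) {b : Bool} (c : ℕ) {x : C}
    (hx : IsIrreducible b x) : (V.setPt b c x).Respects := by
  have isIrreducible (b' c') : IsIrreducible b' ((V.setPt b c x).pt b' c') := by
    by_cases h : b' = b ∧ c' = c
    · obtain ⟨rfl, rfl⟩ := h
      rwa [V.pt_setPt_self]
    · rw [V.pt_setPt_of_ne x (not_and.1 h)]
      exact hV.isIrreducible_pt b' c'
  exact ⟨isIrreducible true, isIrreducible false⟩

variable {K : Set C} {box dia : C → C} (h : IsPerfect box dia)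
include h

lemma AgreeOff.evalIn_eq {V V' : Assignment C} (hVV' : AgreeOff F V V') {n : ℕ} {t : Term β n}
    (ht : ∀ b c, F b c → t.PtFree b c) (env : Fin n → C) :
    evalIn K box dia V' t env = evalIn K box dia V t env :=
  evalIn_congr h.box_gc.monotone_u h.dia_gc.monotone_l (fun _ _ => by rw [hVV'.var_eq])
    (fun _ _ => rfl) (fun j hj => hVV'.pt_eq true j (mt (ht true j) hj))
    (fun m hm => hVV'.pt_eq false m (mt (ht false m) hm))

lemma evalIn_setPt {V : Assignment C} {b : Bool} {c : ℕ} {n : ℕ} {t : Term β n}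
    (ht : t.PtFree b c) (x : C) (env : Fin n → C) :
    evalIn K box dia (V.setPt b c x) t env = evalIn K box dia V t env :=
  AgreeOff.evalIn_eq h (F := fun b' c' => b' = b ∧ c' = c) ((AgreeOff.refl _ V).setPt ⟨rfl, rfl⟩ x)
    (by rintro _ _ ⟨rfl, rfl⟩; exact ht) env

end Points

/-! ### Validity of inequalities and quasi-inequalities -/

section Holds

variable {C : Type v} [CompleteLattice C] {β : Type}

/-- The inequality `I` holds under the assignment `V` when fixed points are computed in `K`. -/
def Holds (K : Set C) (box dia : C → C) (V : Assignment C) (I : Ineq β) : Prop :=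
  evalIn K box dia V I.lhs Fin.elim0 ≤ evalIn K box dia V I.rhs Fin.elim0

/-- Validity of a quasi-inequality when propositional variables take values in `K` and fixed points
are computed in `K`. -/
def ValidIn (K : Set C) (box dia : C → C) (Q : QIneq) : Prop :=
  ∀ V : Assignment C, V.Respects → (∀ p, V.var p ∈ K) → (∀ I ∈ Q.ants, Holds K box dia V I) →
    V.nom Q.i ≤ V.cnom Q.m

/-- The marked binders of an inequality in an antecedent are those which the fixed point
approximation rules may mark there. -/
def Ineq.WellHandled (I : Ineq Bool) : Prop :=
  MuCanon.WellHandled false I.lhs ∧ MuCanon.WellHandled true I.rhs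

variable {K : Set C} {box dia : C → C}

lemma holds_pt {V : Assignment C} {b : Bool} {c : ℕ} {φ : Term β 0} :
    Holds K box dia V (if b then ⟨.nom c, φ⟩ else ⟨φ, .cnom c⟩) ↔
      SignLE b (V.pt b c) (evalIn K box dia V φ Fin.elim0) := by
  cases b <;> exact Iff.rfl

lemma wellHandled_pt {b : Bool} {c : ℕ} {φ : Term Bool 0} (hφ : WellHandled b φ) :
    Ineq.WellHandled (if b then ⟨.nom c, φ⟩ else ⟨φ, .cnom c⟩) := by
  cases b
  exacts [⟨hφ, trivial⟩, ⟨trivial, hφ⟩]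

lemma AgreeOff.holds_iff (h : IsPerfect box dia) {F : Bool → ℕ → Prop} {V V' : Assignment C}
    (hVV' : AgreeOff F V V') {I : Ineq β} (hI : ∀ b c, F b c → I.PtFree b c) :
    Holds K box dia V' I ↔ Holds K box dia V I := by
  simp only [Holds, hVV'.evalIn_eq h fun b c hc => (hI b c hc).1,
    hVV'.evalIn_eq h fun b c hc => (hI b c hc).2]

variable {n : ℕ} {τ : Fin n → Bool} {k : Fin n} {c : ℕ}

lemma cnomTuple_eq_nomTuple : cnomTuple τ k c = nomTuple (fun l => !τ l) k c := by
  funext l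
  cases hτ : τ l <;> by_cases hl : l = k <;> simp_all [cnomTuple, nomTuple]

lemma evalIn_nomTuple (V : Assignment C) :
    (fun l => evalIn K box dia V (nomTuple τ k c l) Fin.elim0) =
      singleTuple τ k (V.pt (τ k) c) := by
  funext l
  cases hτ : τ l <;> by_cases hl : l = k <;>
    simp_all [nomTuple, singleTuple, Assignment.pt, evalIn]

lemma wellHandled_nomTuple (l : Fin n) (s : Bool) : WellHandled s (nomTuple τ k c l) := by
  unfold nomTuple
  split_ifs <;> exact trivial

end Holds

/-! ### The rules for a single inequality -/

section Rules

variable {C : Type v} [CompleteLattice C] {box dia : C → C} (h : IsPerfect box dia)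
include h

lemma holds_mu_subst {K : Set C} {V : Assignment C} {n : ℕ} {τ : Fin n → Bool} {b : Bool}
    {ψ : Term Bool (n + 1)} (hsign : ∀ k, ψ.FVarSign k.succ (τ k)) {φ : Fin n → Term Bool 0}
    {i c : ℕ} {k : Fin n}
    (hi : Holds K box dia V ⟨.nom i, ((Term.mu b ψ).handle true).subst (nomTuple τ k c)⟩)
    (hk : Holds K box dia V (if τ k then ⟨.nom c, φ k⟩ else ⟨φ k, .cnom c⟩)) :
    Holds K box dia V ⟨.nom i, (Term.mu b ψ).subst φ⟩ := by
  simp only [Holds, evalIn_subst, evalIn_handle, evalIn_nomTuple] at hi ⊢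
  exact hi.trans (evalIn_le_of_signLE h (t := .mu b ψ) hsign
    (signLE_singleTuple (holds_pt.1 hk)))

lemma holds_nu_subst {K : Set C} {V : Assignment C} {n : ℕ} {τ : Fin n → Bool} {b : Bool}
    {φ : Term Bool (n + 1)} (hsign : ∀ k, φ.FVarSign k.succ (τ k)) {ψ : Fin n → Term Bool 0}
    {m c : ℕ} {k : Fin n}
    (hm : Holds K box dia V ⟨((Term.nu b φ).handle false).subst (cnomTuple τ k c), .cnom m⟩)
    (hk : Holds K box dia V (if τ k then ⟨ψ k, .cnom c⟩ else ⟨.nom c, ψ k⟩)) :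
    Holds K box dia V ⟨(Term.nu b φ).subst ψ, .cnom m⟩ := by
  simp only [Holds, evalIn_subst, evalIn_handle, cnomTuple_eq_nomTuple, evalIn_nomTuple] at hm ⊢
  have signLE : SignLE (!τ k) (V.pt (!τ k) c) (evalIn K box dia V (ψ k) Fin.elim0) :=
    holds_pt.1 (by cases hτ : τ k <;> simpa [hτ] using hk)
  refine le_trans (evalIn_le_of_signLE h (t := .nu b φ) hsign fun l => ?_) hm
  have := signLE_singleTuple (τ := fun l => !τ l)
    (x := fun l => evalIn K box dia V (ψ l) Fin.elim0) signLE l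
  cases hτ : τ l <;> simp_all [SignLE]

theorem Rule.holds {K : Set C} {FN FC : ℕ → Prop} {I : Ineq Bool} {D : List (List (Ineq Bool))}
    (hr : Rule.{v} FN FC I D) {V : Assignment C} {Is : List (Ineq Bool)} (hIs : Is ∈ D)
    (H : ∀ J ∈ Is, Holds K box dia V J) : Holds K box dia V I := by
  cases hr
  case muAppr hsign _ _ =>
    obtain ⟨k, rfl⟩ := List.mem_ofFn.1 hIs
    rw [List.forall_mem_cons, List.forall_mem_singleton] at H
    exact holds_mu_subst h hsign H.1 H.2
  case nuAppr hsign _ _ =>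
    obtain ⟨k, rfl⟩ := List.mem_ofFn.1 hIs
    rw [List.forall_mem_cons, List.forall_mem_singleton] at H
    exact holds_nu_subst h hsign H.1 H.2
  all_goals
    obtain rfl := List.mem_singleton.1 hIs
    simp only [List.mem_cons, List.not_mem_nil, or_false, forall_eq_or_imp, forall_eq] at H
  case subLR => exact h.meetPrimeDense.relSub_le_iff.2 H
  case impRR => exact h.joinPrimeDense.le_relImp_iff.2 H
  case andLR => exact h.joinPrimeDense.le_relImp_iff.1 H
  case andLR_comm => exact (inf_comm _ _).trans_le (h.joinPrimeDense.le_relImp_iff.1 H)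
  case orRR => exact h.meetPrimeDense.relSub_le_iff.1 H
  case orRR_comm => exact (h.meetPrimeDense.relSub_le_iff.1 H).trans_eq (sup_comm _ _)
  case orLA => exact sup_le H.1 H.2
  case andRA => exact le_inf H.1 H.2
  case diaLA => exact h.dia_gc.le_iff_le.2 H
  case boxRA => exact h.box_gc.le_iff_le.1 H
  case boxAppr => exact (h.box_gc.monotone_u H.2).trans H.1
  case diaAppr => exact le_trans H.1 (h.dia_gc.monotone_l H.2)
  case impAppr => exact (relImp_mono H.2.1 H.2.2).trans H.1
  case subAppr => exact le_trans H.1 (relSub_mono H.2.1 H.2.2)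

end Rules

/-! ### Completeness of the rules for a single inequality -/

section Alternatives

variable {C : Type v} [CompleteLattice C] {box dia : C → C}

/-- The nominals (if `b = true`) in `FN` and the co-nominals (if `b = false`) in `FC`. -/
def Fresh (FN FC : ℕ → Prop) (b : Bool) (c : ℕ) : Prop := if b then FN c else FC c

/-- Some alternative in `D` consists of well-handled inequalities which hold under an assignment
that agrees with `V` off the nominals and co-nominals in `F`. -/
def HoldsSome (F : Bool → ℕ → Prop) (box dia : C → C) (V : Assignment C)
    (D : List (List (Ineq Bool))) : Prop :=
  ∃ Is ∈ D, (∀ J ∈ Is, J.WellHandled) ∧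
    ∃ V' : Assignment C, V'.Respects ∧ AgreeOff F V V' ∧ ∀ J ∈ Is, Holds Set.univ box dia V' J

variable {F : Bool → ℕ → Prop} {V : Assignment C}

lemma holdsSome_of_holds (hV : V.Respects) {Is : List (Ineq Bool)} (hIs : ∀ J ∈ Is, J.WellHandled)
    (H : ∀ J ∈ Is, Holds Set.univ box dia V J) : HoldsSome F box dia V [Is] :=
  ⟨Is, List.mem_singleton_self _, hIs, V, hV, .refl F V, H⟩

lemma holdsSome_of_holds_setPt (hV : V.Respects) {b : Bool} {c : ℕ} (hc : F b c) {x : C}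
    (hx : IsIrreducible b x) {Is : List (Ineq Bool)} {D : List (List (Ineq Bool))} (hIs : Is ∈ D)
    (hwell : ∀ J ∈ Is, J.WellHandled)
    (H : ∀ J ∈ Is, Holds Set.univ box dia (V.setPt b c x) J) : HoldsSome F box dia V D :=
  ⟨Is, hIs, hwell, _, hV.setPt c hx, (AgreeOff.refl F V).setPt hc x, H⟩

variable (h : IsPerfect box dia) (hV : V.Respects)
include h hV

lemma holdsSome_boxAppr {ψ : Term Bool 0} {m n : ℕ} (hn : F false n)
    (hfresh : Ineq.PtFree false n ⟨.box ψ, .cnom m⟩) (hψ : WellHandled false ψ)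
    (H : Holds Set.univ box dia V ⟨.box ψ, .cnom m⟩) :
    HoldsSome F box dia V [[⟨.box (.cnom n), .cnom m⟩, ⟨ψ, .cnom n⟩]] := by
  obtain ⟨x, hx, hψx, hxm⟩ := h.exists_box_le (hV.2 m) H
  refine holdsSome_of_holds_setPt hV hn (b := false) hx (List.mem_singleton_self _) ?_ ?_
  · simp [Ineq.WellHandled, WellHandled, hψ]
  · have eval_n : (V.setPt false n x).cnom n = x := V.pt_setPt_self false n x
    have eval_m : (V.setPt false n x).cnom m = V.cnom m :=
      evalIn_setPt h (K := Set.univ) hfresh.2 x Fin.elim0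
    have eval_ψ := evalIn_setPt h (K := Set.univ) (V := V) (t := ψ) hfresh.1 x Fin.elim0
    simp [Holds, evalIn, eval_n, eval_m, eval_ψ, hxm, hψx]

lemma holdsSome_diaAppr {ψ : Term Bool 0} {j i : ℕ} (hi : F true i)
    (hfresh : Ineq.PtFree true i ⟨.nom j, .dia ψ⟩) (hψ : WellHandled true ψ)
    (H : Holds Set.univ box dia V ⟨.nom j, .dia ψ⟩) :
    HoldsSome F box dia V [[⟨.nom j, .dia (.nom i)⟩, ⟨.nom i, ψ⟩]] := by
  obtain ⟨x, hx, hxψ, hjx⟩ := h.exists_le_dia (hV.1 j) H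
  refine holdsSome_of_holds_setPt hV hi (b := true) hx (List.mem_singleton_self _) ?_ ?_
  · simp [Ineq.WellHandled, WellHandled, hψ]
  · have eval_i : (V.setPt true i x).nom i = x := V.pt_setPt_self true i x
    have eval_j : (V.setPt true i x).nom j = V.nom j :=
      evalIn_setPt h (K := Set.univ) hfresh.1 x Fin.elim0
    have eval_ψ := evalIn_setPt h (K := Set.univ) (V := V) (t := ψ) hfresh.2 x Fin.elim0
    simp [Holds, evalIn, eval_i, eval_j, eval_ψ, hxψ, hjx]

lemma exists_setPt_setPt {χ φ : Term Bool 0} {j n : ℕ} (hj : F true j) (hn : F false n)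
    (hfresh : ∀ b c, F b c → χ.PtFree b c ∧ φ.PtFree b c) {x y : C}
    (hx : IsCompletelyJoinIrreducible x) (hy : IsCompletelyMeetIrreducible y)
    (hxχ : x ≤ evalIn Set.univ box dia V χ Fin.elim0)
    (hφy : evalIn Set.univ box dia V φ Fin.elim0 ≤ y) :
    ∃ V' : Assignment C, V'.Respects ∧ AgreeOff F V V' ∧ V'.nom j = x ∧ V'.cnom n = y ∧
      Holds Set.univ box dia V' ⟨.nom j, χ⟩ ∧ Holds Set.univ box dia V' ⟨φ, .cnom n⟩ := by
  have agreeOff : AgreeOff F V ((V.setPt true j x).setPt false n y) :=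
    ((AgreeOff.refl F V).setPt hj x).setPt hn y
  refine ⟨_, (hV.setPt (b := true) j hx).setPt (b := false) n hy, agreeOff, Function.update_self ..,
    Function.update_self .., ?_, ?_⟩
  · exact (Function.update_self (β := fun _ => C) ..).trans_le
      (hxχ.trans_eq (agreeOff.evalIn_eq h (fun b c hc => (hfresh b c hc).1) _).symm)
  · exact ((agreeOff.evalIn_eq h (fun b c hc => (hfresh b c hc).2) _).trans_le hφy).trans_eq
      (Function.update_self (β := fun _ => C) ..).symm

lemma holdsSome_impAppr {χ φ : Term Bool 0} {m j n : ℕ} (hj : F true j) (hn : F false n)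
    (hfresh : ∀ b c, F b c → Ineq.PtFree b c ⟨.imp χ φ, .cnom m⟩)
    (hχ : WellHandled true χ) (hφ : WellHandled false φ)
    (H : Holds Set.univ box dia V ⟨.imp χ φ, .cnom m⟩) :
    HoldsSome F box dia V
      [[⟨.imp (.nom j) (.cnom n), .cnom m⟩, ⟨.nom j, χ⟩, ⟨φ, .cnom n⟩]] := by
  obtain ⟨x, y, hx, hy, hxχ, hφy, hle⟩ := h.exists_relImp_le (hV.2 m) H
  obtain ⟨V', hV', agreeOff, rfl, rfl, holds_χ, holds_φ⟩ := exists_setPt_setPt h hV hj hn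
    (fun b c hc => by have := hfresh b c hc; cases b <;> exact this.1) hx hy hxχ hφy
  refine ⟨_, List.mem_singleton_self _, ?_, V', hV', agreeOff, ?_⟩
  · simp [Ineq.WellHandled, WellHandled, hχ, hφ]
  · have eval_m : V'.cnom m = V.cnom m :=
      agreeOff.evalIn_eq h (K := Set.univ) (fun b c hc => (hfresh b c hc).2) Fin.elim0
    simp only [List.mem_cons, List.not_mem_nil, or_false, forall_eq_or_imp, forall_eq]
    exact ⟨by rwa [Holds, evalIn, evalIn, eval_m], holds_χ, holds_φ⟩

lemma holdsSome_subAppr {χ φ : Term Bool 0} {i j n : ℕ} (hj : F true j) (hn : F false n)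
    (hfresh : ∀ b c, F b c → Ineq.PtFree b c ⟨.nom i, .sub χ φ⟩)
    (hχ : WellHandled true χ) (hφ : WellHandled false φ)
    (H : Holds Set.univ box dia V ⟨.nom i, .sub χ φ⟩) :
    HoldsSome F box dia V
      [[⟨.nom i, .sub (.nom j) (.cnom n)⟩, ⟨.nom j, χ⟩, ⟨φ, .cnom n⟩]] := by
  obtain ⟨x, y, hx, hy, hxχ, hφy, hle⟩ := h.exists_le_relSub (hV.1 i) H
  obtain ⟨V', hV', agreeOff, rfl, rfl, holds_χ, holds_φ⟩ := exists_setPt_setPt h hV hj hn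
    (fun b c hc => by have := hfresh b c hc; cases b <;> exact this.2) hx hy hxχ hφy
  refine ⟨_, List.mem_singleton_self _, ?_, V', hV', agreeOff, ?_⟩
  · simp [Ineq.WellHandled, WellHandled, hχ, hφ]
  · have eval_i : V'.nom i = V.nom i :=
      agreeOff.evalIn_eq h (K := Set.univ) (fun b c hc => (hfresh b c hc).1) Fin.elim0
    simp only [List.mem_cons, List.not_mem_nil, or_false, forall_eq_or_imp, forall_eq]
    exact ⟨by rwa [Holds, evalIn, evalIn, eval_i], holds_χ, holds_φ⟩

lemma holdsSome_muAppr {n : ℕ} {τ : Fin n → Bool} {b : Bool} {ψ : Term Bool (n + 1)}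
    (hsign : ∀ k, ψ.FVarSign k.succ (τ k)) (hψ : JoinPreserving.{v} ψ τ)
    {φ : Fin n → Term Bool 0} {i : ℕ} {c : Fin n → ℕ} (hc : ∀ k, F (τ k) (c k))
    (hfresh : ∀ b' c, F b' c → Ineq.PtFree b' c ⟨.nom i, (Term.mu b ψ).subst φ⟩)
    (hwell : WellHandled true ((Term.mu b ψ).subst φ))
    (H : Holds Set.univ box dia V ⟨.nom i, (Term.mu b ψ).subst φ⟩) :
    HoldsSome F box dia V (List.ofFn fun k =>
      [⟨.nom i, ((Term.mu b ψ).handle true).subst (nomTuple τ k (c k))⟩,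
        if τ k then ⟨.nom (c k), φ k⟩ else ⟨φ k, .cnom (c k)⟩]) := by
  have H' := H
  simp only [Holds, evalIn_subst] at H'
  obtain ⟨k, x, hk, hx, hxφ, hix⟩ := exists_le_mu_singleTuple h hsign hψ hV (hV.1 i) H'
  have fresh := hfresh _ _ (hc k)
  refine holdsSome_of_holds_setPt hV (hc k) hx (List.mem_ofFn.2 ⟨k, rfl⟩) ?_ ?_ <;>
    rw [List.forall_mem_cons, List.forall_mem_singleton]
  · exact ⟨⟨trivial, hwell.of_subst.handle.subst wellHandled_nomTuple⟩,
      wellHandled_pt (by simpa using hwell.of_subst_occ hk)⟩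
  · constructor
    · rwa [Holds, evalIn_subst, evalIn_handle, evalIn_nomTuple, V.pt_setPt_self,
        evalIn_setPt h fresh.1, evalIn_setPt h fresh.2.of_subst]
    · rwa [holds_pt, V.pt_setPt_self, evalIn_setPt h (fresh.2.of_subst_occ hk)]

lemma holdsSome_nuAppr {n : ℕ} {τ : Fin n → Bool} {b : Bool} {φ : Term Bool (n + 1)}
    (hsign : ∀ k, φ.FVarSign k.succ (τ k)) (hφ : MeetPreserving.{v} φ τ)
    {ψ : Fin n → Term Bool 0} {m : ℕ} {c : Fin n → ℕ} (hc : ∀ k, F (!τ k) (c k))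
    (hfresh : ∀ b' c, F b' c → Ineq.PtFree b' c ⟨(Term.nu b φ).subst ψ, .cnom m⟩)
    (hwell : WellHandled false ((Term.nu b φ).subst ψ))
    (H : Holds Set.univ box dia V ⟨(Term.nu b φ).subst ψ, .cnom m⟩) :
    HoldsSome F box dia V (List.ofFn fun k =>
      [⟨((Term.nu b φ).handle false).subst (cnomTuple τ k (c k)), .cnom m⟩,
        if τ k then ⟨ψ k, .cnom (c k)⟩ else ⟨.nom (c k), ψ k⟩]) := by
  have H' := H
  simp only [Holds, evalIn_subst] at H'
  obtain ⟨k, x, hk, hx, hxψ, hle⟩ := exists_nu_singleTuple_le h hsign hφ hV (hV.2 m) H'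
  have fresh := hfresh _ _ (hc k)
  have ite_not : (if τ k then ⟨ψ k, .cnom (c k)⟩ else ⟨.nom (c k), ψ k⟩ : Ineq Bool) =
      if !τ k then ⟨.nom (c k), ψ k⟩ else ⟨ψ k, .cnom (c k)⟩ := by
    cases τ k <;> rfl
  refine holdsSome_of_holds_setPt hV (hc k) hx (List.mem_ofFn.2 ⟨k, rfl⟩) ?_ ?_ <;>
    rw [List.forall_mem_cons, List.forall_mem_singleton, ite_not, cnomTuple_eq_nomTuple]
  · exact ⟨⟨hwell.of_subst.handle.subst wellHandled_nomTuple, trivial⟩,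
      wellHandled_pt (by simpa using hwell.of_subst_occ hk)⟩
  · constructor
    · rwa [Holds, evalIn_subst, evalIn_handle, evalIn_nomTuple, V.pt_setPt_self,
        evalIn_setPt h fresh.2, evalIn_setPt h fresh.1.of_subst]
    · rwa [holds_pt, V.pt_setPt_self, evalIn_setPt h (fresh.1.of_subst_occ hk)]

theorem Rule.holdsSome {FN FC : ℕ → Prop} {I : Ineq Bool} {D : List (List (Ineq Bool))}
    (hr : Rule.{v} FN FC I D) (hfresh : ∀ b c, Fresh FN FC b c → I.PtFree b c)
    (hI : I.WellHandled) (H : Holds Set.univ box dia V I) :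
    HoldsSome (Fresh FN FC) box dia V D := by
  cases hr
  case boxAppr hn => exact holdsSome_boxAppr h hV hn (hfresh false _ hn) hI.1 H
  case diaAppr hi => exact holdsSome_diaAppr h hV hi (hfresh true _ hi) hI.2 H
  case impAppr hj hn => exact holdsSome_impAppr h hV hj hn hfresh hI.1.1 hI.1.2 H
  case subAppr hj hn => exact holdsSome_subAppr h hV hj hn hfresh hI.2.1 hI.2.2 H
  case muAppr hsign hψ hc => exact holdsSome_muAppr h hV hsign hψ hc hfresh hI.2 H
  case nuAppr n τ b φ ψ m c _ hsign hφ hc =>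
    refine holdsSome_nuAppr h hV hsign hφ (fun k => ?_) hfresh hI.1 H
    have hck := hc k
    cases hτ : τ k <;> simpa [hτ, Fresh] using hck
  all_goals
    refine holdsSome_of_holds hV ?_ ?_ <;>
    simp only [List.mem_cons, List.not_mem_nil, or_false, forall_eq_or_imp, forall_eq]
  case subLR.refine_1 => exact ⟨hI.1.1, hI.1.2, hI.2⟩
  case subLR.refine_2 => exact h.meetPrimeDense.relSub_le_iff.1 H
  case impRR.refine_1 => exact ⟨⟨hI.1, hI.2.1⟩, hI.2.2⟩
  case impRR.refine_2 => exact h.joinPrimeDense.le_relImp_iff.1 H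
  case andLR.refine_1 => exact ⟨hI.1.1, hI.1.2, hI.2⟩
  case andLR.refine_2 => exact h.joinPrimeDense.le_relImp_iff.2 H
  case andLR_comm.refine_1 => exact ⟨hI.1.2, hI.1.1, hI.2⟩
  case andLR_comm.refine_2 =>
    exact h.joinPrimeDense.le_relImp_iff.2 ((inf_comm _ _).trans_le H)
  case orRR.refine_1 => exact ⟨⟨hI.1, hI.2.1⟩, hI.2.2⟩
  case orRR.refine_2 => exact h.meetPrimeDense.relSub_le_iff.2 H
  case orRR_comm.refine_1 => exact ⟨⟨hI.1, hI.2.2⟩, hI.2.1⟩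
  case orRR_comm.refine_2 =>
    exact h.meetPrimeDense.relSub_le_iff.2 (H.trans_eq (sup_comm _ _))
  case orLA.refine_1 => exact ⟨⟨hI.1.1, hI.2⟩, hI.1.2, hI.2⟩
  case orLA.refine_2 => exact ⟨le_trans le_sup_left H, le_trans le_sup_right H⟩
  case andRA.refine_1 => exact ⟨⟨hI.1, hI.2.1⟩, hI.1, hI.2.2⟩
  case andRA.refine_2 => exact ⟨le_trans H inf_le_left, le_trans H inf_le_right⟩
  case diaLA.refine_1 => exact ⟨hI.1, hI.2⟩
  case diaLA.refine_2 => exact h.dia_gc.le_iff_le.1 H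
  case boxRA.refine_1 => exact ⟨hI.1, hI.2⟩
  case boxRA.refine_2 => exact h.box_gc.le_iff_le.2 H

end Alternatives

/-! ### Finite joins and meets of terms -/

section BigOr

lemma bigOr_induction {P : Term Bool 0 → Prop} (hbot : P .bot)
    (hor : ∀ α β, P α → P β → P (.or α β)) {l : List (Term Bool 0)} (hl : ∀ α ∈ l, P α) :
    P (bigOr l) := by
  induction l using bigOr.induct with
  | case1 => exact hbot
  | case2 α => exact hl α List.mem_cons_self
  | case3 α β l ih =>
    rw [List.forall_mem_cons] at hl
    exact hor _ _ hl.1 (ih hl.2)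

lemma bigAnd_induction {P : Term Bool 0 → Prop} (htop : P .top)
    (hand : ∀ α β, P α → P β → P (.and α β)) {l : List (Term Bool 0)} (hl : ∀ α ∈ l, P α) :
    P (bigAnd l) := by
  induction l using bigAnd.induct with
  | case1 => exact htop
  | case2 α => exact hl α List.mem_cons_self
  | case3 α β l ih =>
    rw [List.forall_mem_cons] at hl
    exact hand _ _ hl.1 (ih hl.2)

variable {C : Type v} [CompleteLattice C] {K : Set C} {box dia : C → C} {V : Assignment C}
  {l : List (Term Bool 0)} {x : C}

lemma evalIn_bigOr_le_iff : evalIn K box dia V (bigOr l) Fin.elim0 ≤ x ↔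
    ∀ α ∈ l, evalIn K box dia V α Fin.elim0 ≤ x := by
  induction l using bigOr.induct with
  | case1 => simp [bigOr, evalIn]
  | case2 α => simp [bigOr]
  | case3 α β l ih => rw [bigOr, evalIn, sup_le_iff, ih, List.forall_mem_cons (l := β :: l)]

lemma le_evalIn_bigAnd_iff : x ≤ evalIn K box dia V (bigAnd l) Fin.elim0 ↔
    ∀ α ∈ l, x ≤ evalIn K box dia V α Fin.elim0 := by
  induction l using bigAnd.induct with
  | case1 => simp [bigAnd, evalIn]
  | case2 α => simp [bigAnd]
  | case3 α β l ih => rw [bigAnd, evalIn, le_inf_iff, ih, List.forall_mem_cons (l := β :: l)]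

end BigOr

/-! ### Changing the value of a variable -/

section SetVar

variable {C : Type v}

lemma Assignment.setVar_self (V : Assignment C) (p : ℕ) : V.setVar p (V.var p) = V := by
  simp [Assignment.setVar]

lemma Assignment.var_setVar_of_ne (V : Assignment C) {p q : ℕ} (h : q ≠ p) (x : C) :
    (V.setVar p x).var q = V.var q :=
  Function.update_of_ne h ..

lemma Assignment.var_setVar_self (V : Assignment C) (p : ℕ) (x : C) : (V.setVar p x).var p = x :=
  Function.update_self ..

lemma Assignment.var_setVar_mem {K : Set C} {V : Assignment C} (hV : ∀ q, V.var q ∈ K) (p : ℕ)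
    {x : C} (hx : x ∈ K) (q : ℕ) : (V.setVar p x).var q ∈ K := by
  rcases eq_or_ne q p with rfl | h
  exacts [(V.var_setVar_self q x).symm ▸ hx, (V.var_setVar_of_ne h x).symm ▸ hV q]

variable [CompleteLattice C] {K : Set C} {box dia : C → C} {β : Type}

lemma Assignment.Respects.setVar {V : Assignment C} (hV : V.Respects) (p : ℕ) (x : C) :
    (V.setVar p x).Respects := hV

variable (h : IsPerfect box dia)
include h

lemma evalIn_setVar_le {V : Assignment C} {p : ℕ} {b : Bool} {x y : C} {n : ℕ} {t : Term β n}
    (ht : t.VarSign p b) (hxy : SignLE b x y) (env : Fin n → C) :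
    evalIn K box dia (V.setVar p x) t env ≤ evalIn K box dia (V.setVar p y) t env := by
  have var_le {q : ℕ} (b' : Bool) (hq : ¬ t.VarSign q b') :
      SignLE (!b') ((V.setVar p x).var q) ((V.setVar p y).var q) := by
    rcases eq_or_ne q p with rfl | hqp
    · obtain rfl : b = !b' := by cases b <;> cases b' <;> first | rfl | exact absurd ht hq
      simpa only [V.var_setVar_self] using hxy
    · simp only [V.var_setVar_of_ne hqp]
      cases b' <;> exact le_rfl
  exact evalIn_mono h.box_gc.monotone_u h.dia_gc.monotone_l
    ⟨fun _ => var_le false, fun _ => var_le true, fun _ _ => le_rfl, fun _ _ => le_rfl,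
      fun _ _ => rfl, fun _ _ => rfl⟩

lemma evalIn_setVar_of_varFree {V : Assignment C} {p : ℕ} {n : ℕ} {t : Term β n}
    (ht : t.VarFree p) (x : C) (env : Fin n → C) :
    evalIn K box dia (V.setVar p x) t env = evalIn K box dia V t env :=
  evalIn_congr h.box_gc.monotone_u h.dia_gc.monotone_l
    (fun q hq => V.var_setVar_of_ne (fun hqp : q = p => hq (hqp ▸ ht)) x) (fun _ _ => rfl)
    (fun _ _ => rfl) (fun _ _ => rfl)

lemma Holds.substVar {V : Assignment C} {p : ℕ} {b : Bool} {α : Term Bool 0} {I : Ineq Bool}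
    (H : Holds K box dia V I) (hα : SignLE b (evalIn K box dia V α Fin.elim0) (V.var p))
    (hl : I.lhs.VarSign p b) (hr : I.rhs.VarSign p !b) :
    Holds K box dia V (I.substVar p α) := by
  have hα' : SignLE (!b) (V.var p) (evalIn K box dia V α Fin.elim0) := by
    cases b <;> exact hα
  rw [← V.setVar_self p] at H
  rw [Holds, Ineq.substVar, evalIn_substVar, evalIn_substVar]
  exact (evalIn_setVar_le h hl hα _).trans (H.trans (evalIn_setVar_le h hr hα' _))

end SetVar

lemma Ineq.WellHandled.substVar {p : ℕ} {b : Bool} {α : Term Bool 0} {I : Ineq Bool}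
    (hI : I.WellHandled) (hα : MuCanon.WellHandled (!b) α) (hl : I.lhs.VarSign p b)
    (hr : I.rhs.VarSign p !b) : (I.substVar p α).WellHandled :=
  ⟨hI.1.substVar hl (by cases b <;> exact hα), hI.2.substVar hr (by cases b <;> exact hα)⟩

/-! ### The rules for quasi-inequalities -/

section QRules

/-- The marked binders of a quasi-inequality are those which the fixed point approximation rules
may mark there. -/
def QIneq.WellHandled (Q : QIneq) : Prop := ∀ I ∈ Q.ants, I.WellHandled

variable {C : Type v} [CompleteLattice C] {K : Set C} {box dia : C → C} (h : IsPerfect box dia)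
include h

lemma validIn_univ_of_rule {l₁ l₂ : List (Ineq Bool)} {I : Ineq Bool} {i m : ℕ}
    {D : List (List (Ineq Bool))}
    (hr : Rule.{v} (QIneq.FreshNom ⟨l₁ ++ I :: l₂, i, m⟩) (QIneq.FreshCnom ⟨l₁ ++ I :: l₂, i, m⟩)
      I D)
    (hQ : QIneq.WellHandled ⟨l₁ ++ I :: l₂, i, m⟩)
    (H : ∀ Is ∈ D, QIneq.WellHandled ⟨l₁ ++ Is ++ l₂, i, m⟩ →
      ValidIn Set.univ box dia ⟨l₁ ++ Is ++ l₂, i, m⟩) :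
    ValidIn Set.univ box dia ⟨l₁ ++ I :: l₂, i, m⟩ := by
  intro V hV _ hants
  have ptFree {b c} (hc : Fresh (QIneq.FreshNom ⟨l₁ ++ I :: l₂, i, m⟩)
      (QIneq.FreshCnom ⟨l₁ ++ I :: l₂, i, m⟩) b c) : ∀ J ∈ l₁ ++ I :: l₂, J.PtFree b c := by
    cases b <;> exact hc.2
  have hI : I ∈ l₁ ++ I :: l₂ := by simp
  obtain ⟨Is, hIs, hwell, V', hV', hVV', holds_Is⟩ :=
    Rule.holdsSome h hV hr (fun _ _ hc => ptFree hc I hI) (hQ I hI) (hants I hI)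
  have holds_ants : ∀ J ∈ l₁ ++ I :: l₂, Holds Set.univ box dia V' J := fun J hJ =>
    (hVV'.holds_iff h fun _ _ hc => ptFree hc J hJ).2 (hants J hJ)
  have nom_eq : V'.nom i = V.nom i := hVV'.pt_eq true i fun hi => hi.1 rfl
  have cnom_eq : V'.cnom m = V.cnom m := hVV'.pt_eq false m fun hm => hm.1 rfl
  simp only [QIneq.WellHandled, List.forall_mem_append, List.forall_mem_cons] at hQ holds_ants H
  rw [← nom_eq, ← cnom_eq]
  refine H Is hIs ⟨⟨hQ.1, hwell⟩, hQ.2.2⟩ V' hV' (fun _ => Set.mem_univ _) ?_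
  simp only [List.forall_mem_append]
  exact ⟨⟨holds_ants.1, holds_Is⟩, holds_ants.2.2⟩

theorem QRule.validIn_univ {Q : QIneq} {Qs : List QIneq} (hQQs : QRule.{v} Q Qs)
    (hQ : Q.WellHandled) (H : ∀ Q' ∈ Qs, Q'.WellHandled → ValidIn Set.univ box dia Q') :
    ValidIn Set.univ box dia Q := by
  cases hQQs with
  | single l₁ l₂ I i m D hr => exact validIn_univ_of_rule h hr hQ (List.forall_mem_map.1 H)
  | rightAckermann p αs Bs rest ants i m hperm hα hB hrest =>
    intro V hV _ hants
    simp only [QIneq.WellHandled, hperm.mem_iff, List.forall_mem_append, List.forall_mem_map]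
      at hQ hants
    have hwell : WellHandled false (bigOr αs) :=
      bigOr_induction trivial (fun _ _ => And.intro) fun α hα => (hQ.1.1 α hα).1
    have hle : evalIn Set.univ box dia V (bigOr αs) Fin.elim0 ≤ V.var p :=
      evalIn_bigOr_le_iff.2 hants.1.1
    refine H _ List.mem_cons_self ?_ V hV (fun _ => Set.mem_univ _) ?_ <;>
      simp only [QIneq.WellHandled, List.forall_mem_append, List.forall_mem_map]
    · exact ⟨fun I hI => (hQ.1.2 I hI).substVar (b := true) hwell (hB I hI).1 (hB I hI).2.2.1,
        hQ.2⟩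
    · exact ⟨fun I hI => (hants.1.2 I hI).substVar h (b := true) hle (hB I hI).1 (hB I hI).2.2.1,
        hants.2⟩
  | leftAckermann p αs Bs rest ants i m hperm hα hB hrest =>
    intro V hV _ hants
    simp only [QIneq.WellHandled, hperm.mem_iff, List.forall_mem_append, List.forall_mem_map]
      at hQ hants
    have hwell : WellHandled true (bigAnd αs) :=
      bigAnd_induction trivial (fun _ _ => And.intro) fun α hα => (hQ.1.1 α hα).2
    have hle : V.var p ≤ evalIn Set.univ box dia V (bigAnd αs) Fin.elim0 :=
      le_evalIn_bigAnd_iff.2 hants.1.1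
    refine H _ List.mem_cons_self ?_ V hV (fun _ => Set.mem_univ _) ?_ <;>
      simp only [QIneq.WellHandled, List.forall_mem_append, List.forall_mem_map]
    · exact ⟨fun I hI => (hQ.1.2 I hI).substVar (b := false) hwell (hB I hI).1 (hB I hI).2.2.1,
        hQ.2⟩
    · exact ⟨fun I hI => (hants.1.2 I hI).substVar h (b := false) hle (hB I hI).1 (hB I hI).2.2.1,
        hants.2⟩

/-- Handling every binder makes the passage from `K` to the whole lattice sound: the left-hand sides
of a well-handled inequality can only decrease and the right-hand sides can only increase. -/
theorem validIn_univ_of_pure {Q : QIneq} (hK : K.Nonempty) (hQ : Q.WellHandled)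
    (hpure : ∀ I ∈ Q.ants, I.lhs.Pure ∧ I.rhs.Pure)
    (hhandled : ∀ I ∈ Q.ants, I.lhs.AllHandled ∧ I.rhs.AllHandled) (H : ValidIn K box dia Q) :
    ValidIn Set.univ box dia Q := by
  intro V hV _ hants
  obtain ⟨x, hx⟩ := hK
  have hbox := h.box_gc.monotone_u
  have hdia := h.dia_gc.monotone_l
  have evalIn_const {t : Term Bool 0} (ht : t.Pure) :
      evalIn K box dia { V with var := fun _ => x } t Fin.elim0 = evalIn K box dia V t Fin.elim0 :=
    evalIn_congr hbox hdia (fun p hp => absurd (ht p) hp) (fun _ _ => rfl) (fun _ _ => rfl)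
      (fun _ _ => rfl)
  refine H { V with var := fun _ => x } hV (fun _ => hx) fun I hI => ?_
  rw [Holds, evalIn_const (hpure I hI).1, evalIn_const (hpure I hI).2]
  calc evalIn K box dia V I.lhs Fin.elim0
    _ ≤ evalIn Set.univ box dia V I.lhs Fin.elim0 :=
      (eval_le_evalIn hbox hdia V (hhandled I hI).1 _).2 (hQ I hI).1
    _ ≤ evalIn Set.univ box dia V I.rhs Fin.elim0 := hants I hI
    _ ≤ evalIn K box dia V I.rhs Fin.elim0 :=
      (eval_le_evalIn hbox hdia V (hhandled I hI).2 _).1 (hQ I hI).2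

end QRules

/-! ### Preprocessing -/

section Preprocessing

variable {C : Type v} [CompleteLattice C] {K : Set C} {box dia : C → C}

lemma validIn_firstApprox_iff {i m : ℕ} {I : Ineq Unit} :
    ValidIn K box dia (firstApprox i m I) ↔ ∀ V : Assignment C, V.Respects → (∀ p, V.var p ∈ K) →
      V.nom i ≤ evalIn K box dia V I.lhs Fin.elim0 →
      evalIn K box dia V I.rhs Fin.elim0 ≤ V.cnom m → V.nom i ≤ V.cnom m := by
  simp [ValidIn, firstApprox, Holds, evalIn_star, evalIn]

variable (h : IsPerfect box dia)
include h

lemma Distr.evalIn_eq {s : Bool} {n : ℕ} {t t' : Term Unit n} (htt' : Distr s t t')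
    (V : Assignment C) (env : Fin n → C) :
    evalIn K box dia V t env = evalIn K box dia V t' env := by
  induction htt' with
  | dia_or a b => exact h.dia_gc.l_sup
  | or_and a b c => simp only [evalIn, inf_comm _ (evalIn K box dia V c _),
      h.joinPrimeDense.inf_sup_left]
  | and_or a b c => exact h.joinPrimeDense.inf_sup_left _ _ _
  | box_and a b => exact h.box_gc.u_inf
  | and_orN a b c => simp only [evalIn, sup_comm _ (evalIn K box dia V c _),
      h.meetPrimeDense.sup_inf_left]
  | or_andN a b c => exact h.meetPrimeDense.sup_inf_left _ _ _
  | _ => simp_all only [evalIn]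

lemma PreRule.validIn {I : Ineq Unit} {Is : List (Ineq Unit)} (hIIs : PreRule I Is)
    (hbot : ⊥ ∈ K) (htop : ⊤ ∈ K) {i m : ℕ} (H : ValidIn K box dia (firstApprox i m I)) :
    ∀ J ∈ Is, ValidIn K box dia (firstApprox i m J) := by
  simp only [validIn_firstApprox_iff] at H ⊢
  cases hIIs <;>
    simp only [List.mem_cons, List.not_mem_nil, or_false, forall_eq_or_imp, forall_eq]
  case distrL hd => simpa only [hd.evalIn_eq h] using H
  case distrR hd => simpa only [hd.evalIn_eq h] using H
  case orLA =>
    exact ⟨fun V hV hK h1 h2 => H V hV hK (h1.trans le_sup_left) h2,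
      fun V hV hK h1 h2 => H V hV hK (h1.trans le_sup_right) h2⟩
  case andRA =>
    exact ⟨fun V hV hK h1 h2 => H V hV hK h1 (inf_le_left.trans h2),
      fun V hV hK h1 h2 => H V hV hK h1 (inf_le_right.trans h2)⟩
  case elimBot p _ _ _ _ =>
    simp only [evalIn_substVar]
    exact fun V hV hK => H _ (hV.setVar p _) (Assignment.var_setVar_mem hK p hbot)
  case elimTop p _ _ _ _ =>
    simp only [evalIn_substVar]
    exact fun V hV hK => H _ (hV.setVar p _) (Assignment.var_setVar_mem hK p htop)

lemma PreRule.validIn_univ {I : Ineq Unit} {Is : List (Ineq Unit)} (hIIs : PreRule I Is)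
    {i m : ℕ} (H : ∀ J ∈ Is, ValidIn Set.univ box dia (firstApprox i m J)) :
    ValidIn Set.univ box dia (firstApprox i m I) := by
  simp only [validIn_firstApprox_iff] at H ⊢
  intro V hV hK hi hm
  cases hIIs <;>
    simp only [List.mem_cons, List.not_mem_nil, or_false, forall_eq_or_imp, forall_eq] at H
  case distrL hd => exact H V hV hK (hd.evalIn_eq h V _ ▸ hi) hm
  case distrR hd => exact H V hV hK hi (hd.evalIn_eq h V _ ▸ hm)
  case orLA α β _ =>
    obtain ⟨_, rfl | rfl, hle⟩ := h.joinPrimeDense.isJoinPrime (hV.1 i)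
      {evalIn Set.univ box dia V α Fin.elim0, evalIn Set.univ box dia V β Fin.elim0}
      (hi.trans_eq sSup_pair.symm)
    exacts [H.1 V hV hK hle hm, H.2 V hV hK hle hm]
  case andRA β γ =>
    obtain ⟨_, rfl | rfl, hle⟩ := h.meetPrimeDense.isMeetPrime (hV.2 m)
      {evalIn Set.univ box dia V β Fin.elim0, evalIn Set.univ box dia V γ Fin.elim0}
      (sInf_pair.trans_le hm)
    exacts [H.1 V hV hK hi hle, H.2 V hV hK hi hle]
  case elimBot p α β hα hβ =>
    rw [← V.setVar_self p] at hi hm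
    simp only [evalIn_substVar] at H
    exact H V hV hK (hi.trans (evalIn_setVar_le h hα (bot_le (a := V.var p)) _))
      ((evalIn_setVar_le h hβ (bot_le (a := V.var p)) _).trans hm)
  case elimTop p γ χ hγ hχ =>
    rw [← V.setVar_self p] at hi hm
    simp only [evalIn_substVar] at H
    exact H V hV hK (hi.trans (evalIn_setVar_le h hγ (le_top (a := V.var p)) _))
      ((evalIn_setVar_le h hχ (le_top (a := V.var p)) _).trans hm)

end Preprocessing

/-! ### Topological Ackermann lemma -/

section Limits

variable {A : Type u} {C : Type v} [CompleteLattice C]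

lemma map_extend [Lattice A] [BoundedOrder A] (e : BoundedLatticeHom A C) {n : ℕ} (a : A)
    (env : Fin n → A) : extend (e a) (fun i => e (env i)) = fun i => e (extend a env i) :=
  funext fun i => Fin.cases rfl (fun _ => rfl) i

variable [BiheytingAlgebra A] {e : BoundedLatticeHom A C} {bx : InfTopHom A A}
  {di : SupBotHom A A} {box dia : C → C} (he : IsDenseCompact e) (hbox : IsBoxExt e bx box)
  (hdia : IsDiaExt e di dia)

section Family

variable {D : Type*} [Preorder D] [IsDirectedOrder D] [Nonempty D] {V : Assignment C} {p : ℕ}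
  (hvar : ∀ q, q ≠ p → V.var q ∈ Set.range e) {x : C} {y : D → C} {r : Bool}
  (hlim : if r then ClosedLim e x y else OpenLim e x y)
include he hlim hvar

omit [IsDirectedOrder D] in
lemma var_setVar_lim (q : ℕ) :
    ((q = p → r = true) →
        ClosedLim e ((V.setVar p x).var q) fun d => (V.setVar p (y d)).var q) ∧
      ((q = p → (!r) = true) →
        OpenLim e ((V.setVar p x).var q) fun d => (V.setVar p (y d)).var q) := by
  rcases eq_or_ne q p with rfl | hq
  · simp only [V.var_setVar_self]
    cases r
    exacts [⟨fun h => absurd (h trivial) Bool.false_ne_true, fun _ => hlim⟩,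
      ⟨fun _ => hlim, fun h => absurd (h trivial) Bool.false_ne_true⟩]
  · simp only [V.var_setVar_of_ne hq]
    obtain ⟨a, ha⟩ := hvar q hq
    rw [← ha]
    exact ⟨fun _ => .const he (isClosedElt_map e a), fun _ => .const he (isOpenElt_map e a)⟩

variable (hV : V.Respects)
include hbox hdia hV

/-- Fixed points are computed in `A`: only then can a fixed point operator be applied to a limit,
one prefixed point at a time. -/
theorem evalIn_lim {n : ℕ} (t : Term Bool n) (env : Fin n → A) :
    (t.Syn false → t.VarSign p r →
      ClosedLim e (evalIn (Set.range e) box dia (V.setVar p x) t fun i => e (env i))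
        fun d => evalIn (Set.range e) box dia (V.setVar p (y d)) t fun i => e (env i)) ∧
    (t.Syn true → t.VarSign p (!r) →
      OpenLim e (evalIn (Set.range e) box dia (V.setVar p x) t fun i => e (env i))
        fun d => evalIn (Set.range e) box dia (V.setVar p (y d)) t fun i => e (env i)) := by
  have map_lim (a : A) :
      ClosedLim e (e a) (fun _ : D => e a) ∧ OpenLim e (e a) (fun _ : D => e a) :=
    ⟨.const he (isClosedElt_map e a), .const he (isOpenElt_map e a)⟩
  induction t with
  | bot =>
    simp only [evalIn, ← map_bot e]
    exact ⟨fun _ _ => (map_lim _).1, fun _ _ => (map_lim _).2⟩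
  | top =>
    simp only [evalIn, ← map_top e]
    exact ⟨fun _ _ => (map_lim _).1, fun _ _ => (map_lim _).2⟩
  | var q =>
    exact ⟨fun _ => (var_setVar_lim he hvar hlim q).1, fun _ => (var_setVar_lim he hvar hlim q).2⟩
  | fvar i => exact ⟨fun _ _ => (map_lim _).1, fun _ _ => (map_lim _).2⟩
  | nom j =>
    exact ⟨fun _ _ => .const he (he.isClosedElt_of_irreducible (hV.1 j)),
      fun h => absurd h (by simp [Term.Syn])⟩
  | cnom m =>
    exact ⟨fun h => absurd h (by simp [Term.Syn]),
      fun _ _ => .const he (he.isOpenElt_of_irreducible (hV.2 m))⟩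
  | and s t ihs iht =>
    exact ⟨fun h h' => ((ihs env).1 h.1 h'.1).inf he ((iht env).1 h.2 h'.2),
      fun h h' => ((ihs env).2 h.1 h'.1).inf ((iht env).2 h.2 h'.2)⟩
  | or s t ihs iht =>
    exact ⟨fun h h' => ((ihs env).1 h.1 h'.1).sup ((iht env).1 h.2 h'.2),
      fun h h' => ((ihs env).2 h.1 h'.1).sup he ((iht env).2 h.2 h'.2)⟩
  | imp s t ihs iht =>
    exact ⟨fun h h' => .imp he ((ihs env).2 h.1 h'.1) ((iht env).1 h.2 h'.2),
      fun h h' => .imp he ((ihs env).1 h.1 (Bool.not_not r ▸ h'.1)) ((iht env).2 h.2 h'.2)⟩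
  | sub s t ihs iht =>
    exact ⟨fun h h' => .sub he ((ihs env).1 h.1 h'.1) ((iht env).2 h.2 h'.2),
      fun h h' => .sub he ((ihs env).2 h.1 h'.1) ((iht env).1 h.2 (Bool.not_not r ▸ h'.2))⟩
  | dia t ih =>
    exact ⟨fun h h' => .dia he hdia ((ih env).1 h h'),
      fun h h' => .dia he hdia ((ih env).2 h h')⟩
  | box t ih =>
    exact ⟨fun h h' => .box he hbox ((ih env).1 h h'),
      fun h h' => .box he hbox ((ih env).2 h h')⟩
  | bdia t ih =>
    exact ⟨fun h h' => .leftAdj he hbox ((ih env).1 h.2 h'), fun h => absurd h.1 (by simp)⟩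
  | bbox t ih =>
    exact ⟨fun h => absurd h.1 (by simp), fun h h' => .rightAdj he hdia ((ih env).2 h.2 h')⟩
  | mu b t ih =>
    refine ⟨fun h h' => .lfpIn he
      (F := fun c => evalIn (Set.range e) box dia (V.setVar p x) t (extend c fun i => e (env i)))
      (G := fun d c =>
        evalIn (Set.range e) box dia (V.setVar p (y d)) t (extend c fun i => e (env i)))
      fun a => ?_, fun h => absurd h.1 (by simp)⟩
    simpa only [map_extend] using (ih (extend a env)).1 h.2 h'
  | nu b t ih =>
    refine ⟨fun h => absurd h.1 (by simp), fun h h' => .gfpIn he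
      (F := fun c => evalIn (Set.range e) box dia (V.setVar p x) t (extend c fun i => e (env i)))
      (G := fun d c =>
        evalIn (Set.range e) box dia (V.setVar p (y d)) t (extend c fun i => e (env i)))
      fun a => ?_⟩
    simpa only [map_extend] using (ih (extend a env)).2 h.2 h'

lemma evalIn_closedLim {t : Term Bool 0} (ht : t.SynClosed) (hp : t.VarSign p r) :
    ClosedLim e (evalIn (Set.range e) box dia (V.setVar p x) t Fin.elim0)
      fun d => evalIn (Set.range e) box dia (V.setVar p (y d)) t Fin.elim0 := by
  simpa only [Subsingleton.elim (fun i => e (Fin.elim0 i)) Fin.elim0] using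
    (evalIn_lim he hbox hdia hvar hlim hV t Fin.elim0).1 ht hp

lemma evalIn_openLim {t : Term Bool 0} (ht : t.SynOpen) (hp : t.VarSign p (!r)) :
    OpenLim e (evalIn (Set.range e) box dia (V.setVar p x) t Fin.elim0)
      fun d => evalIn (Set.range e) box dia (V.setVar p (y d)) t Fin.elim0 := by
  simpa only [Subsingleton.elim (fun i => e (Fin.elim0 i)) Fin.elim0] using
    (evalIn_lim he hbox hdia hvar hlim hV t Fin.elim0).2 ht hp

lemma eventually_holds_of_lim {I : Ineq Bool} (hl : I.lhs.VarSign p r) (hlc : I.lhs.SynClosed)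
    (hr : I.rhs.VarSign p (!r)) (hro : I.rhs.SynOpen)
    (h : Holds (Set.range e) box dia (V.setVar p x) I) :
    ∀ᶠ d in Filter.atTop, Holds (Set.range e) box dia (V.setVar p (y d)) I := by
  have lhs_lim := evalIn_closedLim he hbox hdia hvar hlim hV hlc hl
  have rhs_lim := evalIn_openLim he hbox hdia hvar hlim hV hro hr
  obtain ⟨a, hla, har⟩ :=
    he.exists_between (lhs_lim.isClosedElt he) (rhs_lim.isOpenElt he) h
  obtain ⟨d₁, hd₁⟩ := lhs_lim.exists_le_map hla
  obtain ⟨d₂, hd₂⟩ := rhs_lim.exists_map_le har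
  filter_upwards [Filter.eventually_ge_atTop d₁, Filter.eventually_ge_atTop d₂] with d h₁ h₂
  exact (lhs_lim.anti h₁).trans (hd₁.trans (hd₂.trans (rhs_lim.mono h₂)))

lemma exists_forall_holds_of_lim {Bs : List (Ineq Bool)}
    (hB : ∀ I ∈ Bs, I.lhs.VarSign p r ∧ I.lhs.SynClosed ∧ I.rhs.VarSign p (!r) ∧ I.rhs.SynOpen)
    (h : ∀ I ∈ Bs, Holds (Set.range e) box dia (V.setVar p x) I) :
    ∃ d, ∀ I ∈ Bs, Holds (Set.range e) box dia (V.setVar p (y d)) I :=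
  ((Filter.eventually_all_finite Bs.finite_toSet).2 fun I hI =>
    have ⟨hl, hlc, hr, hro⟩ := hB I hI
    eventually_holds_of_lim he hbox hdia hvar hlim hV hl hlc hr hro (h I hI)).exists

end Family

include he

lemma closedLim_map_of_isClosedElt {k : C} (hk : IsClosedElt e k) :
    ClosedLim e k fun a : {a : A // k ≤ e a}ᵒᵈ => e (OrderDual.ofDual a).1 := by
  refine ⟨fun a => a.2, fun a b hab => OrderHomClass.mono e hab, fun o ho hko => ?_⟩
  obtain ⟨a, hka, hao⟩ := he.exists_between hk ho hko
  exact ⟨⟨a, hka⟩, a, le_rfl, hao⟩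

lemma openLim_map_of_isOpenElt {o : C} (ho : IsOpenElt e o) :
    OpenLim e o fun a : {a : A // e a ≤ o} => e a.1 := by
  refine ⟨fun a => a.2, fun a b hab => OrderHomClass.mono e hab, fun k hk hko => ?_⟩
  obtain ⟨a, hka, hao⟩ := he.exists_between hk ho hko
  exact ⟨⟨a, hao⟩, a, le_rfl, hka⟩

variable {V : Assignment C} {p : ℕ} (hV : V.Respects) (hvar : ∀ q, V.var q ∈ Set.range e)
include hbox hdia hV hvar

lemma isClosedElt_evalIn {t : Term Bool 0} (ht : t.SynClosed) (hp : t.VarFree p) :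
    IsClosedElt e (evalIn (Set.range e) box dia V t Fin.elim0) := by
  obtain ⟨a, ha⟩ := hvar p
  have hlim : ClosedLim e (V.var p) fun _ : Unit => V.var p :=
    .const he (ha ▸ isClosedElt_map e a)
  simpa only [V.setVar_self] using (evalIn_closedLim he hbox hdia (r := true)
    (fun q _ => hvar q) hlim hV ht (hp.varSign _)).isClosedElt he

lemma isOpenElt_evalIn {t : Term Bool 0} (ht : t.SynOpen) (hp : t.VarFree p) :
    IsOpenElt e (evalIn (Set.range e) box dia V t Fin.elim0) := by
  obtain ⟨a, ha⟩ := hvar p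
  have hlim : ClosedLim e (V.var p) fun _ : Unit => V.var p :=
    .const he (ha ▸ isClosedElt_map e a)
  simpa only [V.setVar_self] using (evalIn_openLim he hbox hdia (r := true)
    (fun q _ => hvar q) hlim hV ht (hp.varSign _)).isOpenElt he

lemma exists_forall_holds_of_isClosedElt {k : C} (hk : IsClosedElt e k) {Bs : List (Ineq Bool)}
    (hB : ∀ I ∈ Bs, I.lhs.VarSign p true ∧ I.lhs.SynClosed ∧ I.rhs.VarSign p false ∧
      I.rhs.SynOpen)
    (h : ∀ I ∈ Bs, Holds (Set.range e) box dia (V.setVar p k) I) :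
    ∃ a, k ≤ e a ∧ ∀ I ∈ Bs, Holds (Set.range e) box dia (V.setVar p (e a)) I := by
  have : IsDirectedOrder {a : A // k ≤ e a}ᵒᵈ := ⟨fun a b =>
    ⟨⟨a.1 ⊓ b.1, by rw [map_inf]; exact le_inf a.2 b.2⟩, inf_le_left (a := a.1),
      inf_le_right (b := b.1)⟩⟩
  have : Nonempty {a : A // k ≤ e a}ᵒᵈ := ⟨⟨⊤, by simp⟩⟩
  obtain ⟨d, hd⟩ := exists_forall_holds_of_lim he hbox hdia (r := true) (fun q _ => hvar q)
    (closedLim_map_of_isClosedElt he hk) hV hB h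
  exact ⟨_, d.2, hd⟩

lemma exists_forall_holds_of_isOpenElt {o : C} (ho : IsOpenElt e o) {Bs : List (Ineq Bool)}
    (hB : ∀ I ∈ Bs, I.lhs.VarSign p false ∧ I.lhs.SynClosed ∧ I.rhs.VarSign p true ∧
      I.rhs.SynOpen)
    (h : ∀ I ∈ Bs, Holds (Set.range e) box dia (V.setVar p o) I) :
    ∃ a, e a ≤ o ∧ ∀ I ∈ Bs, Holds (Set.range e) box dia (V.setVar p (e a)) I := by
  have : IsDirectedOrder {a : A // e a ≤ o} := ⟨fun a b =>
    ⟨⟨a.1 ⊔ b.1, by rw [map_sup]; exact sup_le a.2 b.2⟩, le_sup_left (a := a.1),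
      le_sup_right (b := b.1)⟩⟩
  have : Nonempty {a : A // e a ≤ o} := ⟨⟨⊥, by simp⟩⟩
  obtain ⟨d, hd⟩ := exists_forall_holds_of_lim he hbox hdia (r := false) (fun q _ => hvar q)
    (openLim_map_of_isOpenElt he ho) hV hB h
  exact ⟨_, d.2, hd⟩

end Limits

section AckermannInRange

variable {A : Type u} [BiheytingAlgebra A] {C : Type v} [CompleteLattice C]
  {e : BoundedLatticeHom A C} {bx : InfTopHom A A} {di : SupBotHom A A} {box dia : C → C}
  (he : IsDenseCompact e) (hbox : IsBoxExt e bx box) (hdia : IsDiaExt e di dia)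
include he hbox hdia

theorem QRule.validIn_range {Q : QIneq} {Qs : List QIneq} (hQQs : QRule.{v} Q Qs)
    (H : ValidIn (Set.range e) box dia Q) : ∀ Q' ∈ Qs, ValidIn (Set.range e) box dia Q' := by
  have h := he.isPerfect hbox hdia
  cases hQQs with
  | single l₁ l₂ I i m D hr =>
    refine List.forall_mem_map.2 fun Is hIs V hV hK hants => H V hV hK ?_
    simp only [List.forall_mem_append, List.forall_mem_cons] at hants ⊢
    exact ⟨hants.1.1, Rule.holds h hr hIs hants.1.2, hants.2⟩
  | rightAckermann p αs Bs rest ants i m hperm hα hB hrest =>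
    refine List.forall_mem_singleton.2 fun V hV hK hants => ?_
    simp only [List.forall_mem_append, List.forall_mem_map, Holds, Ineq.substVar,
      evalIn_substVar] at hants
    have bigOr_closed := isClosedElt_evalIn he hbox hdia hV hK
      (bigOr_induction (P := Term.SynClosed) trivial (fun _ _ => And.intro) fun α h => (hα α h).2)
      (bigOr_induction (P := Term.VarFree p) trivial (fun _ _ => And.intro) fun α h => (hα α h).1)
    obtain ⟨a, hka, ha⟩ :=
      exists_forall_holds_of_isClosedElt he hbox hdia hV hK bigOr_closed hB hants.1
    refine H (V.setVar p (e a)) (hV.setVar p _) (Assignment.var_setVar_mem hK p ⟨_, rfl⟩) ?_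
    simp only [hperm.mem_iff, List.forall_mem_append, List.forall_mem_map]
    refine ⟨⟨fun α hαs => ?_, ha⟩, fun I hI => ?_⟩ <;> rw [Holds]
    · rw [evalIn_setVar_of_varFree h (hα α hαs).1, evalIn, V.var_setVar_self]
      exact evalIn_bigOr_le_iff.1 hka α hαs
    · rw [evalIn_setVar_of_varFree h (hrest I hI).1, evalIn_setVar_of_varFree h (hrest I hI).2]
      exact hants.2 I hI
  | leftAckermann p αs Bs rest ants i m hperm hα hB hrest =>
    refine List.forall_mem_singleton.2 fun V hV hK hants => ?_
    simp only [List.forall_mem_append, List.forall_mem_map, Holds, Ineq.substVar,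
      evalIn_substVar] at hants
    have bigAnd_open := isOpenElt_evalIn he hbox hdia hV hK
      (bigAnd_induction (P := Term.SynOpen) trivial (fun _ _ => And.intro) fun α h => (hα α h).2)
      (bigAnd_induction (P := Term.VarFree p) trivial (fun _ _ => And.intro) fun α h => (hα α h).1)
    obtain ⟨a, hao, ha⟩ :=
      exists_forall_holds_of_isOpenElt he hbox hdia hV hK bigAnd_open hB hants.1
    refine H (V.setVar p (e a)) (hV.setVar p _) (Assignment.var_setVar_mem hK p ⟨_, rfl⟩) ?_
    simp only [hperm.mem_iff, List.forall_mem_append, List.forall_mem_map]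
    refine ⟨⟨fun α hαs => ?_, ha⟩, fun I hI => ?_⟩ <;> rw [Holds]
    · rw [evalIn_setVar_of_varFree h (hα α hαs).1, evalIn, V.var_setVar_self]
      exact le_evalIn_bigAnd_iff.1 hao α hαs
    · rw [evalIn_setVar_of_varFree h (hrest I hI).1, evalIn_setVar_of_varFree h (hrest I hI).2]
      exact hants.2 I hI

end AckermannInRange

/-! ### The canonical extension of a modal bi-Heyting algebra -/

section CanonicalExtension

variable (A : Type u) [ModalBiheytingAlgebra A]

/-- The box of a modal bi-Heyting algebra, as a homomorphism. -/
def ModalBiheytingAlgebra.boxHom : InfTopHom A A where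
  toFun := box
  map_inf' := box_inf
  map_top' := box_top

/-- The diamond of a modal bi-Heyting algebra, as a homomorphism. -/
def ModalBiheytingAlgebra.diaHom : SupBotHom A A where
  toFun := dia
  map_sup' := dia_sup
  map_bot' := dia_bot

variable {A} {C : Type v} [CompleteLattice C] {e : BoundedLatticeHom A C}

lemma IsCanonicalExtension.isDenseCompact (he : IsCanonicalExtension e) : IsDenseCompact e where
  le_of_forall_closed c d h := by
    obtain ⟨F, rfl⟩ := he.join_of_meets c
    exact sSup_le (Set.forall_mem_image.2 fun S hS =>
      h _ ⟨S, rfl⟩ (le_sSup (Set.mem_image_of_mem _ hS)))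
  le_of_forall_open c d h := by
    obtain ⟨F, rfl⟩ := he.meet_of_joins d
    exact le_sInf (Set.forall_mem_image.2 fun S hS =>
      h _ ⟨S, rfl⟩ (sInf_le (Set.mem_image_of_mem _ hS)))
  compact := he.compact

lemma le_piExt_iff {f : A → A} {x c : C} :
    x ≤ piExt e f c ↔ ∀ k o, IsClosedElt e k → IsOpenElt e o → k ≤ c → c ≤ o →
      x ≤ sSup ((fun a => e (f a)) '' {a | k ≤ e a ∧ e a ≤ o}) := by
  rw [piExt, le_sInf_iff]
  refine ⟨fun h k o hk ho hkc hco => h _ ⟨k, hk, o, ho, hkc, hco, rfl⟩, ?_⟩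
  rintro h _ ⟨k, hk, o, ho, hkc, hco, rfl⟩
  exact h k o hk ho hkc hco

lemma sigmaExt_le_iff {f : A → A} {x c : C} :
    sigmaExt e f c ≤ x ↔ ∀ k o, IsClosedElt e k → IsOpenElt e o → k ≤ c → c ≤ o →
      sInf ((fun a => e (f a)) '' {a | k ≤ e a ∧ e a ≤ o}) ≤ x := by
  rw [sigmaExt, sSup_le_iff]
  refine ⟨fun h k o hk ho hkc hco => h _ ⟨k, hk, o, ho, hkc, hco, rfl⟩, ?_⟩
  rintro h _ ⟨k, hk, o, ho, hkc, hco, rfl⟩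
  exact h k o hk ho hkc hco

namespace IsDenseCompact

variable (he : IsDenseCompact e)
include he

lemma isBoxExt_piExt (f : InfTopHom A A) : IsBoxExt e f (piExt e f) :=
  he.isBoxExt_of_le_iff f fun _ _ => le_piExt_iff

lemma isDiaExt_sigmaExt (f : SupBotHom A A) : IsDiaExt e f (sigmaExt e f) := by
  have le_iff (x c : C) : sigmaExt e f c ≤ x ↔ ∀ o k, IsOpenElt e o → IsClosedElt e k → c ≤ o →
      k ≤ c → sInf ((fun a => e (f a)) '' {a | e a ≤ o ∧ k ≤ e a}) ≤ x := by
    simp only [sigmaExt_le_iff, and_comm (a := e _ ≤ _)]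
    exact ⟨fun h o k ho hk hco hkc => h k o hk ho hkc hco,
      fun h k o hk ho hkc hco => h o k ho hk hco hkc⟩
  exact IsDenseCompact.isBoxExt_of_le_iff (C := Cᵒᵈ) he.dual f.dual
    (F := (sigmaExt e f : C → C)) le_iff

end IsDenseCompact

end CanonicalExtension

/-! ### Transfinite iteration -/

section Iteration

variable {A : Type u} [PartialOrder A]

/-- `g` is the transfinite sequence of iterates of `f` starting at `⊥`. -/
structure IsIteration [OrderBot A] (f : A → A) (g : Ordinal.{u} → A) : Prop where
  zero : g 0 = ⊥
  succ : ∀ α, g (Order.succ α) = f (g α)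
  limit : ∀ l, Order.IsSuccLimit l → IsLUB (g '' Set.Iio l) (g l)

namespace IsIteration

variable [OrderBot A] {f : A → A} {g : Ordinal.{u} → A} (h : IsIteration f g) (hf : Monotone f)
include h hf

lemma le_of_map_le {a : A} (ha : f a ≤ a) (α : Ordinal.{u}) : g α ≤ a := by
  induction α using Ordinal.limitRecOn with
  | zero => exact h.zero.trans_le bot_le
  | add_one α ih =>
    rw [← Order.succ_eq_add_one, h.succ]
    exact (hf ih).trans ha
  | limit l hl ih => exact (h.limit l hl).2 (Set.forall_mem_image.2 ih)

lemma le_map (α : Ordinal.{u}) : g α ≤ f (g α) := by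
  induction α using Ordinal.limitRecOn with
  | zero => exact h.zero.trans_le bot_le
  | add_one α ih =>
    rw [← Order.succ_eq_add_one, h.succ]
    exact hf ih
  | limit l hl ih =>
    refine (h.limit l hl).2 (Set.forall_mem_image.2 fun β hβ => (ih β hβ).trans (hf ?_))
    exact (h.limit l hl).1 (Set.mem_image_of_mem g hβ)

lemma monotone : Monotone g := by
  intro β α hβα
  induction α using Ordinal.limitRecOn with
  | zero => rw [nonpos_iff_eq_zero.1 hβα]
  | add_one α ih =>
    rcases hβα.eq_or_lt with rfl | hβα
    · exact le_rfl
    · rw [← Order.succ_eq_add_one] at hβα ⊢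
      exact (ih (Order.lt_succ_iff.1 hβα)).trans ((h.le_map hf α).trans_eq (h.succ α).symm)
  | limit l hl _ =>
    rcases hβα.eq_or_lt with rfl | hβα
    · exact le_rfl
    · exact (h.limit l hl).1 (Set.mem_image_of_mem g hβα)

-- Otherwise the iterates would be an injection of the ordinals into `A`.
lemma exists_fixedPoint : ∃ α, f (g α) = g α := by
  by_contra! hne
  refine not_injective_of_ordinal g (StrictMono.injective fun β α hβα => ?_)
  calc g β < f (g β) := (h.le_map hf β).lt_of_ne (hne β).symm
    _ = g (Order.succ β) := (h.succ β).symm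
    _ ≤ g α := h.monotone hf (Order.succ_le_of_lt hβα)

lemma isLeast {b : A} (hb : IsLUB (Set.range g) b) : IsLeast {a | f a ≤ a} b := by
  obtain ⟨α, hα⟩ := h.exists_fixedPoint hf
  have hbα : b = g α := le_antisymm
    (hb.2 (Set.forall_mem_range.2 (h.le_of_map_le hf hα.le))) (hb.1 (Set.mem_range_self α))
  rw [hbα]
  exact ⟨hα.le, fun a ha => h.le_of_map_le hf ha α⟩

end IsIteration

end Iteration

section Values

variable {A : Type u} [ModalBiheytingAlgebra A] {f : A → A} {b : A}

lemma IsMu₂.isLeast (hf : Monotone f) (h : IsMu₂ f b) : IsLeast {a | f a ≤ a} b := by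
  obtain ⟨g, hzero, hsucc, hlimit, hb⟩ := h
  exact IsIteration.isLeast ⟨hzero, hsucc, hlimit⟩ hf hb

lemma IsNu₂.isGreatest (hf : Monotone f) (h : IsNu₂ f b) : IsGreatest {a | a ≤ f a} b := by
  obtain ⟨g, hzero, hsucc, hlimit, hb⟩ := h
  exact IsIteration.isLeast (A := Aᵒᵈ) (f := f) (g := g) ⟨hzero, hsucc, hlimit⟩ hf.dual hb

end Values

/-! ### Values of terms in the algebra and in its canonical extension -/

section Comparison

variable {A : Type u} {C : Type v} [CompleteLattice C]

section FixedPoints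

variable [Lattice A] [BoundedOrder A] {e : BoundedLatticeHom A C} (he : IsDenseCompact e)
  {f : A → A} {F : C → C} (hF : ∀ a, e (f a) = F (e a)) {b : A}
include he hF

lemma map_isLeast_eq_lfpIn (hb : IsLeast {a | f a ≤ a} b) : e b = lfpIn (Set.range e) F := by
  refine le_antisymm (le_sInf ?_) (sInf_le ⟨⟨b, rfl⟩, hF b ▸ he.map_le_map_iff.2 hb.1⟩)
  rintro _ ⟨⟨a, rfl⟩, ha⟩
  rw [← hF, he.map_le_map_iff] at ha
  exact he.map_le_map_iff.2 (hb.2 ha)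

lemma map_isGreatest_eq_gfpIn (hb : IsGreatest {a | a ≤ f a} b) :
    e b = gfpIn (Set.range e) F :=
  map_isLeast_eq_lfpIn (C := Cᵒᵈ) he.dual (f := f) hF hb

end FixedPoints

lemma monotone_of_map_eq_evalIn [BiheytingAlgebra A] {e : BoundedLatticeHom A C}
    (he : IsDenseCompact e) {K : Set C} {box dia : C → C} (hbox : Monotone box)
    (hdia : Monotone dia) {β : Type} {n : ℕ} {t : Term β (n + 1)} (ht : t.FVarSign 0 true)
    {V : Assignment C} {env : Fin n → A} {f : A → A}
    (hf : ∀ a, e (f a) = evalIn K box dia V t (extend (e a) fun i => e (env i))) :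
    Monotone f := by
  intro a a' haa'
  rw [← he.map_le_map_iff, hf, hf]
  refine evalIn_mono hbox hdia ⟨fun _ _ => le_rfl, fun _ _ => le_rfl, ?_, ?_, fun _ _ => rfl,
    fun _ _ => rfl⟩
  · exact Fin.cases (fun _ => he.map_le_map_iff.2 haa') fun _ _ => le_rfl
  · exact Fin.cases (fun h => absurd ht h) fun _ _ => le_rfl

variable [ModalBiheytingAlgebra A] {e : BoundedLatticeHom A C} {box dia : C → C}
  (he : IsDenseCompact e) (hbox : IsBoxExt e (ModalBiheytingAlgebra.boxHom A) box)
  (hdia : IsDiaExt e (ModalBiheytingAlgebra.diaHom A) dia)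
include he hbox hdia

lemma val_and_map_eq_evalIn {v : ℕ → A} {V : Assignment C} (hV : ∀ p, V.var p = e (v p)) {n : ℕ}
    {t : Term Unit n} (ht : IsMuTerm t) {env : Fin n → A} {b : A}
    (hb : Val IsMu₂ IsNu₂ v t env b) :
    Val IsMu IsNu v t env b ∧
      e b = evalIn (Set.range e) box dia V t (fun i => e (env i)) := by
  have h := he.isPerfect hbox hdia
  induction t generalizing b with
  | nom | cnom | bdia | bbox => exact hb.elim
  | bot => exact ⟨hb, by subst hb; exact map_bot e⟩
  | top => exact ⟨hb, by subst hb; exact map_top e⟩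
  | var p => exact ⟨hb, by subst hb; exact (hV p).symm⟩
  | fvar i => exact ⟨hb, by subst hb; rfl⟩
  | and s t ihs iht =>
    obtain ⟨x, y, hx, hy, rfl⟩ := hb
    obtain ⟨hx, hex⟩ := ihs ⟨ht.1.1, ht.2.1⟩ hx
    obtain ⟨hy, hey⟩ := iht ⟨ht.1.2, ht.2.2⟩ hy
    exact ⟨⟨x, y, hx, hy, rfl⟩, by rw [map_inf, hex, hey, evalIn]⟩
  | or s t ihs iht =>
    obtain ⟨x, y, hx, hy, rfl⟩ := hb
    obtain ⟨hx, hex⟩ := ihs ⟨ht.1.1, ht.2.1⟩ hx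
    obtain ⟨hy, hey⟩ := iht ⟨ht.1.2, ht.2.2⟩ hy
    exact ⟨⟨x, y, hx, hy, rfl⟩, by rw [map_sup, hex, hey, evalIn]⟩
  | imp s t ihs iht =>
    obtain ⟨x, y, hx, hy, rfl⟩ := hb
    obtain ⟨hx, hex⟩ := ihs ⟨ht.1.1, ht.2.1⟩ hx
    obtain ⟨hy, hey⟩ := iht ⟨ht.1.2, ht.2.2⟩ hy
    exact ⟨⟨x, y, hx, hy, rfl⟩, by rw [he.map_himp, hex, hey, evalIn]⟩
  | sub s t ihs iht =>
    obtain ⟨x, y, hx, hy, rfl⟩ := hb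
    obtain ⟨hx, hex⟩ := ihs ⟨ht.1.1, ht.2.1⟩ hx
    obtain ⟨hy, hey⟩ := iht ⟨ht.1.2, ht.2.2⟩ hy
    exact ⟨⟨x, y, hx, hy, rfl⟩, by rw [he.map_sdiff, hex, hey, evalIn]⟩
  | dia t ih =>
    obtain ⟨x, hx, rfl⟩ := hb
    obtain ⟨hx, hex⟩ := ih ht hx
    exact ⟨⟨x, hx, rfl⟩, (hdia.dual.map_apply he.dual x).symm.trans (congrArg dia hex)⟩
  | box t ih =>
    obtain ⟨x, hx, rfl⟩ := hb
    obtain ⟨hx, hex⟩ := ih ht hx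
    exact ⟨⟨x, hx, rfl⟩, (hbox.map_apply he x).symm.trans (congrArg box hex)⟩
  | mu _ t ih =>
    obtain ⟨f, hf, hb⟩ := hb
    have ih (a) := ih ⟨ht.1, ht.2.2⟩ (hf a)
    simp only [← map_extend] at ih
    have hleast := hb.isLeast (monotone_of_map_eq_evalIn he h.box_gc.monotone_u
      h.dia_gc.monotone_l ht.2.1 fun a => (ih a).2)
    exact ⟨⟨f, fun a => (ih a).1, hleast.isGLB⟩,
      map_isLeast_eq_lfpIn he (fun a => (ih a).2) hleast⟩
  | nu _ t ih =>
    obtain ⟨f, hf, hb⟩ := hb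
    have ih (a) := ih ⟨ht.1, ht.2.2⟩ (hf a)
    simp only [← map_extend] at ih
    have hgreatest := hb.isGreatest (monotone_of_map_eq_evalIn he h.box_gc.monotone_u
      h.dia_gc.monotone_l ht.2.1 fun a => (ih a).2)
    exact ⟨⟨f, fun a => (ih a).1, hgreatest.isLUB⟩,
      map_isGreatest_eq_gfpIn he (fun a => (ih a).2) hgreatest⟩

end Comparison

/-! ### Canonicity -/

section Runs

variable {C : Type v} [CompleteLattice C] {K : Set C} {box dia : C → C} (h : IsPerfect box dia)
  {i m : ℕ} {Is Js : List (Ineq Unit)}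
include h

lemma forall_validIn_of_preSteps (hIsJs : Relation.ReflTransGen PreStep Is Js) (hbot : ⊥ ∈ K)
    (htop : ⊤ ∈ K) (H : ∀ I ∈ Is, ValidIn K box dia (firstApprox i m I)) :
    ∀ J ∈ Js, ValidIn K box dia (firstApprox i m J) := by
  induction hIsJs with
  | refl => exact H
  | tail _ hstep ih =>
    obtain ⟨l₁, l₂, hrule⟩ := hstep
    simp only [List.forall_mem_append, List.forall_mem_cons] at ih ⊢
    exact ⟨⟨ih.1, hrule.validIn h hbot htop ih.2.1⟩, ih.2.2⟩

lemma forall_validIn_univ_of_preSteps (hIsJs : Relation.ReflTransGen PreStep Is Js)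
    (H : ∀ J ∈ Js, ValidIn Set.univ box dia (firstApprox i m J)) :
    ∀ I ∈ Is, ValidIn Set.univ box dia (firstApprox i m I) := by
  induction hIsJs using Relation.ReflTransGen.head_induction_on with
  | refl => exact H
  | head hstep _ ih =>
    obtain ⟨l₁, l₂, hrule⟩ := hstep
    simp only [List.forall_mem_append, List.forall_mem_cons] at ih ⊢
    exact ⟨ih.1.1, hrule.validIn_univ h ih.1.2, ih.2⟩

end Runs

section Basic

variable {β : Type} {n : ℕ} {t : Term β n}

lemma Term.Basic.nomFree (ht : t.Basic) (j : ℕ) : t.NomFree j := by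
  induction t <;> simp_all [Term.Basic, Term.NomFree]

lemma Term.Basic.cnomFree (ht : t.Basic) (m : ℕ) : t.CnomFree m := by
  induction t <;> simp_all [Term.Basic, Term.CnomFree]

end Basic

lemma IsPerfect.eval_le_of_validIn_firstApprox {C : Type v} [CompleteLattice C] {box dia : C → C}
    (h : IsPerfect box dia) {φ ψ : Term Unit 0} (hφ : φ.Basic) (hψ : ψ.Basic) {i m : ℕ}
    (H : ValidIn Set.univ box dia (firstApprox i m ⟨φ, ψ⟩)) (V : Assignment C) :
    eval box dia V φ Fin.elim0 ≤ eval box dia V ψ Fin.elim0 := by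
  rw [validIn_firstApprox_iff] at H
  rw [← evalIn_univ, ← evalIn_univ]
  refine h.joinPrimeDense _ _ fun j hj hjφ => h.meetPrimeDense _ _ fun n hn hψn => ?_
  have evalIn_const {t : Term Unit 0} (ht : t.Basic) :
      evalIn Set.univ box dia ⟨V.var, fun _ => j, fun _ => n⟩ t Fin.elim0 =
        evalIn Set.univ box dia V t Fin.elim0 :=
    evalIn_congr h.box_gc.monotone_u h.dia_gc.monotone_l (fun _ _ => rfl) (fun _ _ => rfl)
      (fun k hk => absurd (ht.nomFree k) hk) (fun k hk => absurd (ht.cnomFree k) hk)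
  exact H ⟨V.var, fun _ => j, fun _ => n⟩ ⟨fun _ => hj.irreducible, fun _ => hn.irreducible⟩
    (fun _ => Set.mem_univ _) (hjφ.trans_eq (evalIn_const hφ).symm)
    ((evalIn_const hψ).trans_le hψn)

lemma firstApprox_wellHandled (i m : ℕ) (I : Ineq Unit) : (firstApprox i m I).WellHandled := by
  simp only [QIneq.WellHandled, firstApprox, List.mem_cons, List.not_mem_nil, or_false,
    forall_eq_or_imp, forall_eq]
  exact ⟨⟨trivial, wellHandled_star _ _⟩, wellHandled_star _ _, trivial⟩

section CanonicalExtension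

variable {A : Type u} [ModalBiheytingAlgebra A] {C : Type v} [CompleteLattice C]
  {e : BoundedLatticeHom A C} {box dia : C → C} (he : IsDenseCompact e)
  (hbox : IsBoxExt e (ModalBiheytingAlgebra.boxHom A) box)
  (hdia : IsDiaExt e (ModalBiheytingAlgebra.diaHom A) dia)
include he hbox hdia

-- `QRule.validIn_range` goes down a run, `QRule.validIn_univ` comes back up.
lemma validIn_univ_of_validIn_range_of_steps {Qs Qs' : List QIneq}
    (hQsQs' : Relation.ReflTransGen Step.{v} Qs Qs')
    (H : ∀ Q ∈ Qs', Q.WellHandled → ValidIn (Set.range e) box dia Q →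
      ValidIn Set.univ box dia Q) :
    ∀ Q ∈ Qs, Q.WellHandled → ValidIn (Set.range e) box dia Q → ValidIn Set.univ box dia Q := by
  induction hQsQs' using Relation.ReflTransGen.head_induction_on with
  | refl => exact H
  | head hstep _ ih =>
    obtain ⟨l₁, l₂, hrule⟩ := hstep
    simp only [List.forall_mem_append, List.forall_mem_cons] at ih ⊢
    exact ⟨ih.1.1, fun hwell hvalid =>
      hrule.validIn_univ (he.isPerfect hbox hdia) hwell fun Q' hQ' hwell' =>
        ih.1.2 Q' hQ' hwell' (hrule.validIn_range he hbox hdia hvalid Q' hQ'), ih.2⟩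

lemma validIn_range_of_models {φ ψ : Term Unit 0} (hφ : IsMuTerm φ) (hψ : IsMuTerm ψ)
    (hφA : ∀ v : ℕ → A, ∃ a, Val IsMu₂ IsNu₂ v φ Fin.elim0 a)
    (hψA : ∀ v : ℕ → A, ∃ a, Val IsMu₂ IsNu₂ v ψ Fin.elim0 a) (hval : Models A φ ψ) (i m : ℕ) :
    ValidIn (Set.range e) box dia (firstApprox i m ⟨φ, ψ⟩) := by
  rw [validIn_firstApprox_iff]
  intro V _ hK hi hm
  choose v hv using hK
  obtain ⟨a, ha⟩ := hφA v
  obtain ⟨b, hb⟩ := hψA v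
  obtain ⟨ha, hea⟩ := val_and_map_eq_evalIn he hbox hdia (fun p => (hv p).symm) hφ ha
  obtain ⟨hb, heb⟩ := val_and_map_eq_evalIn he hbox hdia (fun p => (hv p).symm) hψ hb
  rw [Subsingleton.elim (fun i => e (Fin.elim0 i)) Fin.elim0] at hea heb
  calc V.nom i ≤ e a := hi.trans_eq hea.symm
    _ ≤ e b := he.map_le_map_iff.2 (hval v a b ha hb)
    _ ≤ V.cnom m := heb.trans_le hm

end CanonicalExtension

end MuCanon

theorem mainTheorem3_general {A : Type u} [MuCanon.ModalBiheytingAlgebra A]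
    {C : Type v} [CompleteLattice C] (e : BoundedLatticeHom A C)
    (he : MuCanon.IsCanonicalExtension e)
    (φ ψ : MuCanon.Term Unit 0) (hφ : MuCanon.IsMuTerm φ) (hψ : MuCanon.IsMuTerm ψ)
    (hφA : ∀ v : ℕ → A, ∃ a, MuCanon.Val MuCanon.IsMu₂ MuCanon.IsNu₂ v φ Fin.elim0 a)
    (hψA : ∀ v : ℕ → A, ∃ a, MuCanon.Val MuCanon.IsMu₂ MuCanon.IsNu₂ v ψ Fin.elim0 a)
    (hrun : MuCanon.ProperRunSucceeds.{v} φ ψ) (hval : MuCanon.Models A φ ψ) :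
    MuCanon.CanonicalModels e φ ψ := by
  obtain ⟨Qs, ⟨Is, i, m, hpre, hsteps⟩, hpure, hhandled⟩ := hrun
  have hdc := he.isDenseCompact
  have hbox := hdc.isBoxExt_piExt (MuCanon.ModalBiheytingAlgebra.boxHom A)
  have hdia := hdc.isDiaExt_sigmaExt (MuCanon.ModalBiheytingAlgebra.diaHom A)
  have hperf := hdc.isPerfect hbox hdia
  have valid_range := MuCanon.forall_validIn_of_preSteps hperf hpre
    (K := Set.range e) ⟨⊥, map_bot e⟩ ⟨⊤, map_top e⟩ (List.forall_mem_singleton.2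
      (MuCanon.validIn_range_of_models hdc hbox hdia hφ hψ hφA hψA hval i m))
  have univ_of_range := MuCanon.validIn_univ_of_validIn_range_of_steps hdc hbox hdia hsteps
    fun Q hQ hwell => MuCanon.validIn_univ_of_pure hperf (Set.range_nonempty e) hwell
      (hpure Q hQ) (hhandled Q hQ)
  have valid_univ := MuCanon.forall_validIn_univ_of_preSteps hperf hpre fun I hI =>
    univ_of_range _ (List.mem_map_of_mem hI) (MuCanon.firstApprox_wellHandled i m I)
      (valid_range I hI)
  exact hperf.eval_le_of_validIn_firstApprox hφ.1 hψ.1 (valid_univ _ List.mem_cons_self)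

theorem mainTheorem3 {A : Type u} [MuCanon.ModalBiheytingAlgebra A] (hA : MuCanon.SecondKind A)
    {C : Type v} [CompleteLattice C] (e : BoundedLatticeHom A C)
    (he : MuCanon.IsCanonicalExtension e)
    (φ ψ : MuCanon.Term Unit 0) (hφ : MuCanon.IsMuTerm φ) (hψ : MuCanon.IsMuTerm ψ)
    (hrun : MuCanon.ProperRunSucceeds.{v} φ ψ) (hval : MuCanon.Models A φ ψ) :
    MuCanon.CanonicalModels e φ ψ :=
  mainTheorem3_general e he φ ψ hφ hψ (fun v => hA 0 φ hφ v Fin.elim0)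
    (fun v => hA 0 ψ hψ v Fin.elim0) hrun hval
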